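/- **Theorem 1.** Let $G$ be a compact gauge group with totally antisymmetric structure constants $C^{abc}$ and let $T^a$ be the Hermitian generators of $G$ in a unitary representation, $[T^a,T^b]=iC^{abc}T^c$. Consider in four-dimensional Minkowski space, $\eta_{\mu\nu}=\mathrm{diag}(1,-1,-1,-1)$, the Yang–Mills theory coupled to a scalar field $\phi$ in this representation, with the action $$S=\int d^4x\Big[\eta^{\mu\nu}(D_\mu\phi)^\dagger D_\nu\phi-V(\phi^\dagger\phi)-\tfrac14F^{a\,\mu\nu}F^a_{\mu\nu}\Big],$$ where $D_\mu\phi=\partial_\mu\phi-igT^aA^a_\mu\phi$ and $F^a_{\mu\nu}=\partial_\mu A^a_\nu-\partial_\nu A^a_\mu+gC^{abc}A^b_\mu A^c_\nu$. Here $V$ is differentiable on $[0,\infty)$ (one-sidedly at $0$, so that $V'(0)$ is finite) and $V(0)=0$. Let $(\phi,A_\mu)$ be a smooth solution of the Euler–Lagrange equations of $S$ on $\mathbb R\times\mathbb R^3$ such that: 1. $\phi(t,\vec x)\to0$ and $A_\mu(t,\vec x)\to0$ as $|\vec x|\to\infty$, for every $t$; 2. there are $\tilde T\in(0,\infty)$,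 $\Omega\in SO(3)$ and $\vec l\in\mathbb R^3$ with $\Omega\vec l=\vec l$ and $|\vec l|/\tilde T<1$ such that $\Psi(t+\tilde T,\vec x)=\Lambda(\Omega)\Psi(t,\Omega^{-1}\vec x-\vec l)$ for all $t,\vec x$ and every field $\Psi$, where $\phi$ and $A_0$ are scalars ($\Lambda(\Omega)=1$) and $(A_1,A_2,A_3)$ is a vector ($\Lambda(\Omega)=\Omega$); 3. the functions $(D_0\phi)^\dagger D_0\phi$, $\sum_i(D_i\phi)^\dagger D_i\phi$, $\frac12\sum_{a,i}(F^a_{0i})^2$, $\frac14\sum_{a,i,j}(F^a_{ij})^2$ ($i,j=1,2,3$), $V'(\phi^\dagger\phi)\,\phi^\dagger\phi$ and $V(\phi^\dagger\phi)$ are integrable over $[0,\tilde T]\times\mathbb R^3$. Suppose that there is a $\gamma$ with $\frac12<\gamma\le\frac32$ such that $$2\gamma\,V'(\phi^\dagger\phi)\,\phi^\dagger\phi-3V(\phi^\dagger\phi)\ge0$$ for all values of $\phi$ (or at least for all values that the solution takes). Then the solution is trivial: $\phi\equiv0$, $F^a_{\mu\nu}\equiv0$, and $A_\mu$ is a pure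 gauge, that is, for a smooth $U:\mathbb R\times\mathbb R^3\to G$, with $G$ realised as a closed group of unitary matrices with generators $\tau^a$, one has $\partial_\mu U=ig\,\tau^aA^a_\mu\,U$. In other words, there are no non-topological solitons of this kind. -/

import Mathlib

open Set Filter Topology MeasureTheory
open scoped ContDiff Matrix

noncomputable section

namespace YangMillsScalar

/-! ### Space, space-time and partial derivatives -/

/-- Physical space `ℝ³` with its Euclidean norm. -/
abbrev Space : Type := EuclideanSpace ℝ (Fin 3)

/-- Minkowski space-time, with points `(t, x)`; the speed of light is `1`. -/
abbrev Spacetime : Type := ℝ × Space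

/-- The coordinate vectors of space-time; index `0` is time, the index `i.succ` is the `i`-th
spatial direction. -/
def coordVec : Fin 4 → Spacetime :=
  Fin.cons ((1 : ℝ), (0 : Space)) (fun i : Fin 3 => ((0 : ℝ), EuclideanSpace.single i (1 : ℝ)))

/-- The partial derivative `∂_μ f`. -/
def pd {E : Type*} [NormedAddCommGroup E] [NormedSpace ℝ E] (μ : Fin 4) (f : Spacetime → E)
    (z : Spacetime) : E :=
  fderiv ℝ f z (coordVec μ)

/-- The diagonal entries of the Minkowski metric `diag(1,-1,-1,-1)`. -/
def eta : Fin 4 → ℝ := ![1, -1, -1, -1]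

/-! ### The gauge group and its representations -/

/-- A compact gauge group, realised (as every compact Lie group can be) as a closed subgroup `G`
of a unitary group `U(N)`, together with a basis `i τ^1, …, i τ^n` of its Lie algebra
`{Y | exp (s Y) ∈ G for all real s}` in which the structure constants, given by
`[τ^a, τ^b] = i C^{abc} τ^c`, are totally antisymmetric (that is, a basis which is orthonormal
for an invariant inner product, so that `F^a F^a` is gauge invariant). -/
structure GaugeGroup (N n : ℕ) where
  G : Subgroup (Matrix.unitaryGroup (Fin N) ℂ)
  isClosed : IsClosed (G : Set (Matrix.unitaryGroup (Fin N) ℂ))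
  τ : Fin n → Matrix (Fin N) (Fin N) ℂ
  C : Fin n → Fin n → Fin n → ℝ
  linearIndependent : LinearIndependent ℝ τ
  lieAlgebra_iff : ∀ X : Matrix (Fin N) (Fin N) ℂ,
    X ∈ Submodule.span ℝ (Set.range τ) ↔
      ∀ s : ℝ, ∃ U ∈ G, (U : Matrix (Fin N) (Fin N) ℂ) =
        NormedSpace.exp (s • (Complex.I • X))
  comm : ∀ a b, τ a * τ b - τ b * τ a = Complex.I • ∑ c, C a b c • τ c
  antisymm_left : ∀ a b c, C b a c = - C a b c
  antisymm_right : ∀ a b c, C a c b = - C a b c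

/-- The generators `T^a` of the gauge group in a unitary representation on `ℂ^d`. -/
structure Generators {N n : ℕ} (𝒢 : GaugeGroup N n) (d : ℕ) where
  T : Fin n → Matrix (Fin d) (Fin d) ℂ
  isHermitian : ∀ a, (T a).IsHermitian
  comm : ∀ a b, T a * T b - T b * T a = Complex.I • ∑ c, 𝒢.C a b c • T c

/-! ### The Lagrangian

It is a function of the values `φ`, `A μ a = A_μ^a` of the fields and `dφ μ = ∂_μ φ`,
`dA μ ν a = ∂_μ A_ν^a` of their first derivatives at a point. -/

section Lagrangian

variable {N n d : ℕ} (𝒢 : GaugeGroup N n) (R : Generators 𝒢 d) (g : ℝ) (V : ℝ → ℝ)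

/-- `D_μ φ = ∂_μ φ - i g T^a A_μ^a φ`. -/
def covD (φ : EuclideanSpace ℂ (Fin d)) (A : Fin 4 → Fin n → ℝ)
    (dφ : Fin 4 → EuclideanSpace ℂ (Fin d)) (μ : Fin 4) : EuclideanSpace ℂ (Fin d) :=
  dφ μ - (Complex.I * (g : ℂ)) • ∑ a, A μ a • Matrix.toEuclideanLin (R.T a) φ

/-- `F_{μν}^a = ∂_μ A_ν^a - ∂_ν A_μ^a + g C^{abc} A_μ^b A_ν^c`. -/
def curv (A : Fin 4 → Fin n → ℝ) (dA : Fin 4 → Fin 4 → Fin n → ℝ) (μ ν : Fin 4) (a : Fin n) : ℝ :=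
  dA μ ν a - dA ν μ a + g * ∑ b, ∑ c, 𝒢.C a b c * A μ b * A ν c

/-- The Lagrangian `η^{μν} (D_μ φ)† D_ν φ - V(φ†φ) - (1/4) F^{aμν} F^a_{μν}`. -/
def lagrangian (φ : EuclideanSpace ℂ (Fin d)) (A : Fin 4 → Fin n → ℝ)
    (dφ : Fin 4 → EuclideanSpace ℂ (Fin d)) (dA : Fin 4 → Fin 4 → Fin n → ℝ) : ℝ :=
  (∑ μ, eta μ * ‖covD 𝒢 R g φ A dφ μ‖ ^ 2) - V (‖φ‖ ^ 2)
    - (1 / 4) * ∑ a, ∑ μ, ∑ ν, eta μ * eta ν * curv 𝒢 g A dA μ ν a ^ 2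

end Lagrangian

/-! ### Fields and equations of motion -/

section Fields

variable {N n d : ℕ} (𝒢 : GaugeGroup N n) (R : Generators 𝒢 d) (g : ℝ) (V : ℝ → ℝ)
  (φ : Spacetime → EuclideanSpace ℂ (Fin d)) (A : Spacetime → Fin 4 → Fin n → ℝ)

/-- All first derivatives `∂_μ φ` at a point. -/
def grad (z : Spacetime) : Fin 4 → EuclideanSpace ℂ (Fin d) := fun μ => pd μ φ z

/-- All first derivatives `∂_μ A_ν^a` at a point. -/
def gradA (z : Spacetime) : Fin 4 → Fin 4 → Fin n → ℝ :=
  fun μ ν a => pd μ (fun y => A y ν a) z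

/-- The covariant derivative `D_μ φ` of the field `φ`. -/
def covDeriv (μ : Fin 4) (z : Spacetime) : EuclideanSpace ℂ (Fin d) :=
  covD 𝒢 R g (φ z) (A z) (grad φ z) μ

/-- The field strength `F_{μν}^a` of the gauge field `A`. -/
def fieldStrength (μ ν : Fin 4) (a : Fin n) (z : Spacetime) : ℝ :=
  curv 𝒢 g (A z) (gradA A z) μ ν a

/-- The direction in which only `∂_μ φ` varies, by `v`. -/
def dirGrad (μ : Fin 4) (v : EuclideanSpace ℂ (Fin d)) : Fin 4 → EuclideanSpace ℂ (Fin d) :=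
  Pi.single μ v

/-- The direction in which only `A_ν^a` varies. -/
def dirA (ν : Fin 4) (a : Fin n) : Fin 4 → Fin n → ℝ :=
  Pi.single ν (Pi.single a 1)

/-- The direction in which only `∂_μ A_ν^a` varies. -/
def dirGradA (μ ν : Fin 4) (a : Fin n) : Fin 4 → Fin 4 → Fin n → ℝ :=
  Pi.single μ (dirA ν a)

/-- The equations of motion, that is the Euler–Lagrange equations
`∂_μ (∂L/∂(∂_μ ψ)) = ∂L/∂ψ` for `ψ = φ` (in every real direction `v` of `ℂ^d`) and for
`ψ = A_ν^a`. -/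
structure EquationsOfMotion : Prop where
  scalar : ∀ (v : EuclideanSpace ℂ (Fin d)) (z : Spacetime),
    ∑ μ, pd μ (fun y => deriv (fun ε : ℝ =>
        lagrangian 𝒢 R g V (φ y) (A y) (grad φ y + ε • dirGrad μ v) (gradA A y)) 0) z
      = deriv (fun ε : ℝ =>
        lagrangian 𝒢 R g V (φ z + ε • v) (A z) (grad φ z) (gradA A z)) 0
  gauge : ∀ (ν : Fin 4) (a : Fin n) (z : Spacetime),
    ∑ μ, pd μ (fun y => deriv (fun ε : ℝ =>
        lagrangian 𝒢 R g V (φ y) (A y) (grad φ y)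
          (gradA A y + ε • dirGradA μ ν a)) 0) z
      = deriv (fun ε : ℝ =>
        lagrangian 𝒢 R g V (φ z) (A z + ε • dirA ν a)
          (grad φ z) (gradA A z)) 0

/-- All fields vanish at spatial infinity, at every time. -/
structure VanishAtSpatialInfinity : Prop where
  scalar : ∀ t : ℝ, Tendsto (fun x : Space => φ (t, x)) (cocompact Space) (𝓝 0)
  gauge : ∀ t : ℝ, Tendsto (fun x : Space => A (t, x)) (cocompact Space) (𝓝 0)

/-- Periodicity in time with period `P` up to the rotation `Ω` and the shift `l`:
`Ψ(t + P, x) = Λ(Ω) Ψ(t, Ω⁻¹ x - l)`, where `φ` and `A_0` are scalars and `(A_1, A_2, A_3)` is a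
vector under rotations. -/
structure PeriodicUpTo (P : ℝ) (Ω : Matrix (Fin 3) (Fin 3) ℝ) (l : Space) : Prop where
  scalar : ∀ (t : ℝ) (x : Space), φ (t + P, x) = φ (t, Matrix.toEuclideanLin Ω⁻¹ x - l)
  gauge_time : ∀ (t : ℝ) (x : Space) (a : Fin n),
    A (t + P, x) 0 a = A (t, Matrix.toEuclideanLin Ω⁻¹ x - l) 0 a
  gauge_space : ∀ (t : ℝ) (x : Space) (i : Fin 3) (a : Fin n),
    A (t + P, x) i.succ a = ∑ j : Fin 3, Ω i j * A (t, Matrix.toEuclideanLin Ω⁻¹ x - l) j.succ a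

/-- The space-time region of one period, `0 ≤ t ≤ P`. -/
def onePeriod (P : ℝ) : Set Spacetime := Set.Icc 0 P ×ˢ (Set.univ : Set Space)

/-- Finiteness, over one period, of the kinetic integrals of the scalar field, of those of the
gauge field, and of the integrals of `V'(φ†φ) φ†φ` and of `V(φ†φ)`. Here `V` matters only on
`[0, ∞)`, and `V'` is its derivative there (one-sided at `0`). -/
structure FiniteIntegrals (P : ℝ) : Prop where
  scalar_time : IntegrableOn (fun z => ‖covDeriv 𝒢 R g φ A 0 z‖ ^ 2) (onePeriod P)
  scalar_space : IntegrableOn (fun z => ∑ i : Fin 3, ‖covDeriv 𝒢 R g φ A i.succ z‖ ^ 2)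
    (onePeriod P)
  gauge_electric : IntegrableOn
    (fun z => (1 / 2) * ∑ a, ∑ i : Fin 3, fieldStrength 𝒢 g A 0 i.succ a z ^ 2) (onePeriod P)
  gauge_magnetic : IntegrableOn
    (fun z => (1 / 4) * ∑ a, ∑ i : Fin 3, ∑ j : Fin 3,
      fieldStrength 𝒢 g A i.succ j.succ a z ^ 2) (onePeriod P)
  potential_deriv : IntegrableOn
    (fun z => derivWithin V (Set.Ici 0) (‖φ z‖ ^ 2) * ‖φ z‖ ^ 2) (onePeriod P)
  potential : IntegrableOn (fun z => V (‖φ z‖ ^ 2)) (onePeriod P)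

/-- `A` is a pure gauge: for a smooth map `U` from space-time to the gauge group,
`g A_μ^a τ^a = -i (∂_μ U) U⁻¹`, written as `∂_μ U = i g A_μ^a τ^a U`. So `A` is the gauge
transform by `U` of the zero field. -/
def IsPureGauge : Prop :=
  ∃ U : Spacetime → Matrix.unitaryGroup (Fin N) ℂ,
    (∀ z, U z ∈ 𝒢.G) ∧
    (∀ p q, ContDiff ℝ ∞ (fun z => (U z : Matrix (Fin N) (Fin N) ℂ) p q)) ∧
    ∀ (μ : Fin 4) (z : Spacetime) (p q : Fin N),
      pd μ (fun y => (U y : Matrix (Fin N) (Fin N) ℂ) p q) z =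
        (((Complex.I * (g : ℂ)) • ∑ a, A z μ a • 𝒢.τ a) *
          (U z : Matrix (Fin N) (Fin N) ℂ)) p q

end Fields

end YangMillsScalar

end

open YangMillsScalar

open YangMillsScalar

noncomputable section

namespace YangMillsScalar

/-! ### Partial derivatives -/

section RealInner

variable {X E : Type*} [NormedAddCommGroup X] [NormedSpace ℝ X] [NormedAddCommGroup E]
  [InnerProductSpace ℝ E] {f g : X → E} {x : X}

/-! The proof is a virial (Derrick–Pohozaev) argument in the frame that moves with the soliton. Put
v = l/P, u = (1, v) and κ = 1/(1 - |v|²). The assumed symmetry is a translation along u combined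
with a rotation R that fixes v, so the part of the position vector which is Minkowski-orthogonal to
u is merely rotated. Two currents therefore have equal fluxes through the times 0 and P, and their
divergences integrate to zero over one period once a cutoff at large comoving distance has been
removed.

The first current is the conserved stress tensor contracted with this orthogonal position vector. It
gives ∫ (3V - Q - 2κ|D_uφ|² - M) = 0, where Q = η^{μν}⟨D_μφ, D_νφ⟩, D_u is the covariant derivative
along u, and M ≥ 0 is the gauge field energy in the moving frame (`integral_stress`,
`sum_stress_eq`). The second current is ⟨φ, D_μφ⟩. It gives ∫ (Q - V'(|φ|²)|φ|²) = 0
(`integral_scalar`). Removing its cutoff needs |φ|²/(1 + |x|²) to be integrable although φ is not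
assumed square integrable; this is Hardy's inequality for fields that tend to 0 at infinity
(`hardy`).

Let K = κ|D_uφ|² - Q, a nonnegative quantity that controls the covariant derivatives in the spatial
directions of the moving frame (`spatial_part_ge`). Minus the first identity minus 2γ times the
second reads ∫ [(2γ V'|φ|² - 3V) + (3 - 2γ) κ|D_uφ|² + (2γ - 1) K + M] = 0. All four terms are
nonnegative, so K and M vanish, first almost everywhere and then everywhere by continuity
(`energies_eq_zero`). From M = 0 follows F = 0. From K = 0 it follows that, at fixed time, |φ| is
constant along every line orthogonal to v, and the decay at infinity gives φ = 0 (`eq_zero`).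

A flat potential is integrated by parallel transport along the rays from the origin: flatness makes
the radial solution satisfy the full system ∂_μU = X_μ U, and it stays in the closed group
(`exists_pureGauge`).

The field theory is done for an abstract `GaugeAction`, with the coupling absorbed into bracket and
action; `EquationsOfMotion.fieldEquations` and `exists_periodicSolution` translate the hypotheses
into that setting. -/

@[fun_prop]
lemma differentiable_real_inner (hf : Differentiable ℝ f) (hg : Differentiable ℝ g) :
    Differentiable ℝ (fun x => inner ℝ (f x) (g x)) :=
  hf.inner ℝ hg

@[fun_prop]
lemma differentiableAt_real_inner (hf : DifferentiableAt ℝ f x) (hg : DifferentiableAt ℝ g x) :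
    DifferentiableAt ℝ (fun x => inner ℝ (f x) (g x)) x :=
  hf.inner ℝ hg

@[fun_prop]
lemma contDiff_real_inner {n : WithTop ℕ∞} (hf : ContDiff ℝ n f) (hg : ContDiff ℝ n g) :
    ContDiff ℝ n (fun x => inner ℝ (f x) (g x)) :=
  hf.inner ℝ hg

end RealInner

section PartialDerivatives

variable {E : Type*} [NormedAddCommGroup E] [NormedSpace ℝ E]
  {F : Type*} [NormedAddCommGroup F] [NormedSpace ℝ F]
  {G : Type*} [NormedAddCommGroup G] [NormedSpace ℝ G]
  {f f' : Spacetime → E} {μ ν : Fin 4} {z : Spacetime}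

lemma contDiff_pd (μ : Fin 4) (hf : ContDiff ℝ ∞ f) : ContDiff ℝ ∞ (pd μ f) :=
  (hf.fderiv_right (m := ∞) (by simp)).clm_apply contDiff_const

lemma pd_comm (hf : ContDiff ℝ ∞ f) (μ ν : Fin 4) (z : Spacetime) :
    pd μ (pd ν f) z = pd ν (pd μ f) z := by
  have h1 : DifferentiableAt ℝ (fderiv ℝ f) z :=
    (hf.fderiv_right (m := ∞) (by simp)).differentiable (by simp) z
  have h2 : ∀ μ ν, pd μ (pd ν f) z = fderiv ℝ (fderiv ℝ f) z (coordVec μ) (coordVec ν) := by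
    intro μ ν
    unfold pd
    rw [fderiv_clm_apply h1 (by fun_prop)]
    simp
  rw [h2, h2]
  exact (hf.contDiffAt.isSymmSndFDerivAt (by simpa using WithTop.coe_le_coe.2 (le_top (a := (2 : ℕ∞))))) _ _

lemma pd_add (hf : DifferentiableAt ℝ f z) (hf' : DifferentiableAt ℝ f' z) :
    pd μ (fun y => f y + f' y) z = pd μ f z + pd μ f' z := by
  simp [pd, fderiv_fun_add hf hf']

lemma pd_sub (hf : DifferentiableAt ℝ f z) (hf' : DifferentiableAt ℝ f' z) :
    pd μ (fun y => f y - f' y) z = pd μ f z - pd μ f' z := by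
  simp [pd, fderiv_fun_sub hf hf']

lemma pd_sum {ι : Type*} {s : Finset ι} {f : ι → Spacetime → E}
    (hf : ∀ i ∈ s, DifferentiableAt ℝ (f i) z) :
    pd μ (fun y => ∑ i ∈ s, f i y) z = ∑ i ∈ s, pd μ (f i) z := by
  simp [pd, fderiv_fun_sum hf]

lemma pd_const_mul {f : Spacetime → ℝ} (c : ℝ) (hf : DifferentiableAt ℝ f z) :
    pd μ (fun y => c * f y) z = c * pd μ f z := by
  simp [pd, fderiv_const_mul hf]

lemma pd_mul {f f' : Spacetime → ℝ} (hf : DifferentiableAt ℝ f z)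
    (hf' : DifferentiableAt ℝ f' z) :
    pd μ (fun y => f y * f' y) z = pd μ f z * f' z + f z * pd μ f' z := by
  simp [pd, fderiv_fun_mul hf hf']
  ring

lemma pd_bilinear (B : E →L[ℝ] F →L[ℝ] G) {f : Spacetime → E} {g : Spacetime → F}
    (hf : DifferentiableAt ℝ f z) (hg : DifferentiableAt ℝ g z) :
    pd μ (fun y => B (f y) (g y)) z = B (pd μ f z) (g z) + B (f z) (pd μ g z) := by
  simp [pd, B.fderiv_of_bilinear hf hg, add_comm]

lemma pd_inner {E : Type*} [NormedAddCommGroup E] [InnerProductSpace ℝ E]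
    {f g : Spacetime → E} (hf : DifferentiableAt ℝ f z) (hg : DifferentiableAt ℝ g z) :
    pd μ (fun y => inner ℝ (f y) (g y)) z
      = inner ℝ (pd μ f z) (g z) + inner ℝ (f z) (pd μ g z) := by
  simp only [pd]
  rw [fderiv_inner_apply ℝ hf hg, add_comm]

end PartialDerivatives

/-! ### Gauge fields in an abstract setting -/

/-- A Lie algebra `𝔤` with an invariant inner product which acts on `H` by skew-adjoint
operators. -/
structure GaugeAction (𝔤 H : Type*) [NormedAddCommGroup 𝔤] [InnerProductSpace ℝ 𝔤]
    [NormedAddCommGroup H] [InnerProductSpace ℝ H] where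
  br : 𝔤 →L[ℝ] 𝔤 →L[ℝ] 𝔤
  act : 𝔤 →L[ℝ] H →L[ℝ] H
  br_antisymm : ∀ X Y, br Y X = -br X Y
  jacobi : ∀ X Y Z, br X (br Y Z) + br Y (br Z X) + br Z (br X Y) = 0
  br_skew : ∀ X Y Z, inner ℝ (br X Y) Z = -inner ℝ Y (br X Z)
  act_skew : ∀ X v w, inner ℝ (act X v) w = -inner ℝ v (act X w)
  act_br : ∀ X Y v, act (br X Y) v = act X (act Y v) - act Y (act X v)

namespace GaugeAction

variable {𝔤 H : Type*} [NormedAddCommGroup 𝔤] [InnerProductSpace ℝ 𝔤]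
    [NormedAddCommGroup H] [InnerProductSpace ℝ H] (𝒜 : GaugeAction 𝔤 H)
    (a : Fin 4 → Spacetime → 𝔤) (φ : Spacetime → H)

/-- The covariant derivative of a field with values in the representation. -/
def cov (ψ : Spacetime → H) (μ : Fin 4) (z : Spacetime) : H :=
  pd μ ψ z + 𝒜.act (a μ z) (ψ z)

/-- The covariant derivative of a field with values in the Lie algebra. -/
def covAd (X : Spacetime → 𝔤) (μ : Fin 4) (z : Spacetime) : 𝔤 :=
  pd μ X z + 𝒜.br (a μ z) (X z)

/-- The field strength. -/
def curvature (μ ν : Fin 4) (z : Spacetime) : 𝔤 :=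
  pd μ (a ν) z - pd ν (a μ) z + 𝒜.br (a μ z) (a ν z)

variable {a φ}

lemma contDiff_cov {ψ : Spacetime → H} (ha : ∀ μ, ContDiff ℝ ∞ (a μ)) (hψ : ContDiff ℝ ∞ ψ)
    (μ : Fin 4) : ContDiff ℝ ∞ (𝒜.cov a ψ μ) :=
  (contDiff_pd μ hψ).add ((𝒜.act.contDiff.comp (ha μ)).clm_apply hψ)

lemma contDiff_curvature (ha : ∀ μ, ContDiff ℝ ∞ (a μ)) (μ ν : Fin 4) :
    ContDiff ℝ ∞ (𝒜.curvature a μ ν) :=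
  ((contDiff_pd μ (ha ν)).sub (contDiff_pd ν (ha μ))).add
    ((𝒜.br.contDiff.comp (ha μ)).clm_apply (ha ν))

lemma act_self_inner (X : 𝔤) (v : H) : inner ℝ v (𝒜.act X v) = 0 := by
  have := 𝒜.act_skew X v v
  rw [real_inner_comm] at this
  linarith

lemma curvature_antisymm (μ ν : Fin 4) (z : Spacetime) :
    𝒜.curvature a ν μ z = -𝒜.curvature a μ ν z := by
  simp only [curvature, 𝒜.br_antisymm (a μ z) (a ν z)]
  abel

/-- The connection terms cancel by skew-adjointness, so ordinary derivatives of gauge invariant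
quantities can be computed with covariant derivatives throughout. -/
lemma pd_inner_cov {ψ χ : Spacetime → H} {μ : Fin 4} {z : Spacetime}
    (hψ : DifferentiableAt ℝ ψ z) (hχ : DifferentiableAt ℝ χ z) :
    pd μ (fun y => inner ℝ (ψ y) (χ y)) z
      = inner ℝ (𝒜.cov a ψ μ z) (χ z) + inner ℝ (ψ z) (𝒜.cov a χ μ z) := by
  rw [pd_inner hψ hχ]
  simp only [cov, inner_add_left, inner_add_right, 𝒜.act_skew]
  ring

lemma pd_inner_covAd {X Y : Spacetime → 𝔤} {μ : Fin 4} {z : Spacetime}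
    (hX : DifferentiableAt ℝ X z) (hY : DifferentiableAt ℝ Y z) :
    pd μ (fun y => inner ℝ (X y) (Y y)) z
      = inner ℝ (𝒜.covAd a X μ z) (Y z) + inner ℝ (X z) (𝒜.covAd a Y μ z) := by
  rw [pd_inner hX hY]
  simp only [covAd, inner_add_left, inner_add_right, 𝒜.br_skew]
  ring

lemma cov_cov_sub {ψ : Spacetime → H} (ha : ∀ μ, ContDiff ℝ ∞ (a μ)) (hψ : ContDiff ℝ ∞ ψ)
    (μ ν : Fin 4) (z : Spacetime) :
    𝒜.cov a (𝒜.cov a ψ ν) μ z - 𝒜.cov a (𝒜.cov a ψ μ) ν z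
      = 𝒜.act (𝒜.curvature a μ ν z) (ψ z) := by
  have key : ∀ μ ν, 𝒜.cov a (𝒜.cov a ψ ν) μ z = pd μ (pd ν ψ) z
      + (𝒜.act (pd μ (a ν) z) (ψ z) + 𝒜.act (a ν z) (pd μ ψ z))
      + 𝒜.act (a μ z) (pd ν ψ z) + 𝒜.act (a μ z) (𝒜.act (a ν z) (ψ z)) := by
    intro μ ν
    have h1 : DifferentiableAt ℝ (a ν) z := (ha ν).differentiable (by simp) z
    have h2 : DifferentiableAt ℝ ψ z := hψ.differentiable (by simp) z
    have h3 : DifferentiableAt ℝ (pd ν ψ) z := (contDiff_pd ν hψ).differentiable (by simp) z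
    have h4 : DifferentiableAt ℝ (fun y => 𝒜.act (a ν y) (ψ y)) z :=
      ((𝒜.act.contDiff.comp (ha ν)).clm_apply hψ).differentiable (by simp) z
    have : pd μ (𝒜.cov a ψ ν) z = pd μ (pd ν ψ) z
      + (𝒜.act (pd μ (a ν) z) (ψ z) + 𝒜.act (a ν z) (pd μ ψ z)) := by
      rw [← pd_bilinear 𝒜.act h1 h2, ← pd_add h3 h4]
      rfl
    rw [cov, this]
    simp only [cov, map_add]
    abel
  rw [key, key, pd_comm hψ ν μ]
  simp only [curvature, map_add, map_sub, add_apply, sub_apply, 𝒜.act_br]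
  abel

/-- Second derivatives of the potential cancel by symmetry, the terms with one derivative by
antisymmetry of the bracket, and the cubic terms by the Jacobi identity. -/
lemma bianchi (ha : ∀ μ, ContDiff ℝ ∞ (a μ)) (ρ μ ν : Fin 4) (z : Spacetime) :
    𝒜.covAd a (𝒜.curvature a μ ν) ρ z + 𝒜.covAd a (𝒜.curvature a ν ρ) μ z
      + 𝒜.covAd a (𝒜.curvature a ρ μ) ν z = 0 := by
  have key : ∀ ρ μ ν, 𝒜.covAd a (𝒜.curvature a μ ν) ρ z
      = pd ρ (pd μ (a ν)) z - pd ρ (pd ν (a μ)) z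
      + (𝒜.br (pd ρ (a μ) z) (a ν z) + 𝒜.br (a μ z) (pd ρ (a ν) z))
      + (𝒜.br (a ρ z) (pd μ (a ν) z) - 𝒜.br (a ρ z) (pd ν (a μ) z))
      + 𝒜.br (a ρ z) (𝒜.br (a μ z) (a ν z)) := by
    intro ρ μ ν
    have h1 : ∀ ν, DifferentiableAt ℝ (a ν) z := fun ν => (ha ν).differentiable (by simp) z
    have h3 : ∀ μ ν, DifferentiableAt ℝ (pd μ (a ν)) z :=
      fun μ ν => (contDiff_pd μ (ha ν)).differentiable (by simp) z
    have h4 : DifferentiableAt ℝ (fun y => 𝒜.br (a μ y) (a ν y)) z :=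
      ((𝒜.br.contDiff.comp (ha μ)).clm_apply (ha ν)).differentiable (by simp) z
    have : pd ρ (𝒜.curvature a μ ν) z = pd ρ (pd μ (a ν)) z - pd ρ (pd ν (a μ)) z
      + (𝒜.br (pd ρ (a μ) z) (a ν z) + 𝒜.br (a μ z) (pd ρ (a ν) z)) := by
      rw [← pd_bilinear 𝒜.br (h1 μ) (h1 ν), ← pd_sub (h3 μ ν) (h3 ν μ),
        ← pd_add ((h3 μ ν).fun_sub (h3 ν μ)) h4]
      rfl
    rw [covAd, this]
    simp only [curvature, map_add, map_sub]
    abel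
  rw [key, key, key, pd_comm (ha ν) μ ρ, pd_comm (ha μ) ν ρ, pd_comm (ha ρ) ν μ,
    ← 𝒜.jacobi (a ρ z) (a μ z) (a ν z),
    𝒜.br_antisymm (a μ z) (pd ν (a ρ) z), 𝒜.br_antisymm (a ν z) (pd ρ (a μ) z),
    𝒜.br_antisymm (a ρ z) (pd μ (a ν) z)]
  abel

/-! ### The energy-momentum tensor -/

variable (a φ)

/-- The Lagrangian, with the potential energy density `Vp` as a given function. -/
def lagr (Vp : Spacetime → ℝ) (z : Spacetime) : ℝ :=
  (∑ μ, eta μ * inner ℝ (𝒜.cov a φ μ z) (𝒜.cov a φ μ z)) - Vp z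
    - (1 / 4) * ∑ μ, ∑ ν, eta μ * eta ν *
      inner ℝ (𝒜.curvature a μ ν z) (𝒜.curvature a μ ν z)

/-- The symmetric gauge invariant energy-momentum tensor. -/
def stress (Vp : Spacetime → ℝ) (μ ν : Fin 4) (z : Spacetime) : ℝ :=
  2 * inner ℝ (𝒜.cov a φ μ z) (𝒜.cov a φ ν z)
    - (∑ ρ, eta ρ * inner ℝ (𝒜.curvature a μ ρ z) (𝒜.curvature a ν ρ z))
    - (if μ = ν then eta μ else 0) * 𝒜.lagr a φ Vp z

/-- The field equations, with the force `S` of the potential as a given function. -/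
structure FieldEquations (S : Spacetime → H) : Prop where
  scalar : ∀ z, ∑ μ, eta μ • 𝒜.cov a (𝒜.cov a φ μ) μ z = -S z
  gauge : ∀ ν z X, ∑ μ, eta μ * inner ℝ (𝒜.covAd a (𝒜.curvature a μ ν) μ z) X
    = -2 * inner ℝ (𝒜.cov a φ ν z) (𝒜.act X (φ z))

variable {a φ}

lemma eta_mul_self (μ : Fin 4) : eta μ * eta μ = 1 := by
  fin_cases μ <;> simp [eta]

lemma lagr_differentiable {Vp : Spacetime → ℝ} (ha : ∀ μ, ContDiff ℝ ∞ (a μ))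
    (hφ : ContDiff ℝ ∞ φ) (hVp : Differentiable ℝ Vp) :
    Differentiable ℝ (𝒜.lagr a φ Vp) := by
  have h1 : ∀ μ, Differentiable ℝ (𝒜.cov a φ μ) :=
    fun μ => (𝒜.contDiff_cov ha hφ μ).differentiable (by simp)
  have h2 : ∀ μ ν, Differentiable ℝ (𝒜.curvature a μ ν) :=
    fun μ ν => (𝒜.contDiff_curvature ha μ ν).differentiable (by simp)
  unfold lagr
  fun_prop

lemma pd_lagr {Vp : Spacetime → ℝ} {S : Spacetime → H} (ha : ∀ μ, ContDiff ℝ ∞ (a μ))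
    (hφ : ContDiff ℝ ∞ φ) (hVp : Differentiable ℝ Vp)
    (hS : ∀ μ z, pd μ Vp z = 2 * inner ℝ (S z) (pd μ φ z)) (ν : Fin 4) (z : Spacetime) :
    pd ν (𝒜.lagr a φ Vp) z
      = (∑ μ, eta μ * (2 * inner ℝ (𝒜.cov a φ μ z) (𝒜.cov a (𝒜.cov a φ μ) ν z)))
        - 2 * inner ℝ (S z) (pd ν φ z)
        - (1 / 4) * ∑ μ, ∑ ρ, eta μ * eta ρ * (2 * inner ℝ (𝒜.curvature a μ ρ z)
            (𝒜.covAd a (𝒜.curvature a μ ρ) ν z)) := by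
  have h1 : ∀ μ, Differentiable ℝ (𝒜.cov a φ μ) :=
    fun μ => (𝒜.contDiff_cov ha hφ μ).differentiable (by simp)
  have h2 : ∀ μ ν, Differentiable ℝ (𝒜.curvature a μ ν) :=
    fun μ ν => (𝒜.contDiff_curvature ha μ ν).differentiable (by simp)
  unfold lagr
  rw [pd_sub (by fun_prop) (by fun_prop), pd_sub (by fun_prop) (by fun_prop),
    pd_const_mul _ (by fun_prop), pd_sum (by fun_prop), pd_sum (by fun_prop), hS]
  congr 2
  · refine Finset.sum_congr rfl fun μ _ => ?_
    rw [pd_const_mul _ (by fun_prop), 𝒜.pd_inner_cov (a := a) (h1 μ z) (h1 μ z), real_inner_comm]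
    ring
  · refine Finset.sum_congr rfl fun μ _ => ?_
    rw [pd_sum (by fun_prop)]
    refine Finset.sum_congr rfl fun ρ _ => ?_
    rw [pd_const_mul _ (by fun_prop), 𝒜.pd_inner_covAd (a := a) (h2 μ ρ z) (h2 μ ρ z),
      real_inner_comm]
    ring

lemma pd_stress {Vp : Spacetime → ℝ} (ha : ∀ μ, ContDiff ℝ ∞ (a μ))
    (hφ : ContDiff ℝ ∞ φ) (hVp : Differentiable ℝ Vp) (σ μ ν : Fin 4) (z : Spacetime) :
    pd σ (𝒜.stress a φ Vp μ ν) z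
      = 2 * (inner ℝ (𝒜.cov a (𝒜.cov a φ μ) σ z) (𝒜.cov a φ ν z)
          + inner ℝ (𝒜.cov a φ μ z) (𝒜.cov a (𝒜.cov a φ ν) σ z))
        - (∑ ρ, eta ρ * (inner ℝ (𝒜.covAd a (𝒜.curvature a μ ρ) σ z) (𝒜.curvature a ν ρ z)
          + inner ℝ (𝒜.curvature a μ ρ z) (𝒜.covAd a (𝒜.curvature a ν ρ) σ z)))
        - (if μ = ν then eta μ else 0) * pd σ (𝒜.lagr a φ Vp) z := by
  have h1 : ∀ μ, Differentiable ℝ (𝒜.cov a φ μ) :=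
    fun μ => (𝒜.contDiff_cov ha hφ μ).differentiable (by simp)
  have h2 : ∀ μ ν, Differentiable ℝ (𝒜.curvature a μ ν) :=
    fun μ ν => (𝒜.contDiff_curvature ha μ ν).differentiable (by simp)
  have h3 := 𝒜.lagr_differentiable ha hφ hVp
  unfold stress
  rw [pd_sub (by fun_prop) (by fun_prop), pd_sub (by fun_prop) (by fun_prop),
    pd_const_mul _ (by fun_prop), pd_const_mul _ (by fun_prop), pd_sum (by fun_prop),
    𝒜.pd_inner_cov (a := a) (h1 μ z) (h1 ν z)]
  congr 2
  refine Finset.sum_congr rfl fun ρ _ => ?_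
  rw [pd_const_mul _ (by fun_prop), 𝒜.pd_inner_covAd (a := a) (h2 μ ρ z) (h2 ν ρ z)]

lemma covAd_curvature_antisymm (σ μ ν : Fin 4) (z : Spacetime) :
    𝒜.covAd a (𝒜.curvature a ν μ) σ z = -𝒜.covAd a (𝒜.curvature a μ ν) σ z := by
  have : 𝒜.curvature a ν μ = -𝒜.curvature a μ ν := by
    ext z; exact 𝒜.curvature_antisymm μ ν z
  simp [covAd, this, pd, fderiv_neg]
  abel

/-- Conservation of energy and momentum. -/
theorem stress_conserved {Vp : Spacetime → ℝ} {S : Spacetime → H}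
    (ha : ∀ μ, ContDiff ℝ ∞ (a μ)) (hφ : ContDiff ℝ ∞ φ) (hVp : Differentiable ℝ Vp)
    (hS : ∀ μ z, pd μ Vp z = 2 * inner ℝ (S z) (pd μ φ z))
    (hS' : ∀ X z, inner ℝ (S z) (𝒜.act X (φ z)) = 0)
    (heq : 𝒜.FieldEquations a φ S) (ν : Fin 4) (z : Spacetime) :
    ∑ μ, eta μ * pd μ (𝒜.stress a φ Vp μ ν) z = 0 := by
  simp only [𝒜.pd_stress ha hφ hVp]
  have hlast : ∑ μ, eta μ * ((if μ = ν then eta μ else 0) * pd μ (𝒜.lagr a φ Vp) z)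
      = pd ν (𝒜.lagr a φ Vp) z := by
    simp only [ite_mul, mul_ite, zero_mul, mul_zero, Finset.sum_ite_eq', Finset.mem_univ,
      if_true, ← mul_assoc, eta_mul_self, one_mul]
  simp only [mul_sub, Finset.sum_sub_distrib, hlast]
  rw [𝒜.pd_lagr ha hφ hVp hS]
  set d := fun μ => 𝒜.cov a φ μ z
  set dd := fun μ ν => 𝒜.cov a (𝒜.cov a φ μ) ν z
  set f := fun μ ν => 𝒜.curvature a μ ν z
  set df := fun μ ν σ => 𝒜.covAd a (𝒜.curvature a μ ν) σ z
  -- Scalar part: the field equation produces the force, and exchanging the order of two covariant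
  -- derivatives produces a curvature term. The same term appears in `e2` and cancels there.
  have e1 : ∑ μ, eta μ * (2 * (inner ℝ (dd μ μ) (d ν) + inner ℝ (d μ) (dd ν μ)))
      = -2 * inner ℝ (S z) (pd ν φ z) + ∑ μ, eta μ * (2 * inner ℝ (d μ) (dd μ ν))
        + 2 * ∑ μ, eta μ * inner ℝ (d μ) (𝒜.act (f μ ν) (φ z)) := by
    have h1 : ∑ μ, eta μ * inner ℝ (dd μ μ) (d ν) = -inner ℝ (S z) (pd ν φ z) := by
      have := congrArg (fun w => inner ℝ w (d ν)) (heq.scalar z)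
      simp only [sum_inner, real_inner_smul_left, inner_neg_left] at this
      rw [this]
      -- The force is orthogonal to the gauge orbit, so D_νφ may be replaced by ∂_νφ.
      simp only [d, cov, inner_add_right, hS', add_zero]
    have h2 : ∀ μ, inner ℝ (d μ) (dd ν μ)
        = inner ℝ (d μ) (dd μ ν) + inner ℝ (d μ) (𝒜.act (f μ ν) (φ z)) := by
      intro μ
      rw [← inner_add_right, ← 𝒜.cov_cov_sub ha hφ μ ν z]
      simp [dd]
    simp only [h2, mul_add, Finset.sum_add_distrib, Finset.mul_sum]
    have h1' := congrArg (2 * ·) h1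
    simp only [Finset.mul_sum] at h1'
    have : ∑ μ, eta μ * (2 * inner ℝ (dd μ μ) (d ν)) = -2 * inner ℝ (S z) (pd ν φ z) := by
      rw [neg_mul, ← mul_neg, ← h1']
      exact Finset.sum_congr rfl fun _ _ => by ring
    rw [this, add_assoc]
    congr 2
    exact Finset.sum_congr rfl fun _ _ => by ring
  -- Gauge part: the term with the divergence of F is given by the gauge equation, the other one by
  -- the Bianchi identity.
  have e2 : ∑ μ, eta μ * ∑ ρ, eta ρ * (inner ℝ (df μ ρ μ) (f ν ρ) + inner ℝ (f μ ρ) (df ν ρ μ))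
      = 2 * (∑ μ, eta μ * inner ℝ (d μ) (𝒜.act (f μ ν) (φ z)))
        + (1 / 4) * ∑ μ, ∑ ρ, eta μ * eta ρ * (2 * inner ℝ (f μ ρ) (df μ ρ ν)) := by
    simp only [mul_add, Finset.sum_add_distrib]
    congr 1
    · simp only [Finset.mul_sum]
      rw [Finset.sum_comm]
      refine Finset.sum_congr rfl fun ρ _ => ?_
      have h := heq.gauge ρ z (f ν ρ)
      have h' := congrArg (eta ρ * ·) h
      simp only [Finset.mul_sum] at h'
      calc _ = ∑ i, eta ρ * (eta i * inner ℝ (𝒜.covAd a (𝒜.curvature a i ρ) i z) (f ν ρ)) :=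
            Finset.sum_congr rfl fun _ _ => by simp only [df]; ring
        _ = _ := h'
        _ = _ := by
          have : f ν ρ = -f ρ ν := 𝒜.curvature_antisymm ρ ν z
          rw [this]
          simp only [map_neg, neg_apply, inner_neg_right, d]
          ring
    · have hb : ∀ μ ρ, df ν ρ μ - df ν μ ρ = df μ ρ ν := by
        intro μ ρ
        have h := 𝒜.bianchi ha μ ν ρ z
        have h1 : df ρ μ ν = -df μ ρ ν := 𝒜.covAd_curvature_antisymm ν μ ρ z
        have h2 : df μ ν ρ = -df ν μ ρ := 𝒜.covAd_curvature_antisymm ρ ν μ z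
        change df ν ρ μ + df ρ μ ν + df μ ν ρ = 0 at h
        rw [h1, h2] at h
        rw [← sub_eq_zero, ← h]
        abel
      set T := ∑ μ, ∑ ρ, eta μ * (eta ρ * inner ℝ (f μ ρ) (df ν ρ μ)) with hT
      have hT' : T = -∑ μ, ∑ ρ, eta μ * (eta ρ * inner ℝ (f μ ρ) (df ν μ ρ)) := by
        rw [hT, Finset.sum_comm, ← Finset.sum_neg_distrib]
        refine Finset.sum_congr rfl fun μ _ => ?_
        rw [← Finset.sum_neg_distrib]
        refine Finset.sum_congr rfl fun ρ _ => ?_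
        have : f ρ μ = -f μ ρ := 𝒜.curvature_antisymm μ ρ z
        rw [this, inner_neg_left]
        ring
      -- Only the part of D_μF_{νρ} antisymmetric in μ and ρ survives contraction with F_{μρ}; by
      -- `hb` it is half of D_νF_{μρ}.
      have h2T : 2 * T = ∑ μ, ∑ ρ, eta μ * (eta ρ * inner ℝ (f μ ρ) (df μ ρ ν)) := by
        rw [two_mul]
        nth_rewrite 2 [hT']
        rw [hT, ← sub_eq_add_neg, ← Finset.sum_sub_distrib]
        refine Finset.sum_congr rfl fun μ _ => ?_
        rw [← Finset.sum_sub_distrib]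
        refine Finset.sum_congr rfl fun ρ _ => ?_
        rw [← hb, inner_sub_right]
        ring
      have : ∑ μ, eta μ * ∑ ρ, eta ρ * inner ℝ (f μ ρ) (df ν ρ μ) = T := by
        simp only [hT, Finset.mul_sum]
      rw [this]
      have h3 : ∑ μ, ∑ ρ, eta μ * eta ρ * (2 * inner ℝ (f μ ρ) (df μ ρ ν)) = 2 * (2 * T) := by
        rw [h2T, Finset.mul_sum]
        refine Finset.sum_congr rfl fun μ _ => ?_
        rw [Finset.mul_sum]
        exact Finset.sum_congr rfl fun ρ _ => by ring
      rw [h3]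
      ring
  have e1' := e1
  have e2' := e2
  simp only [dd, d, f, df] at e1' e2'
  rw [e1', e2']
  ring

end GaugeAction

/-! ### The divergence theorem over one period -/

lemma integral_fderiv_apply_eq_zero {E : Type*} [NormedAddCommGroup E] [NormedSpace ℝ E]
    [FiniteDimensional ℝ E] [MeasurableSpace E] [BorelSpace E] (m : Measure E)
    [m.IsAddHaarMeasure] {f : E → ℝ} (hf : ContDiff ℝ 1 f) (hc : HasCompactSupport f) (v : E) :
    ∫ x, fderiv ℝ f x v ∂m = 0 := by
  have h1 : Integrable (fun x => fderiv ℝ f x v) m :=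
    ((hf.continuous_fderiv (by simp)).clm_apply continuous_const).integrable_of_hasCompactSupport
      ((hc.fderiv (𝕜 := ℝ)).mono fun x hx h => hx (by simp [h]))
  have h2 : Integrable f m := hf.continuous.integrable_of_hasCompactSupport hc
  have := integral_mul_fderiv_eq_neg_fderiv_mul_of_integrable (μ := m) (f := fun _ : E => (1 : ℝ))
    (g := f) (v := v) (by simp) (by simpa using h1) (by simpa using h2)
    (by fun_prop) (fun x _ => hf.differentiable (by simp) x)
  simpa using this

lemma hasCompactSupport_of_forall_le_norm {E : Type*} [NormedAddCommGroup E] [NormedSpace ℝ E]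
    [FiniteDimensional ℝ E] {f : E → ℝ} {r : ℝ} (h : ∀ x, r ≤ ‖x‖ → f x = 0) :
    HasCompactSupport f := by
  refine HasCompactSupport.intro (isCompact_closedBall (0 : E) r) fun x hx => h x ?_
  simp only [Metric.mem_closedBall, dist_zero_right, not_le] at hx
  exact hx.le

lemma pd_zero_hasDerivAt {f : Spacetime → ℝ} (hf : Differentiable ℝ f) (t : ℝ) (x : Space) :
    HasDerivAt (fun s => f (s, x)) (pd 0 f (t, x)) t := by
  have h1 : HasFDerivAt f (fderiv ℝ f (t, x)) (t, x) := (hf (t, x)).hasFDerivAt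
  have h2 : HasDerivAt (fun s : ℝ => ((s, x) : Spacetime)) ((1 : ℝ), (0 : Space)) t :=
    (hasDerivAt_id t).prodMk (hasDerivAt_const t x)
  exact h1.comp_hasDerivAt t h2

lemma pd_succ_eq {E : Type*} [NormedAddCommGroup E] [NormedSpace ℝ E] {f : Spacetime → E}
    (hf : Differentiable ℝ f) (i : Fin 3) (t : ℝ) (x : Space) :
    pd i.succ f (t, x)
      = fderiv ℝ (fun y => f (t, y)) x (EuclideanSpace.single i (1 : ℝ)) := by
  have h1 : HasFDerivAt f (fderiv ℝ f (t, x)) (t, x) := (hf (t, x)).hasFDerivAt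
  have h2 : HasFDerivAt (fun y : Space => ((t, y) : Spacetime))
      ((0 : Space →L[ℝ] ℝ).prod (ContinuousLinearMap.id ℝ Space)) x :=
    (hasFDerivAt_const t x).prodMk (hasFDerivAt_id x)
  have h3 : HasFDerivAt (fun y => f (t, y)) _ x := h1.comp x h2
  rw [h3.fderiv]
  rfl

lemma isClosed_onePeriod (P : ℝ) : IsClosed (onePeriod P) := isClosed_Icc.prod isClosed_univ

lemma measurableSet_onePeriod (P : ℝ) : MeasurableSet (onePeriod P) :=
  (isClosed_onePeriod P).measurableSet

lemma integrableOn_onePeriod_of_continuous {f : Spacetime → ℝ} {P r : ℝ} (hf : Continuous f)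
    (h : ∀ t ∈ Icc 0 P, ∀ x, r < ‖x‖ → f (t, x) = 0) : IntegrableOn f (onePeriod P) := by
  have hK : IsCompact (Icc 0 P ×ˢ Metric.closedBall (0 : Space) r) :=
    isCompact_Icc.prod (isCompact_closedBall _ _)
  refine (hf.continuousOn.integrableOn_compact hK).of_forall_sdiff_eq_zero
    (measurableSet_onePeriod P) ?_
  rintro ⟨t, x⟩ ⟨⟨ht, -⟩, hx⟩
  refine h t ht x ?_
  by_contra hr
  exact hx ⟨ht, by simpa using hr⟩

lemma setIntegral_onePeriod {f : Spacetime → ℝ} {P : ℝ} (hf : IntegrableOn f (onePeriod P)) :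
    ∫ z in onePeriod P, f z = ∫ t in Icc 0 P, ∫ x, f (t, x) := by
  have := setIntegral_prod (μ := volume) (ν := volume) (s := Icc 0 P) (t := (univ : Set Space))
    f hf
  rw [Measure.restrict_univ] at this
  exact this

/-- Compact support removes the spatial boundary terms. The two time faces cancel because x ↦ R x +
l preserves volume and carries the flux at time 0 to the flux at time P. -/
theorem integral_divergence_eq_zero {J : Fin 4 → Spacetime → ℝ} {P r : ℝ} (hP : 0 < P)
    (hJ : ∀ μ, ContDiff ℝ 1 (J μ))
    (hr : ∀ μ, ∀ t ∈ Ioo (-1) (P + 1), ∀ x, r ≤ ‖x‖ → J μ (t, x) = 0)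
    (R : Space ≃ₗᵢ[ℝ] Space) (l : Space) (hper : ∀ x, J 0 (P, R x + l) = J 0 (0, x)) :
    ∫ z in onePeriod P, ∑ μ, eta μ * pd μ (J μ) z = 0 := by
  have hd : ∀ μ, Differentiable ℝ (J μ) := fun μ => (hJ μ).differentiable (by simp)
  have hcont : ∀ μ, Continuous (pd μ (J μ)) := fun μ =>
    ((hJ μ).continuous_fderiv (by simp)).clm_apply continuous_const
  have hIcc : Icc 0 P ⊆ Ioo (-1) (P + 1) := fun t ht => ⟨by linarith [ht.1], by linarith [ht.2]⟩
  have hvan : ∀ μ, ∀ t ∈ Icc 0 P, ∀ x, r < ‖x‖ → pd μ (J μ) (t, x) = 0 := by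
    intro μ t ht x hx
    -- The vanishing assumption covers a time interval larger than the period, so the derivatives
    -- vanish at the end times 0 and P as well.
    have hopen : IsOpen {z : Spacetime | z.1 ∈ Ioo (-1) (P + 1) ∧ r < ‖z.2‖} :=
      (isOpen_Ioo.preimage continuous_fst).inter
        (isOpen_lt continuous_const continuous_snd.norm)
    have : J μ =ᶠ[𝓝 (t, x)] fun _ => 0 :=
      Filter.eventually_of_mem (hopen.mem_nhds ⟨hIcc ht, hx⟩) fun z hz =>
        hr μ z.1 hz.1 z.2 hz.2.le
    simp [pd, this.fderiv_eq]
  have hint : ∀ μ, IntegrableOn (pd μ (J μ)) (onePeriod P) := fun μ =>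
    integrableOn_onePeriod_of_continuous (hcont μ) (hvan μ)
  have hsupp : ∀ μ, ∀ t ∈ Icc 0 P, HasCompactSupport fun x => J μ (t, x) := fun μ t ht =>
    hasCompactSupport_of_forall_le_norm fun x hx => hr μ t (hIcc ht) x hx
  have hslice : ∀ μ, ∀ t, ContDiff ℝ 1 fun x => J μ (t, x) := fun μ t =>
    (hJ μ).comp (contDiff_const.prodMk contDiff_id)
  rw [integral_finsetSum _ fun μ _ => (hint μ).const_mul (eta μ), Fin.sum_univ_succ]
  have htime : ∫ z in onePeriod P, eta 0 * pd 0 (J 0) z = 0 := by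
    rw [integral_const_mul]
    refine mul_eq_zero_of_right _ ?_
    have hsw := integral_integral_swap (μ := volume.restrict (Icc 0 P)) (ν := (volume : Measure Space))
      (f := fun t x => pd 0 (J 0) (t, x)) (by
        have := hint 0
        rw [IntegrableOn, onePeriod, Measure.volume_eq_prod, ← Measure.prod_restrict,
          Measure.restrict_univ] at this
        exact this)
    rw [setIntegral_onePeriod (hint 0), hsw]
    have hftc : ∀ x, ∫ t in Icc 0 P, pd 0 (J 0) (t, x) = J 0 (P, x) - J 0 (0, x) := by
      intro x
      rw [integral_Icc_eq_integral_Ioc, ← intervalIntegral.integral_of_le hP.le]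
      exact intervalIntegral.integral_eq_sub_of_hasDerivAt
        (fun t _ => pd_zero_hasDerivAt (hd 0) t x)
        (((hcont 0).comp (f := fun t : ℝ => ((t, x) : Spacetime)) (by fun_prop)).intervalIntegrable
          0 P)
    have hi : ∀ t ∈ Icc 0 P, Integrable fun x => J 0 (t, x) := fun t ht =>
      (hslice 0 t).continuous.integrable_of_hasCompactSupport (hsupp 0 t ht)
    simp only [hftc]
    rw [integral_sub (hi P (by simp [hP.le])) (hi 0 (by simp [hP.le])), sub_eq_zero,
      ← integral_add_right_eq_self _ l,
      ← R.measurePreserving.integral_comp R.toHomeomorph.measurableEmbedding]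
    simp only [hper]
  have hspace : ∀ i : Fin 3, ∫ z in onePeriod P, eta i.succ * pd i.succ (J i.succ) z = 0 := by
    intro i
    rw [integral_const_mul, setIntegral_onePeriod (hint i.succ)]
    refine mul_eq_zero_of_right _ ?_
    refine setIntegral_eq_zero_of_forall_eq_zero fun t ht => ?_
    simp only [pd_succ_eq (hd i.succ)]
    exact integral_fderiv_apply_eq_zero volume (hslice _ t) (hsupp _ t ht) _
  simp [htime, hspace]

/-! ### A Hardy inequality -/

lemma hasDerivAt_max_zero_sq (s : ℝ) : HasDerivAt (fun s : ℝ => max s 0 ^ 2) (2 * max s 0) s := by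
  rcases lt_trichotomy s 0 with hs | rfl | hs
  · rw [max_eq_right hs.le, mul_zero]
    refine (hasDerivAt_const s (0 : ℝ)).congr_of_eventuallyEq ?_
    filter_upwards [Iio_mem_nhds hs] with y hy
    rw [max_eq_right (le_of_lt hy)]
    simp
  · rw [max_self, mul_zero, hasDerivAt_iff_isLittleO_nhds_zero]
    refine (Asymptotics.IsBigO.of_bound 1 ?_).trans_isLittleO
      (Asymptotics.isLittleO_pow_id (𝕜 := ℝ) (n := 2) (by norm_num))
    filter_upwards with y
    simp only [zero_add, max_self, smul_zero, sub_zero, one_mul, norm_pow, Real.norm_eq_abs]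
    norm_num
    rw [← sq_abs (max y 0), ← sq_abs y]
    refine pow_le_pow_left₀ (abs_nonneg _) ?_ 2
    rcases le_total y 0 with h | h
    · simp [max_eq_right h]
    · simp [max_eq_left h]
  · rw [max_eq_left hs.le]
    have : HasDerivAt (fun s : ℝ => s ^ 2) (2 * s) s := by simpa using hasDerivAt_pow 2 s
    refine this.congr_of_eventuallyEq ?_
    filter_upwards [Ioi_mem_nhds hs] with y hy
    rw [max_eq_left (le_of_lt hy)]

lemma contDiff_max_zero_sq : ContDiff ℝ 1 (fun s : ℝ => max s 0 ^ 2) := by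
  rw [contDiff_one_iff_deriv]
  refine ⟨fun s => (hasDerivAt_max_zero_sq s).differentiableAt, ?_⟩
  rw [funext fun s => (hasDerivAt_max_zero_sq s).deriv]
  fun_prop

/-- A truncation of `s ↦ s` on `[0, ∞)` which vanishes for `s ≤ ε`. -/
def softTrunc (ε s : ℝ) : ℝ := max (s - ε) 0 ^ 2 / (s + ε)

lemma softTrunc_nonneg {ε s : ℝ} (hε : 0 < ε) (hs : 0 ≤ s) : 0 ≤ softTrunc ε s := by
  unfold softTrunc; positivity

lemma softTrunc_of_le {ε s : ℝ} (hs : s ≤ ε) : softTrunc ε s = 0 := by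
  simp [softTrunc, max_eq_right (sub_nonpos.2 hs)]

/-- The bound on c² is what turns |∇s|² ≤ 4sk into |∇F|² ≤ 16Fk for the truncation F of s, uniformly
in ε. -/
lemma exists_hasDerivAt_softTrunc {ε s : ℝ} (hε : 0 < ε) (hs : 0 ≤ s) :
    ∃ c, HasDerivAt (softTrunc ε) c s ∧ c ^ 2 * s ≤ 4 * softTrunc ε s := by
  set m := max (s - ε) 0 with hm
  have h0 : 0 < s + ε := by positivity
  refine ⟨(2 * m * (s + ε) - m ^ 2 * 1) / (s + ε) ^ 2, ?_, ?_⟩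
  · have h1 : HasDerivAt (fun s : ℝ => max (s - ε) 0 ^ 2) (2 * m) s := by
      have := (hasDerivAt_max_zero_sq (s - ε)).comp s ((hasDerivAt_id s).sub_const ε)
      rwa [mul_one] at this
    exact h1.div ((hasDerivAt_id s).add_const ε) h0.ne'
  · have hm0 : 0 ≤ m := le_max_right _ _
    have hms : m ≤ s + ε := max_le (by linarith) h0.le
    have hc0 : 0 ≤ (2 * m * (s + ε) - m ^ 2 * 1) / (s + ε) ^ 2 := by
      apply div_nonneg _ (by positivity)
      nlinarith
    have hc1 : (2 * m * (s + ε) - m ^ 2 * 1) / (s + ε) ^ 2 ≤ 2 * m / (s + ε) := by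
      rw [div_le_div_iff₀ (by positivity) h0]
      nlinarith [mul_nonneg (sq_nonneg m) h0.le]
    calc _ ≤ (2 * m / (s + ε)) ^ 2 * (s + ε) := by
            apply mul_le_mul _ (by linarith) hs (by positivity)
            exact pow_le_pow_left₀ hc0 hc1 2
      _ = 4 * softTrunc ε s := by
            rw [softTrunc, ← hm]
            field_simp
            ring

lemma tendsto_softTrunc {s : ℝ} (hs : 0 ≤ s) :
    Tendsto (fun n : ℕ => softTrunc (1 / (n + 1 : ℝ)) s) atTop (𝓝 s) := by
  have h := tendsto_one_div_add_atTop_nhds_zero_nat (𝕜 := ℝ)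
  rcases hs.eq_or_lt with rfl | hs
  · refine tendsto_const_nhds.congr fun n => ?_
    rw [softTrunc_of_le (by positivity)]
  · have : Tendsto (fun n : ℕ => max (s - 1 / (n + 1 : ℝ)) 0 ^ 2 / (s + 1 / (n + 1 : ℝ))) atTop
        (𝓝 (max (s - 0) 0 ^ 2 / (s + 0))) :=
      (((tendsto_const_nhds.sub h).max tendsto_const_nhds).pow 2).div
        (tendsto_const_nhds.add h) (by simpa using hs.ne')
    have e : max (s - 0) 0 ^ 2 / (s + 0) = s := by
      rw [sub_zero, add_zero, max_eq_left hs.le]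
      field_simp
    rwa [e] at this

/-- The truncation has compact support because s tends to 0, so the divergence of F(x) x/(1 + |x|²)
integrates to zero. In dimension three this divergence is at least F/(1 + |x|²) plus a gradient
term, and Young's inequality absorbs the latter into half of the main term and 8k. -/
lemma lintegral_softTrunc_le {s k : Space → ℝ} {ε : ℝ} (hε : 0 < ε) (hs : ContDiff ℝ 1 s)
    (hs0 : ∀ x, 0 ≤ s x) (hlim : Tendsto s (cocompact Space) (𝓝 0)) (hk0 : ∀ x, 0 ≤ k x)
    (hk : Integrable k)
    (hsk : ∀ x, ∑ i, fderiv ℝ s x (EuclideanSpace.single i (1 : ℝ)) ^ 2 ≤ 4 * (s x * k x)) :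
    ∫⁻ x, ENNReal.ofReal (softTrunc ε (s x) / (1 + ‖x‖ ^ 2))
      ≤ ENNReal.ofReal (16 * ∫ x, k x) := by
  set F : Space → ℝ := fun x => softTrunc ε (s x) with hF
  have hFc : ContDiff ℝ 1 F :=
    ((contDiff_max_zero_sq.comp (hs.sub contDiff_const))).div (hs.add contDiff_const)
      fun x => by have := hs0 x; positivity
  have hF0 : ∀ x, 0 ≤ F x := fun x => softTrunc_nonneg hε (hs0 x)
  have hsupp : HasCompactSupport F := by
    have h := hlim.eventually (Iio_mem_nhds hε)
    rw [Filter.eventually_iff, mem_cocompact] at h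
    obtain ⟨K, hK, hKs⟩ := h
    refine HasCompactSupport.intro hK fun x hx => softTrunc_of_le ?_
    exact le_of_lt (hKs hx)
  set w : Space → ℝ := fun x => 1 + ‖x‖ ^ 2 with hw
  have hw0 : ∀ x, 0 < w x := fun x => by positivity
  have hwc : ContDiff ℝ 1 w := contDiff_const.add (contDiff_norm_sq ℝ)
  have hwd : ∀ x v, fderiv ℝ w x v = 2 * inner ℝ x v := by
    intro x v
    have : HasFDerivAt w (2 • innerSL ℝ x) x :=
      ((hasStrictFDerivAt_norm_sq x).hasFDerivAt).const_add 1
    rw [this.fderiv]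
    simp
  set f : Fin 3 → Space → ℝ := fun i x => F x * (x i / w x) with hf
  have hcoord : ∀ i : Fin 3, ContDiff ℝ 1 fun x : Space => x i := fun i => by fun_prop
  have hfc : ∀ i, ContDiff ℝ 1 (f i) := fun i =>
    hFc.mul ((hcoord i).div hwc fun x => (hw0 x).ne')
  have hfs : ∀ i, HasCompactSupport (f i) := fun i => hsupp.mul_right
  have hfint : ∀ i, Integrable fun x => fderiv ℝ (f i) x (EuclideanSpace.single i (1 : ℝ)) :=
    fun i => (((hfc i).continuous_fderiv (by simp)).clm_apply
      continuous_const).integrable_of_hasCompactSupport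
      (((hfs i).fderiv (𝕜 := ℝ)).mono fun x hx h => hx (by simp [h]))
  have hdiv : ∫ x, ∑ i, fderiv ℝ (f i) x (EuclideanSpace.single i (1 : ℝ)) = 0 := by
    rw [integral_finsetSum _ fun i _ => hfint i]
    exact Finset.sum_eq_zero fun i _ =>
      integral_fderiv_apply_eq_zero volume (hfc i) (hfs i) _
  have hdf : ∀ x, ∑ i, fderiv ℝ (f i) x (EuclideanSpace.single i (1 : ℝ))
      = (∑ i, fderiv ℝ F x (EuclideanSpace.single i (1 : ℝ)) * x i) / w x
        + F x * (3 + ‖x‖ ^ 2) / w x ^ 2 := by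
    intro x
    have hi : ∀ i : Fin 3, fderiv ℝ (f i) x (EuclideanSpace.single i (1 : ℝ))
        = fderiv ℝ F x (EuclideanSpace.single i (1 : ℝ)) * x i / w x
          + F x * (1 / w x - 2 * x i ^ 2 / w x ^ 2) := by
      intro i
      have h1 : HasFDerivAt F (fderiv ℝ F x) x := (hFc.differentiable (by simp) x).hasFDerivAt
      have h2 : HasFDerivAt w (fderiv ℝ w x) x := (hwc.differentiable (by simp) x).hasFDerivAt
      have h3 : HasFDerivAt (fun x : Space => x i) (EuclideanSpace.proj i : Space →L[ℝ] ℝ) x :=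
        (EuclideanSpace.proj i : Space →L[ℝ] ℝ).hasFDerivAt
      have h4 := h1.mul (h3.mul ((hasDerivAt_inv (hw0 x).ne').comp_hasFDerivAt x h2))
      have h5 : f i = F * ((fun x => x i) * (fun y => y⁻¹) ∘ w) := by
        ext y; simp [hf, div_eq_mul_inv]
      rw [h5, HasFDerivAt.fderiv h4]
      simp only [add_apply, smul_apply, smul_eq_mul, hwd, EuclideanSpace.inner_single_right]
      have := (hw0 x).ne'
      simp
      field_simp
      ring
    simp only [hi, Finset.sum_add_distrib, ← Finset.mul_sum, ← Finset.sum_div,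
      Finset.sum_sub_distrib]
    have hn : ∑ i : Fin 3, x i ^ 2 = ‖x‖ ^ 2 := by
      rw [EuclideanSpace.norm_sq_eq]; simp
    rw [hn]
    have := (hw0 x).ne'
    congr 1
    simp
    field_simp
    simp only [hw]
    ring
  have hptw : ∀ x, F x / w x / 2
      ≤ (∑ i, fderiv ℝ (f i) x (EuclideanSpace.single i (1 : ℝ))) + 8 * k x := by
    intro x
    rw [hdf]
    set A := ∑ i, fderiv ℝ F x (EuclideanSpace.single i (1 : ℝ)) * x i with hA
    have hA2 : A ^ 2 ≤ 16 * (F x * k x) * w x := by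
      obtain ⟨c, hc, hcs⟩ := exists_hasDerivAt_softTrunc hε (hs0 x)
      have hFd : ∀ v, fderiv ℝ F x v = c * fderiv ℝ s x v := by
        intro v
        have := hc.comp_hasFDerivAt x (hs.differentiable (by simp) x).hasFDerivAt
        rw [show F = softTrunc ε ∘ s from rfl, this.fderiv]
        simp
      have hcs' := Finset.sum_mul_sq_le_sq_mul_sq Finset.univ
        (fun i => fderiv ℝ F x (EuclideanSpace.single i (1 : ℝ))) (fun i => x i)
      have hn : ∑ i : Fin 3, x i ^ 2 = ‖x‖ ^ 2 := by
        rw [EuclideanSpace.norm_sq_eq]; simp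
      have hg : ∑ i, fderiv ℝ F x (EuclideanSpace.single i (1 : ℝ)) ^ 2
          ≤ 16 * (F x * k x) := by
        simp only [hFd, mul_pow, ← Finset.mul_sum]
        calc _ ≤ c ^ 2 * (4 * (s x * k x)) :=
              mul_le_mul_of_nonneg_left (hsk x) (sq_nonneg c)
          _ = 4 * ((c ^ 2 * s x) * k x) := by ring
          _ ≤ 4 * ((4 * F x) * k x) := by
              have := mul_le_mul_of_nonneg_right hcs (hk0 x)
              linarith
          _ = _ := by ring
      rw [hn] at hcs'
      refine hcs'.trans (mul_le_mul hg ?_ (sq_nonneg _) ?_)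
      · simp [hw]
      · have := mul_nonneg (hF0 x) (hk0 x)
        positivity
    -- This is 4√(ab) ≤ a/2 + 8b with a = F/w and b = k.
    have hb : -(A / w x) ≤ F x / w x / 2 + 8 * k x := by
      have hnn : 0 ≤ F x / w x / 2 + 8 * k x := by
        have := div_nonneg (hF0 x) (hw0 x).le
        have := hk0 x
        positivity
      refine (neg_le_abs _).trans (abs_le_of_sq_le_sq ?_ hnn)
      have h1 : (A / w x) ^ 2 ≤ 16 * (F x / w x * k x) := by
        rw [div_pow, div_le_iff₀ (pow_pos (hw0 x) 2)]
        calc A ^ 2 ≤ 16 * (F x * k x) * w x := hA2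
          _ = _ := by have := (hw0 x).ne'; field_simp
      nlinarith [sq_nonneg (F x / w x / 2 - 8 * k x)]
    have hc : F x / w x ≤ F x * (3 + ‖x‖ ^ 2) / w x ^ 2 := by
      rw [div_le_div_iff₀ (hw0 x) (pow_pos (hw0 x) 2)]
      have : F x * (w x ^ 2) ≤ F x * ((3 + ‖x‖ ^ 2) * w x) := by
        apply mul_le_mul_of_nonneg_left _ (hF0 x)
        rw [sq]
        apply mul_le_mul_of_nonneg_right _ (hw0 x).le
        simp only [hw]; linarith
      linarith
    linarith
  have hFw : Integrable fun x => F x / w x := by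
    refine (hFc.continuous.div hwc.continuous
      fun x => (hw0 x).ne').integrable_of_hasCompactSupport ?_
    simp only [div_eq_mul_inv]
    exact hsupp.mul_right
  rw [← ofReal_integral_eq_lintegral_ofReal hFw
    (Eventually.of_forall fun x => div_nonneg (hF0 x) (hw0 x).le)]
  refine ENNReal.ofReal_le_ofReal ?_
  have hmono := integral_mono (hFw.div_const 2)
    ((integrable_finsetSum _ fun i _ => hfint i).add (hk.const_mul 8)) hptw
  simp only [Pi.add_apply] at hmono
  rw [integral_add (integrable_finsetSum _ fun i _ => hfint i) (hk.const_mul 8), hdiv,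
    integral_div, integral_const_mul] at hmono
  linarith

/-- Hardy's inequality for the square `s` of the length of a field which tends to `0` at
infinity, in terms of the sum `k` of the squares of its (covariant) derivatives. -/
theorem hardy {s k : Space → ℝ} (hs : ContDiff ℝ 1 s)
    (hs0 : ∀ x, 0 ≤ s x) (hlim : Tendsto s (cocompact Space) (𝓝 0)) (hk0 : ∀ x, 0 ≤ k x)
    (hk : Integrable k)
    (hsk : ∀ x, ∑ i, fderiv ℝ s x (EuclideanSpace.single i (1 : ℝ)) ^ 2 ≤ 4 * (s x * k x)) :
    ∫⁻ x, ENNReal.ofReal (s x / (1 + ‖x‖ ^ 2)) ≤ ENNReal.ofReal (16 * ∫ x, k x) := by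
  have hlim' : ∀ x, Tendsto
      (fun n : ℕ => ENNReal.ofReal (softTrunc (1 / (n + 1 : ℝ)) (s x) / (1 + ‖x‖ ^ 2))) atTop
      (𝓝 (ENNReal.ofReal (s x / (1 + ‖x‖ ^ 2)))) := fun x =>
    ENNReal.tendsto_ofReal ((tendsto_softTrunc (hs0 x)).div_const _)
  -- Fatou's lemma along ε = 1/(n + 1), the bound being independent of ε.
  calc ∫⁻ x, ENNReal.ofReal (s x / (1 + ‖x‖ ^ 2))
      = ∫⁻ x, liminf (fun n : ℕ =>
          ENNReal.ofReal (softTrunc (1 / (n + 1 : ℝ)) (s x) / (1 + ‖x‖ ^ 2))) atTop :=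
        lintegral_congr fun x => (hlim' x).liminf_eq.symm
    _ ≤ liminf (fun n : ℕ => ∫⁻ x,
          ENNReal.ofReal (softTrunc (1 / (n + 1 : ℝ)) (s x) / (1 + ‖x‖ ^ 2))) atTop := by
        refine lintegral_liminf_le fun n => ?_
        have : Measurable s := hs.continuous.measurable
        unfold softTrunc
        fun_prop
    _ ≤ ENNReal.ofReal (16 * ∫ x, k x) := by
        refine liminf_le_of_le (by isBoundedDefault) fun b hb => ?_
        obtain ⟨n, hn⟩ := hb.exists
        exact hn.trans (lintegral_softTrunc_le (by positivity) hs hs0 hlim hk0 hk hsk)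

/-! ### Rotations of space acting on space-time -/

/-- The action of a rotation of space on the components of a vector of space-time. -/
def rotMatrix (R : Space ≃ₗᵢ[ℝ] Space) : Fin 4 → Fin 4 → ℝ :=
  Fin.cons (Fin.cons 1 0) fun i => Fin.cons 0 fun j => R (EuclideanSpace.single j (1 : ℝ)) i

section Rotation

variable (R : Space ≃ₗᵢ[ℝ] Space)

lemma rotMatrix_zero (β : Fin 4) : rotMatrix R 0 β = if β = 0 then 1 else 0 := by
  refine Fin.cases ?_ (fun j => ?_) β <;> simp [rotMatrix]

lemma rotMatrix_succ_zero (i : Fin 3) : rotMatrix R i.succ 0 = 0 := by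
  simp [rotMatrix]

lemma rotMatrix_succ_succ (i j : Fin 3) :
    rotMatrix R i.succ j.succ = R (EuclideanSpace.single j (1 : ℝ)) i := by
  simp [rotMatrix]

lemma sum_rotation_mul (j k : Fin 3) :
    ∑ i, R (EuclideanSpace.single j (1 : ℝ)) i * R (EuclideanSpace.single k (1 : ℝ)) i
      = if j = k then 1 else 0 := by
  have h := R.inner_map_map (EuclideanSpace.single j (1 : ℝ)) (EuclideanSpace.single k (1 : ℝ))
  rw [PiLp.inner_apply] at h
  simp only [EuclideanSpace.inner_single_left] at h
  simp only [RCLike.inner_apply, conj_trivial] at h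
  simp only [mul_comm (R (EuclideanSpace.single j (1 : ℝ)) _)]
  rw [h]
  simp [PiLp.single_apply]

lemma sum_rotMatrix_mul (β γ : Fin 4) :
    ∑ ν, rotMatrix R ν β * rotMatrix R ν γ = if β = γ then 1 else 0 := by
  rw [Fin.sum_univ_succ]
  refine Fin.cases ?_ (fun j => ?_) β <;> refine Fin.cases ?_ (fun k => ?_) γ <;>
    simp [rotMatrix_zero, rotMatrix_succ_zero, rotMatrix_succ_succ, sum_rotation_mul,
      Fin.succ_ne_zero, (Fin.succ_ne_zero _).symm]

lemma sum_eta_rotMatrix_mul (β γ : Fin 4) :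
    ∑ ν, eta ν * (rotMatrix R ν β * rotMatrix R ν γ) = if β = γ then eta β else 0 := by
  have he : ∀ i : Fin 3, eta i.succ = -1 := by intro i; fin_cases i <;> rfl
  have he0 : eta 0 = 1 := rfl
  rw [Fin.sum_univ_succ]
  refine Fin.cases ?_ (fun j => ?_) β <;> refine Fin.cases ?_ (fun k => ?_) γ <;>
    simp [rotMatrix_zero, rotMatrix_succ_zero, rotMatrix_succ_succ, sum_rotation_mul, he, he0,
      Fin.succ_ne_zero, (Fin.succ_ne_zero _).symm]
  split_ifs <;> simp

/-- Orthogonality of the rotation: contracting two rotated indices is the same as contracting the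
original ones. -/
lemma sum_rotMatrix_smul {E : Type*} [AddCommGroup E] [Module ℝ E] (c : Fin 4 → ℝ)
    (X : Fin 4 → E) :
    ∑ ν, (∑ β, rotMatrix R ν β * c β) • ∑ γ, rotMatrix R ν γ • X γ = ∑ β, c β • X β := by
  simp only [Finset.sum_smul_sum, smul_smul]
  rw [Finset.sum_comm]
  refine Finset.sum_congr rfl fun β _ => ?_
  rw [Finset.sum_comm]
  have : ∀ γ, ∑ ν, (rotMatrix R ν β * c β * rotMatrix R ν γ) • X γ
      = (if β = γ then 1 else 0) • c β • X γ := by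
    intro γ
    rw [← Finset.sum_smul]
    have := sum_rotMatrix_mul R β γ
    have h : ∑ ν, rotMatrix R ν β * c β * rotMatrix R ν γ
        = (∑ ν, rotMatrix R ν β * rotMatrix R ν γ) * c β := by
      rw [Finset.sum_mul]
      exact Finset.sum_congr rfl fun _ _ => by ring
    rw [h, this]
    split_ifs <;> simp
  simp [this]

lemma sum_eta_rotMatrix_inner {E : Type*} [NormedAddCommGroup E] [InnerProductSpace ℝ E]
    (X Y : Fin 4 → E) :
    ∑ μ, eta μ * inner ℝ (∑ β, rotMatrix R μ β • X β) (∑ γ, rotMatrix R μ γ • Y γ)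
      = ∑ β, eta β * inner ℝ (X β) (Y β) := by
  simp only [sum_inner, inner_sum, real_inner_smul_left, real_inner_smul_right, Finset.mul_sum]
  rw [Finset.sum_comm]
  refine Finset.sum_congr rfl fun β _ => ?_
  rw [Finset.sum_comm]
  have : ∀ γ, ∑ μ, eta μ * (rotMatrix R μ β * (rotMatrix R μ γ * inner ℝ (X γ) (Y β)))
      = (if β = γ then eta β else 0) * inner ℝ (X γ) (Y β) := by
    intro γ
    rw [← sum_eta_rotMatrix_mul R β γ, Finset.sum_mul]
    exact Finset.sum_congr rfl fun _ _ => by ring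
  simp [this]

/-- Translation in time by `P` and in space by `l`, combined with a rotation. -/
def helicalShift (P : ℝ) (l : Space) (z : Spacetime) : Spacetime := (z.1 + P, R z.2 + l)

lemma sum_rotMatrix_coordVec (μ : Fin 4) :
    ∑ α, rotMatrix R μ α • coordVec α
      = ((coordVec μ).1, R.symm (coordVec μ).2) := by
  rw [Fin.sum_univ_succ]
  refine Fin.cases ?_ (fun i => ?_) μ
  · simp [rotMatrix_zero, Fin.succ_ne_zero, coordVec]
  · simp only [rotMatrix_succ_zero, rotMatrix_succ_succ, zero_smul, zero_add, coordVec,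
      Fin.cons_succ]
    ext k
    · simp [Prod.fst_sum]
    · have h : ∀ j, R (EuclideanSpace.single j (1 : ℝ)) i
          = R.symm (EuclideanSpace.single i (1 : ℝ)) j := by
        intro j
        have h := R.inner_map_map (EuclideanSpace.single j (1 : ℝ))
          (R.symm (EuclideanSpace.single i (1 : ℝ)))
        simpa [EuclideanSpace.inner_single_left, EuclideanSpace.inner_single_right] using h
      simp only [h, Prod.snd_sum, Prod.smul_snd]
      simp [Finset.sum_apply, Pi.single_apply]

/-- This is the chain rule solved for the derivative at the shifted point; the inverse of the
orthogonal Jacobian is its transpose, hence the order of the indices. -/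
lemma pd_helicalShift {E : Type*} [NormedAddCommGroup E] [NormedSpace ℝ E] {f : Spacetime → E}
    (hf : Differentiable ℝ f) (P : ℝ) (l : Space) (μ : Fin 4) (z : Spacetime) :
    pd μ f (helicalShift R P l z)
      = ∑ α, rotMatrix R μ α • pd α (fun y => f (helicalShift R P l y)) z := by
  have h1 : HasFDerivAt (helicalShift R P l)
      ((ContinuousLinearMap.fst ℝ ℝ Space).prod
        ((R : Space →L[ℝ] Space).comp (ContinuousLinearMap.snd ℝ ℝ Space))) z :=
    ((ContinuousLinearMap.fst ℝ ℝ Space).hasFDerivAt.add_const P).prodMk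
      (((R : Space →L[ℝ] Space).comp (ContinuousLinearMap.snd ℝ ℝ Space)).hasFDerivAt.add_const l)
  have h2 : HasFDerivAt (fun y => f (helicalShift R P l y)) _ z :=
    (hf (helicalShift R P l z)).hasFDerivAt.comp z h1
  simp only [pd, h2.fderiv, ← map_smul, ← map_sum, sum_rotMatrix_coordVec]
  simp

end Rotation

/-! ### Covariance of the fields and of the stress tensor under helical shifts -/

namespace GaugeAction

variable {𝔤 H : Type*} [NormedAddCommGroup 𝔤] [InnerProductSpace ℝ 𝔤]
    [NormedAddCommGroup H] [InnerProductSpace ℝ H] (𝒜 : GaugeAction 𝔤 H)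
    {a : Fin 4 → Spacetime → 𝔤} {φ : Spacetime → H} {Vp : Spacetime → ℝ}
    {R : Space ≃ₗᵢ[ℝ] Space} {P : ℝ} {l : Space}

lemma cov_helicalShift (hφ : ContDiff ℝ ∞ φ)
    (hφp : ∀ z, φ (helicalShift R P l z) = φ z)
    (hap : ∀ μ z, a μ (helicalShift R P l z) = ∑ α, rotMatrix R μ α • a α z)
    (μ : Fin 4) (z : Spacetime) :
    𝒜.cov a φ μ (helicalShift R P l z) = ∑ α, rotMatrix R μ α • 𝒜.cov a φ α z := by
  simp only [cov, pd_helicalShift R (hφ.differentiable (by simp)), hφp, hap, smul_add,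
    Finset.sum_add_distrib, map_sum, map_smul, sum_apply, smul_apply]

lemma curvature_helicalShift (ha : ∀ μ, ContDiff ℝ ∞ (a μ))
    (hap : ∀ μ z, a μ (helicalShift R P l z) = ∑ α, rotMatrix R μ α • a α z)
    (μ ν : Fin 4) (z : Spacetime) :
    𝒜.curvature a μ ν (helicalShift R P l z)
      = ∑ α, ∑ β, (rotMatrix R μ α * rotMatrix R ν β) • 𝒜.curvature a α β z := by
  have hd : ∀ μ, Differentiable ℝ (a μ) := fun μ => (ha μ).differentiable (by simp)
  have h1 : ∀ μ ν, pd μ (a ν) (helicalShift R P l z)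
      = ∑ α, ∑ β, (rotMatrix R μ α * rotMatrix R ν β) • pd α (a β) z := by
    intro μ ν
    rw [pd_helicalShift R (hd ν)]
    refine Finset.sum_congr rfl fun α _ => ?_
    simp only [hap]
    rw [pd_sum (f := fun β y => rotMatrix R ν β • a β y) fun β _ => ((hd β).const_smul (rotMatrix R ν β)) z, Finset.smul_sum]
    refine Finset.sum_congr rfl fun β _ => ?_
    rw [mul_smul]
    congr 1
    simp [pd, fderiv_fun_const_smul ((hd β) z)]
  have h2 : pd ν (a μ) (helicalShift R P l z)
      = ∑ α, ∑ β, (rotMatrix R μ α * rotMatrix R ν β) • pd β (a α) z := by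
    rw [h1, Finset.sum_comm]
    simp only [mul_comm]
  rw [curvature, h1, h2]
  simp only [curvature, hap, smul_add, smul_sub, Finset.sum_add_distrib, Finset.sum_sub_distrib]
  congr 1
  simp only [map_sum, map_smul, sum_apply, smul_apply, Finset.smul_sum, smul_smul]
  rw [Finset.sum_comm]
  exact Finset.sum_congr rfl fun β _ => Finset.sum_congr rfl fun α _ => by rw [mul_comm]

lemma lagr_helicalShift (ha : ∀ μ, ContDiff ℝ ∞ (a μ)) (hφ : ContDiff ℝ ∞ φ)
    (hφp : ∀ z, φ (helicalShift R P l z) = φ z)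
    (hap : ∀ μ z, a μ (helicalShift R P l z) = ∑ α, rotMatrix R μ α • a α z)
    (hVp : ∀ z, Vp (helicalShift R P l z) = Vp z) (z : Spacetime) :
    𝒜.lagr a φ Vp (helicalShift R P l z) = 𝒜.lagr a φ Vp z := by
  have hF : ∀ μ, ∑ ν, eta ν * inner ℝ (𝒜.curvature a μ ν (helicalShift R P l z))
      (𝒜.curvature a μ ν (helicalShift R P l z))
      = ∑ γ, eta γ * inner ℝ (∑ α, rotMatrix R μ α • 𝒜.curvature a α γ z)
        (∑ α, rotMatrix R μ α • 𝒜.curvature a α γ z) := by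
    intro μ
    rw [← sum_eta_rotMatrix_inner R (fun γ => ∑ α, rotMatrix R μ α • 𝒜.curvature a α γ z)]
    refine Finset.sum_congr rfl fun ν _ => ?_
    have : 𝒜.curvature a μ ν (helicalShift R P l z)
        = ∑ β, rotMatrix R ν β • ∑ α, rotMatrix R μ α • 𝒜.curvature a α β z := by
      rw [𝒜.curvature_helicalShift ha hap, Finset.sum_comm]
      simp only [Finset.smul_sum, smul_smul, mul_comm]
    rw [this]
  simp only [lagr, 𝒜.cov_helicalShift hφ hφp hap, sum_eta_rotMatrix_inner, hVp, mul_assoc,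
    ← Finset.mul_sum, hF]
  congr 2
  simp only [Finset.mul_sum]
  rw [Finset.sum_comm]
  have : ∀ γ, ∑ μ, eta μ * (eta γ * inner ℝ (∑ α, rotMatrix R μ α • 𝒜.curvature a α γ z)
        (∑ α, rotMatrix R μ α • 𝒜.curvature a α γ z))
      = ∑ μ, eta μ * (eta γ * inner ℝ (𝒜.curvature a μ γ z) (𝒜.curvature a μ γ z)) := by
    intro γ
    have := congrArg (eta γ * ·) (sum_eta_rotMatrix_inner R (fun α => 𝒜.curvature a α γ z)
      (fun α => 𝒜.curvature a α γ z))
    simp only [Finset.mul_sum] at this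
    simp only [mul_left_comm _ (eta γ)]
    exact this
  simp only [this]
  exact Finset.sum_comm

/-- The time component of the current T_{μν}c^ν is a scalar, since spatial rotations leave the index
0 alone. This makes the fluxes through the two time faces agree. -/
lemma sum_stress_zero_helicalShift (ha : ∀ μ, ContDiff ℝ ∞ (a μ)) (hφ : ContDiff ℝ ∞ φ)
    (hφp : ∀ z, φ (helicalShift R P l z) = φ z)
    (hap : ∀ μ z, a μ (helicalShift R P l z) = ∑ α, rotMatrix R μ α • a α z)
    (hVp : ∀ z, Vp (helicalShift R P l z) = Vp z) (c c' : Fin 4 → ℝ)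
    (hc : ∀ ν, c' ν = ∑ β, rotMatrix R ν β * c β) (z : Spacetime) :
    ∑ ν, 𝒜.stress a φ Vp 0 ν (helicalShift R P l z) * c' ν
      = ∑ ν, 𝒜.stress a φ Vp 0 ν z * c ν := by
  -- Everything is expressed by η-contractions of vectors, which `sum_eta_rotMatrix_inner` and
  -- `sum_rotMatrix_smul` show to be invariant.
  have key : ∀ (c : Fin 4 → ℝ) y, ∑ ν, 𝒜.stress a φ Vp 0 ν y * c ν
      = 2 * inner ℝ (𝒜.cov a φ 0 y) (∑ ν, c ν • 𝒜.cov a φ ν y)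
        - ∑ ρ, eta ρ * inner ℝ (𝒜.curvature a 0 ρ y) (∑ ν, c ν • 𝒜.curvature a ν ρ y)
        - c 0 * 𝒜.lagr a φ Vp y := by
    intro c y
    simp only [stress, sub_mul, Finset.sum_sub_distrib]
    congr 1
    · congr 1
      · simp only [inner_sum, real_inner_smul_right, Finset.mul_sum]
        exact Finset.sum_congr rfl fun _ _ => by ring
      · simp only [inner_sum, real_inner_smul_right, Finset.mul_sum, Finset.sum_mul]
        rw [Finset.sum_comm]
        exact Finset.sum_congr rfl fun _ _ => Finset.sum_congr rfl fun _ _ => by ring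
    · simp only [ite_mul, zero_mul, Finset.sum_ite_eq, Finset.mem_univ, if_true]
      change 1 * _ * _ = _
      ring
  rw [key, key, 𝒜.lagr_helicalShift ha hφ hφp hap hVp]
  have h0 : c' 0 = c 0 := by simp [hc, rotMatrix_zero]
  have h1 : 𝒜.cov a φ 0 (helicalShift R P l z) = 𝒜.cov a φ 0 z := by
    simp [𝒜.cov_helicalShift hφ hφp hap, rotMatrix_zero]
  have h2 : ∑ ν, c' ν • 𝒜.cov a φ ν (helicalShift R P l z) = ∑ ν, c ν • 𝒜.cov a φ ν z := by
    simp only [hc, 𝒜.cov_helicalShift hφ hφp hap, sum_rotMatrix_smul]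
  have h3 : ∀ ρ, 𝒜.curvature a 0 ρ (helicalShift R P l z)
      = ∑ β, rotMatrix R ρ β • 𝒜.curvature a 0 β z := by
    intro ρ
    rw [𝒜.curvature_helicalShift ha hap]
    simp [rotMatrix_zero]
  have h4 : ∀ ρ, ∑ ν, c' ν • 𝒜.curvature a ν ρ (helicalShift R P l z)
      = ∑ β, rotMatrix R ρ β • ∑ ν, c ν • 𝒜.curvature a ν β z := by
    intro ρ
    have : ∀ ν, 𝒜.curvature a ν ρ (helicalShift R P l z)
        = ∑ α, rotMatrix R ν α • ∑ β, rotMatrix R ρ β • 𝒜.curvature a α β z := by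
      intro ν
      rw [𝒜.curvature_helicalShift ha hap]
      simp only [Finset.smul_sum, smul_smul]
    simp only [this, hc, sum_rotMatrix_smul]
    simp only [Finset.smul_sum, smul_smul]
    rw [Finset.sum_comm]
    simp only [mul_comm]
  simp only [h0, h1, h2, h3, h4, sum_eta_rotMatrix_inner]

end GaugeAction

/-! ### Comoving coordinates and cutoffs -/

/-- The spatial part of the Minkowski-orthogonal projection along the four-velocity `(1, v)`,
where `κ = 1 / (1 - |v|²)`. -/
def comoving (κ : ℝ) (v : Space) : Spacetime →L[ℝ] Space :=
  ContinuousLinearMap.snd ℝ ℝ Space - (κ • (ContinuousLinearMap.fst ℝ ℝ Space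
    - (innerSL ℝ v).comp (ContinuousLinearMap.snd ℝ ℝ Space))).smulRight v

/-- The space-time components of a vector orthogonal to `(1, v)`, in terms of its spatial part. -/
def orthLift (v : Space) : Fin 4 → Space → ℝ :=
  Fin.cons (fun y => inner ℝ v y) fun i y => y i

/-- A rotation invariant smooth cutoff. -/
def cutoff (y : Space) : ℝ := Real.smoothTransition (2 - ‖y‖ ^ 2)

section Comoving

variable {κ P : ℝ} {v : Space} {R : Space ≃ₗᵢ[ℝ] Space}

lemma comoving_apply (κ : ℝ) (v : Space) (z : Spacetime) :
    comoving κ v z = z.2 - (κ * (z.1 - inner ℝ v z.2)) • v := by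
  simp [comoving]

/-- The translation is by a multiple of (1, v), which the projection annihilates, and the rotation
commutes with the projection because it fixes v. -/
lemma comoving_helicalShift (hκ : κ * (1 - ‖v‖ ^ 2) = 1) (hR : R v = v) (z : Spacetime) :
    comoving κ v (helicalShift R P (P • v) z) = R (comoving κ v z) := by
  have h : inner ℝ v (R z.2) = inner ℝ v z.2 := by
    have := R.inner_map_map v z.2
    rwa [hR] at this
  simp only [comoving_apply, helicalShift, map_sub, map_smul, hR, inner_add_right, h,
    real_inner_smul_right, real_inner_self_eq_norm_sq]
  have : κ * (z.1 + P - (inner ℝ v z.2 + P * ‖v‖ ^ 2))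
      = κ * (z.1 - inner ℝ v z.2) + P * (κ * (1 - ‖v‖ ^ 2)) := by ring
  rw [this, hκ, mul_one, add_smul]
  abel

/-- The operator 1 + κ v vᵀ does not shorten vectors, and applied to x it gives the comoving
position plus κ t v. Hence a cutoff in the comoving position is a cutoff in x as long as t stays
bounded. -/
lemma norm_le_comoving (hκ : 0 ≤ κ) (z : Spacetime) :
    ‖z.2‖ ≤ ‖comoving κ v z‖ + κ * |z.1| * ‖v‖ := by
  have h1 : ‖z.2‖ ≤ ‖z.2 + (κ * inner ℝ v z.2) • v‖ := by
    have h : ‖z.2‖ ^ 2 ≤ ‖z.2‖ * ‖z.2 + (κ * inner ℝ v z.2) • v‖ := by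
      refine le_trans ?_ (real_inner_le_norm z.2 _)
      rw [inner_add_right, real_inner_smul_right, real_inner_self_eq_norm_sq,
        real_inner_comm v z.2]
      nlinarith [mul_nonneg hκ (sq_nonneg (inner ℝ v z.2))]
    rcases (norm_nonneg z.2).eq_or_lt with h0 | h0
    · rw [← h0]; exact norm_nonneg _
    · exact le_of_mul_le_mul_left (by linarith [sq (‖z.2‖)]) h0
  have h2 : z.2 + (κ * inner ℝ v z.2) • v = comoving κ v z + (κ * z.1) • v := by
    rw [comoving_apply, mul_sub, sub_smul]
    abel
  rw [h2] at h1
  refine h1.trans ((norm_add_le _ _).trans ?_)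
  rw [norm_smul, norm_mul, Real.norm_eq_abs, Real.norm_eq_abs, abs_of_nonneg hκ]

lemma orthLift_rotation (hR : R v = v) (ν : Fin 4) (y : Space) :
    orthLift v ν (R y) = ∑ β, rotMatrix R ν β * orthLift v β y := by
  refine Fin.cases ?_ (fun i => ?_) ν
  · have h : inner ℝ v (R y) = inner ℝ v y := by
      have := R.inner_map_map v y
      rwa [hR] at this
    simp [rotMatrix_zero, orthLift, h]
  · rw [Fin.sum_univ_succ]
    simp only [rotMatrix_succ_zero, rotMatrix_succ_succ, zero_mul, zero_add, orthLift,
      Fin.cons_succ]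
    have hy : y = ∑ j, y j • EuclideanSpace.single j (1 : ℝ) := by
      ext k
      simp [Pi.single_apply]
    conv_lhs => rw [hy]
    simp [mul_comm]

lemma contDiff_orthLift (ν : Fin 4) : ContDiff ℝ ∞ (orthLift v ν) := by
  refine Fin.cases ?_ (fun i => ?_) ν
  · simp only [orthLift, Fin.cons_zero]
    fun_prop
  · simp only [orthLift, Fin.cons_succ]
    fun_prop

lemma orthLift_add (ν : Fin 4) (y y' : Space) :
    orthLift v ν (y + y') = orthLift v ν y + orthLift v ν y' := by
  refine Fin.cases ?_ (fun i => ?_) ν <;> simp [orthLift, inner_add_right]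

lemma orthLift_smul (ν : Fin 4) (c : ℝ) (y : Space) :
    orthLift v ν (c • y) = c * orthLift v ν y := by
  refine Fin.cases ?_ (fun i => ?_) ν <;> simp [orthLift, real_inner_smul_right]

lemma contDiff_cutoff : ContDiff ℝ ∞ cutoff :=
  Real.smoothTransition.contDiff.comp (contDiff_const.sub (contDiff_norm_sq ℝ))

lemma cutoff_zero : cutoff 0 = 1 :=
  Real.smoothTransition.one_of_one_le (by simp)

lemma cutoff_of_two_le {y : Space} (h : 2 ≤ ‖y‖) : cutoff y = 0 :=
  Real.smoothTransition.zero_of_nonpos (by nlinarith)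

lemma cutoff_mem (y : Space) : 0 ≤ cutoff y ∧ cutoff y ≤ 1 :=
  ⟨Real.smoothTransition.nonneg _, Real.smoothTransition.le_one _⟩

lemma cutoff_rotation (y : Space) : cutoff (R y) = cutoff y := by
  simp [cutoff]

lemma hasCompactSupport_cutoff : HasCompactSupport cutoff :=
  hasCompactSupport_of_forall_le_norm fun _ => cutoff_of_two_le

/-- The cut off lift of a comoving position vector. -/
def cutoffLift (v : Space) (ν : Fin 4) (y : Space) : ℝ := cutoff y * orthLift v ν y

lemma contDiff_cutoffLift (ν : Fin 4) : ContDiff ℝ ∞ (cutoffLift v ν) :=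
  contDiff_cutoff.mul (contDiff_orthLift ν)

lemma cutoffLift_rotation (hR : R v = v) (ν : Fin 4) (y : Space) :
    cutoffLift v ν (R y) = ∑ β, rotMatrix R ν β * cutoffLift v β y := by
  simp only [cutoffLift, cutoff_rotation, orthLift_rotation hR, Finset.mul_sum]
  exact Finset.sum_congr rfl fun _ _ => by ring

/-- Near 0 only the linear factor contributes, since it vanishes at 0 where the cutoff is 1. This
identifies the limit of the rescaled vector fields. -/
lemma fderiv_cutoffLift_zero (ν : Fin 4) (w : Space) :
    fderiv ℝ (cutoffLift v ν) 0 w = orthLift v ν w := by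
  have h1 : DifferentiableAt ℝ cutoff 0 := contDiff_cutoff.differentiable (by simp) 0
  have h2 : DifferentiableAt ℝ (orthLift v ν) 0 :=
    (contDiff_orthLift ν).differentiable (by simp) 0
  have h3 : orthLift v ν 0 = 0 := by
    have := orthLift_smul (v := v) ν 0 0
    simpa using this
  have h4 : HasLineDerivAt ℝ (orthLift v ν) (orthLift v ν w) 0 w := by
    have : (fun t : ℝ => orthLift v ν (0 + t • w)) = fun t => t * orthLift v ν w := by
      ext t; rw [zero_add, orthLift_smul]
    rw [HasLineDerivAt, this]
    simpa using (hasDerivAt_id (0 : ℝ)).mul_const (orthLift v ν w)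
  have h5 : fderiv ℝ (orthLift v ν) 0 w = orthLift v ν w :=
    (h2.lineDeriv_eq_fderiv (v := w)).symm.trans h4.lineDeriv
  change fderiv ℝ (fun y => cutoff y * orthLift v ν y) 0 w = _
  rw [fderiv_fun_mul h1 h2]
  simp [h3, h5, cutoff_zero]

/-- The weight 1 + |y| makes the gradient of y ↦ f(y/r) at most C/(1 + |y|), uniformly in r ≥ 1. -/
lemma exists_bound_fderiv {f : Space → ℝ} (hf : ContDiff ℝ ∞ f) (hc : HasCompactSupport f) :
    ∃ C, 0 ≤ C ∧ ∀ y, (1 + ‖y‖) * ‖fderiv ℝ f y‖ ≤ C := by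
  have h1 : Continuous fun y => (1 + ‖y‖) * ‖fderiv ℝ f y‖ :=
    (continuous_const.add continuous_norm).mul (hf.continuous_fderiv (by simp)).norm
  have h2 : HasCompactSupport fun y => (1 + ‖y‖) * ‖fderiv ℝ f y‖ :=
    (hc.fderiv (𝕜 := ℝ)).norm.mul_left
  obtain ⟨C, hC⟩ := h2.exists_bound_of_continuous h1
  exact ⟨C, (norm_nonneg _).trans (hC 0), fun y => (le_abs_self _).trans (hC y)⟩

lemma hasCompactSupport_cutoffLift (ν : Fin 4) : HasCompactSupport (cutoffLift v ν) :=
  hasCompactSupport_cutoff.mul_right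

lemma contDiff_smul_comoving (c : ℝ) : ContDiff ℝ ∞ fun z => c • comoving κ v z :=
  (comoving κ v).contDiff.const_smul c

lemma pd_comp_comoving {f : Space → ℝ} (hf : Differentiable ℝ f) (c : ℝ) (μ : Fin 4)
    (z : Spacetime) :
    pd μ (fun y => f (c • comoving κ v y)) z
      = c * fderiv ℝ f (c • comoving κ v z) (comoving κ v (coordVec μ)) := by
  have h1 : HasFDerivAt (fun y => c • comoving κ v y) (c • comoving κ v) z :=
    (comoving κ v).hasFDerivAt.const_smul c
  have h2 : HasFDerivAt (fun y => f (c • comoving κ v y)) _ z :=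
    (hf (c • comoving κ v z)).hasFDerivAt.comp z h1
  rw [pd, h2.fderiv]
  simp

lemma tendsto_inv_smul_zero (y : Space) :
    Tendsto (fun n : ℕ => ((n : ℝ) + 1)⁻¹ • y) atTop (𝓝 0) := by
  have := (tendsto_one_div_add_atTop_nhds_zero_nat (𝕜 := ℝ)).smul_const y
  simpa using this

end Comoving

lemma integrableOn_inner_of_sq {E : Type*} [NormedAddCommGroup E] [InnerProductSpace ℝ E]
    {X : Type*} [TopologicalSpace X] [MeasurableSpace X] [OpensMeasurableSpace X]
    {m : Measure X} {f g : X → E} (hf : Continuous f)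
    (hg : Continuous g) {s : Set X} (h1 : IntegrableOn (fun z => ‖f z‖ ^ 2) s m)
    (h2 : IntegrableOn (fun z => ‖g z‖ ^ 2) s m) :
    IntegrableOn (fun z => inner ℝ (f z) (g z)) s m := by
  refine (Integrable.add h1 h2).mono' (hf.inner hg).aestronglyMeasurable
    (Eventually.of_forall fun z => ?_)
  refine (norm_inner_le_norm _ _).trans ?_
  simp only [Pi.add_apply]
  nlinarith [sq_nonneg (‖f z‖ - ‖g z‖), sq_nonneg (‖f z‖), sq_nonneg (‖g z‖)]

/-! ### Virial identities -/

namespace GaugeAction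

variable {𝔤 H : Type*} [NormedAddCommGroup 𝔤] [InnerProductSpace ℝ 𝔤]
    [NormedAddCommGroup H] [InnerProductSpace ℝ H]

/-- A solution of the field equations which is periodic in time with period `P` up to a rotation
`R` and a translation by `P • v`, and has finite integrals over one period. -/
structure PeriodicSolution (𝒜 : GaugeAction 𝔤 H) (a : Fin 4 → Spacetime → 𝔤)
    (φ : Spacetime → H) (Vp : Spacetime → ℝ) (S : Spacetime → H) (P : ℝ) (v : Space)
    (R : Space ≃ₗᵢ[ℝ] Space) : Prop where
  contDiff_a : ∀ μ, ContDiff ℝ ∞ (a μ)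
  contDiff_φ : ContDiff ℝ ∞ φ
  contDiff_Vp : ContDiff ℝ 1 Vp
  pd_Vp : ∀ μ z, pd μ Vp z = 2 * inner ℝ (S z) (pd μ φ z)
  inner_act : ∀ X z, inner ℝ (S z) (𝒜.act X (φ z)) = 0
  fieldEquations : 𝒜.FieldEquations a φ S
  pos : 0 < P
  velocity_lt : ‖v‖ < 1
  rotation : R v = v
  shift_φ : ∀ z, φ (helicalShift R P (P • v) z) = φ z
  shift_a : ∀ μ z, a μ (helicalShift R P (P • v) z) = ∑ α, rotMatrix R μ α • a α z
  shift_Vp : ∀ z, Vp (helicalShift R P (P • v) z) = Vp z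
  lim : ∀ t : ℝ, Tendsto (fun x : Space => φ (t, x)) (cocompact Space) (𝓝 0)
  integrable_cov : ∀ μ, IntegrableOn (fun z => ‖𝒜.cov a φ μ z‖ ^ 2) (onePeriod P)
  integrable_curvature : ∀ μ ν,
    IntegrableOn (fun z => ‖𝒜.curvature a μ ν z‖ ^ 2) (onePeriod P)
  integrable_force : IntegrableOn (fun z => inner ℝ (S z) (φ z)) (onePeriod P)
  integrable_Vp : IntegrableOn Vp (onePeriod P)

namespace PeriodicSolution

variable {𝒜 : GaugeAction 𝔤 H} {a : Fin 4 → Spacetime → 𝔤}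
    {φ : Spacetime → H} {Vp : Spacetime → ℝ} {S : Spacetime → H} {P κ : ℝ} {v : Space}
    {R : Space ≃ₗᵢ[ℝ] Space} (h : 𝒜.PeriodicSolution a φ Vp S P v R)

include h

lemma continuous_cov (μ : Fin 4) : Continuous (𝒜.cov a φ μ) :=
  (𝒜.contDiff_cov h.contDiff_a h.contDiff_φ μ).continuous

lemma continuous_curvature (μ ν : Fin 4) : Continuous (𝒜.curvature a μ ν) :=
  (𝒜.contDiff_curvature h.contDiff_a μ ν).continuous

lemma contDiff_lagr : ContDiff ℝ 1 (𝒜.lagr a φ Vp) := by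
  have h1 : ∀ μ, ContDiff ℝ 1 (𝒜.cov a φ μ) :=
    fun μ => (𝒜.contDiff_cov h.contDiff_a h.contDiff_φ μ).of_le (by simp)
  have h2 : ∀ μ ν, ContDiff ℝ 1 (𝒜.curvature a μ ν) :=
    fun μ ν => (𝒜.contDiff_curvature h.contDiff_a μ ν).of_le (by simp)
  have h3 := h.contDiff_Vp
  unfold lagr
  fun_prop

lemma contDiff_stress (μ ν : Fin 4) : ContDiff ℝ 1 (𝒜.stress a φ Vp μ ν) := by
  have h1 : ∀ μ, ContDiff ℝ 1 (𝒜.cov a φ μ) :=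
    fun μ => (𝒜.contDiff_cov h.contDiff_a h.contDiff_φ μ).of_le (by simp)
  have h2 : ∀ μ ν, ContDiff ℝ 1 (𝒜.curvature a μ ν) :=
    fun μ ν => (𝒜.contDiff_curvature h.contDiff_a μ ν).of_le (by simp)
  have h3 := h.contDiff_lagr
  unfold stress
  fun_prop

lemma integrable_inner_cov (μ ν : Fin 4) :
    IntegrableOn (fun z => inner ℝ (𝒜.cov a φ μ z) (𝒜.cov a φ ν z)) (onePeriod P) :=
  integrableOn_inner_of_sq (h.continuous_cov μ) (h.continuous_cov ν) (h.integrable_cov μ)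
    (h.integrable_cov ν)

lemma integrable_inner_curvature (μ ν ρ σ : Fin 4) :
    IntegrableOn (fun z => inner ℝ (𝒜.curvature a μ ν z) (𝒜.curvature a ρ σ z))
      (onePeriod P) :=
  integrableOn_inner_of_sq (h.continuous_curvature μ ν) (h.continuous_curvature ρ σ)
    (h.integrable_curvature μ ν) (h.integrable_curvature ρ σ)

lemma integrable_lagr : IntegrableOn (𝒜.lagr a φ Vp) (onePeriod P) :=
  ((integrable_finsetSum _ fun μ _ => (h.integrable_inner_cov μ μ).const_mul (eta μ)).sub
    h.integrable_Vp).sub ((integrable_finsetSum _ fun μ _ => integrable_finsetSum _ fun ν _ =>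
      (h.integrable_inner_curvature μ ν μ ν).const_mul (eta μ * eta ν)).const_mul (1 / 4))

lemma integrable_stress (μ ν : Fin 4) : IntegrableOn (𝒜.stress a φ Vp μ ν) (onePeriod P) :=
  (((h.integrable_inner_cov μ ν).const_mul 2).sub (integrable_finsetSum _ fun ρ _ =>
    (h.integrable_inner_curvature μ ρ ν ρ).const_mul (eta ρ))).sub
    (h.integrable_lagr.const_mul _)

lemma two_le_norm_comoving (hκ : 0 ≤ κ) {r : ℝ} (hr : 0 < r) {t : ℝ} (ht : t ∈ Ioo (-1) (P + 1))
    {x : Space} (hx : 2 * r + κ * (P + 1) ≤ ‖x‖) : 2 ≤ ‖r⁻¹ • comoving κ v (t, x)‖ := by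
  have h1 := norm_le_comoving (v := v) hκ (t, x)
  have h2 : |t| ≤ P + 1 := abs_le.2 ⟨by linarith [ht.1, h.pos], ht.2.le⟩
  have h3 : κ * |t| * ‖v‖ ≤ κ * (P + 1) * 1 :=
    mul_le_mul (mul_le_mul_of_nonneg_left h2 hκ) h.velocity_lt.le (norm_nonneg _)
      (mul_nonneg hκ (by linarith [h.pos]))
  rw [norm_smul, norm_inv, Real.norm_of_nonneg hr.le, ← div_eq_inv_mul, le_div_iff₀ hr]
  simp only at h1
  linarith

/-- The virial identity in the comoving frame, with a cutoff. -/
lemma integral_stress_cutoff (hκ0 : 0 ≤ κ) (hκ : κ * (1 - ‖v‖ ^ 2) = 1) {r : ℝ} (hr : 0 < r) :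
    ∫ z in onePeriod P, ∑ μ, ∑ ν, eta μ * (𝒜.stress a φ Vp μ ν z
      * fderiv ℝ (cutoffLift v ν) (r⁻¹ • comoving κ v z) (comoving κ v (coordVec μ))) = 0 := by
  -- The prefactor r compensates the rescaling: the field is the lift of the comoving position
  -- itself, multiplied by a cutoff at distance of order r.
  have hζ : ∀ ν, ContDiff ℝ ∞ fun z => r * cutoffLift v ν (r⁻¹ • comoving κ v z) := fun ν =>
    contDiff_const.mul ((contDiff_cutoffLift ν).comp (contDiff_smul_comoving r⁻¹))
  have hJ : ∀ μ, ContDiff ℝ 1 fun z => ∑ ν, 𝒜.stress a φ Vp μ ν z *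
      (r * cutoffLift v ν (r⁻¹ • comoving κ v z)) := fun μ =>
    ContDiff.sum fun ν _ => (h.contDiff_stress μ ν).mul ((hζ ν).of_le (by simp))
  have hdiv := integral_divergence_eq_zero (P := P) (r := 2 * r + κ * (P + 1)) h.pos
    (J := fun μ z => ∑ ν, 𝒜.stress a φ Vp μ ν z *
      (r * cutoffLift v ν (r⁻¹ • comoving κ v z))) hJ (by
      intro μ t ht x hx
      refine Finset.sum_eq_zero fun ν _ => ?_
      rw [cutoffLift, cutoff_of_two_le (h.two_le_norm_comoving hκ0 hr ht hx)]
      simp) R (P • v) (by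
      intro x
      have := 𝒜.sum_stress_zero_helicalShift h.contDiff_a h.contDiff_φ h.shift_φ h.shift_a
        h.shift_Vp (fun ν => r * cutoffLift v ν (r⁻¹ • comoving κ v (0, x)))
        (fun ν => r * cutoffLift v ν
          (r⁻¹ • comoving κ v (helicalShift R P (P • v) (0, x)))) (by
          intro ν
          rw [comoving_helicalShift hκ h.rotation, ← map_smul, cutoffLift_rotation h.rotation,
            Finset.mul_sum]
          exact Finset.sum_congr rfl fun _ _ => by ring) (0, x)
      simpa [helicalShift] using this)
  rw [← hdiv]
  refine setIntegral_congr_fun (measurableSet_onePeriod P) fun z _ => ?_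
  have hds : ∀ μ ν, Differentiable ℝ (𝒜.stress a φ Vp μ ν) := fun μ ν =>
    (h.contDiff_stress μ ν).differentiable (by simp)
  have hdζ : ∀ ν, Differentiable ℝ fun z => r * cutoffLift v ν (r⁻¹ • comoving κ v z) :=
    fun ν => (hζ ν).differentiable (by simp)
  have hdl : ∀ ν, Differentiable ℝ (cutoffLift v ν) := fun ν =>
    (contDiff_cutoffLift ν).differentiable (by simp)
  have hpd : ∀ μ ν, pd μ (fun z => r * cutoffLift v ν (r⁻¹ • comoving κ v z)) z
      = fderiv ℝ (cutoffLift v ν) (r⁻¹ • comoving κ v z) (comoving κ v (coordVec μ)) := by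
    intro μ ν
    rw [pd_const_mul (f := fun z => cutoffLift v ν (r⁻¹ • comoving κ v z)) _
      (((contDiff_cutoffLift ν).comp (contDiff_smul_comoving r⁻¹)).differentiable (by simp) z),
      pd_comp_comoving (hdl ν), ← mul_assoc,
      mul_inv_cancel₀ hr.ne', one_mul]
  have hz : ∀ μ, pd μ (fun z => ∑ ν, 𝒜.stress a φ Vp μ ν z *
      (r * cutoffLift v ν (r⁻¹ • comoving κ v z))) z
      = ∑ ν, (pd μ (𝒜.stress a φ Vp μ ν) z * (r * cutoffLift v ν (r⁻¹ • comoving κ v z))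
        + 𝒜.stress a φ Vp μ ν z * fderiv ℝ (cutoffLift v ν) (r⁻¹ • comoving κ v z)
          (comoving κ v (coordVec μ))) := by
    intro μ
    rw [pd_sum fun ν _ => ((hds μ ν).fun_mul (hdζ ν)) z]
    refine Finset.sum_congr rfl fun ν _ => ?_
    rw [pd_mul (hds μ ν z) (hdζ ν z), hpd]
  simp only [hz]
  -- Conservation of the stress tensor leaves only the terms in which the vector field is
  -- differentiated.
  have hcons : ∑ μ, ∑ ν, eta μ * (pd μ (𝒜.stress a φ Vp μ ν) z *
      (r * cutoffLift v ν (r⁻¹ • comoving κ v z))) = 0 := by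
    rw [Finset.sum_comm]
    refine Finset.sum_eq_zero fun ν _ => ?_
    have := 𝒜.stress_conserved h.contDiff_a h.contDiff_φ (h.contDiff_Vp.differentiable (by simp))
      h.pd_Vp h.inner_act h.fieldEquations ν z
    simp only [← mul_assoc, ← Finset.sum_mul]
    simp [this]
  simp only [Finset.mul_sum, mul_add, Finset.sum_add_distrib, hcons, zero_add]

/-- The virial identity in the comoving frame. -/
theorem integral_stress (hκ0 : 0 ≤ κ) (hκ : κ * (1 - ‖v‖ ^ 2) = 1) :
    ∫ z in onePeriod P, ∑ μ, ∑ ν, eta μ * (𝒜.stress a φ Vp μ ν z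
      * orthLift v ν (comoving κ v (coordVec μ))) = 0 := by
  have hC : ∀ ν, ∃ C, 0 ≤ C ∧ ∀ y, (1 + ‖y‖) * ‖fderiv ℝ (cutoffLift v ν) y‖ ≤ C := fun ν =>
    exists_bound_fderiv (contDiff_cutoffLift ν) (hasCompactSupport_cutoffLift ν)
  choose C hC0 hC using hC
  -- The first derivatives of the rescaled fields are bounded independently of n and converge to
  -- those at 0, so integrability of the stress tensor suffices for domination.
  have hlim := tendsto_integral_of_dominated_convergence (μ := volume.restrict (onePeriod P))
    (F := fun (n : ℕ) z => ∑ μ, ∑ ν, eta μ * (𝒜.stress a φ Vp μ ν z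
      * fderiv ℝ (cutoffLift v ν) (((n : ℝ) + 1)⁻¹ • comoving κ v z)
        (comoving κ v (coordVec μ))))
    (f := fun z => ∑ μ, ∑ ν, eta μ * (𝒜.stress a φ Vp μ ν z
      * orthLift v ν (comoving κ v (coordVec μ))))
    (fun z => ∑ μ, ∑ ν, |eta μ| * (‖𝒜.stress a φ Vp μ ν z‖
      * (C ν * ‖comoving κ v (coordVec μ)‖)))
    (by
      intro n
      refine Continuous.aestronglyMeasurable ?_
      refine continuous_finsetSum _ fun μ _ => continuous_finsetSum _ fun ν _ =>
        continuous_const.mul ((h.contDiff_stress μ ν).continuous.mul ?_)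
      exact ((((contDiff_cutoffLift ν).continuous_fderiv (by simp)).comp
        (contDiff_smul_comoving (((n : ℝ) + 1)⁻¹)).continuous).clm_apply continuous_const))
    (integrable_finsetSum _ fun μ _ => integrable_finsetSum _ fun ν _ =>
      ((h.integrable_stress μ ν).norm.mul_const _).const_mul _)
    (by
      intro n
      refine Eventually.of_forall fun z => ?_
      refine (norm_sum_le _ _).trans (Finset.sum_le_sum fun μ _ => (norm_sum_le _ _).trans
        (Finset.sum_le_sum fun ν _ => ?_))
      rw [norm_mul, norm_mul, Real.norm_eq_abs]
      refine mul_le_mul_of_nonneg_left (mul_le_mul_of_nonneg_left ?_ (norm_nonneg _))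
        (abs_nonneg _)
      refine (ContinuousLinearMap.le_opNorm _ _).trans
        (mul_le_mul_of_nonneg_right ?_ (norm_nonneg _))
      refine le_trans ?_ (hC ν (((n : ℝ) + 1)⁻¹ • comoving κ v z))
      exact le_mul_of_one_le_left (norm_nonneg _) (le_add_of_nonneg_right (norm_nonneg _)))
    (by
      refine Eventually.of_forall fun z => ?_
      refine tendsto_finsetSum _ fun μ _ => tendsto_finsetSum _ fun ν _ =>
        tendsto_const_nhds.mul (tendsto_const_nhds.mul ?_)
      rw [← fderiv_cutoffLift_zero]
      have hc : Continuous fun y => fderiv ℝ (cutoffLift v ν) y (comoving κ v (coordVec μ)) :=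
        ((contDiff_cutoffLift ν).continuous_fderiv (by simp)).clm_apply continuous_const
      exact (hc.tendsto 0).comp (tendsto_inv_smul_zero _))
  have hzero : ∀ n : ℕ, ∫ z in onePeriod P, ∑ μ, ∑ ν, eta μ * (𝒜.stress a φ Vp μ ν z
      * fderiv ℝ (cutoffLift v ν) (((n : ℝ) + 1)⁻¹ • comoving κ v z)
        (comoving κ v (coordVec μ))) = 0 := fun n =>
    h.integral_stress_cutoff hκ0 hκ (by positivity)
  simp only [hzero] at hlim
  exact (tendsto_nhds_unique hlim tendsto_const_nhds)

lemma pd_norm_sq (μ : Fin 4) (z : Spacetime) :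
    pd μ (fun y => ‖φ y‖ ^ 2) z = 2 * inner ℝ (φ z) (𝒜.cov a φ μ z) := by
  have hd := h.contDiff_φ.differentiable (by simp) z
  simp only [← real_inner_self_eq_norm_sq]
  rw [𝒜.pd_inner_cov (a := a) hd hd, real_inner_comm]
  ring

/-- Replaces square integrability of φ, which is not available. Hardy's inequality applies on almost
every time slice, where the spatial kinetic density is integrable, and is then integrated over time.
The gradient of |φ|² is controlled by covariant derivatives through `pd_norm_sq`. -/
lemma integrable_hardy :
    IntegrableOn (fun z : Spacetime => ‖φ z‖ ^ 2 / (1 + ‖z.2‖ ^ 2)) (onePeriod P) := by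
  set k : Spacetime → ℝ := fun z => ∑ i : Fin 3, ‖𝒜.cov a φ i.succ z‖ ^ 2 with hk
  have hφc := h.contDiff_φ.continuous
  have hcont : Continuous fun z : Spacetime => ‖φ z‖ ^ 2 / (1 + ‖z.2‖ ^ 2) :=
    (hφc.norm.pow 2).div (by fun_prop) fun z => by positivity
  have hki : Integrable k ((volume.restrict (Icc 0 P)).prod volume) := by
    have : IntegrableOn k (onePeriod P) := integrable_finsetSum _ fun i _ => h.integrable_cov i.succ
    rw [IntegrableOn, onePeriod, Measure.volume_eq_prod, ← Measure.prod_restrict,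
      Measure.restrict_univ] at this
    exact this
  refine ⟨hcont.aestronglyMeasurable, ?_⟩
  rw [hasFiniteIntegral_iff_ofReal (Eventually.of_forall fun z => by positivity),
    onePeriod, Measure.volume_eq_prod, ← Measure.prod_restrict, Measure.restrict_univ,
    lintegral_prod _ (hcont.measurable.ennreal_ofReal).aemeasurable]
  have hle : ∀ᵐ t ∂(volume.restrict (Icc 0 P)),
      ∫⁻ x : Space, ENNReal.ofReal (‖φ (t, x)‖ ^ 2 / (1 + ‖x‖ ^ 2))
        ≤ ENNReal.ofReal (16 * ∫ x, k (t, x)) := by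
    filter_upwards [hki.prod_right_ae] with t ht
    have hsq : ContDiff ℝ ∞ fun z => ‖φ z‖ ^ 2 := h.contDiff_φ.norm_sq ℝ
    refine hardy (s := fun x => ‖φ (t, x)‖ ^ 2) (k := fun x => k (t, x))
      ((hsq.comp (contDiff_const.prodMk contDiff_id)).of_le (by simp))
      (fun x => by positivity) ?_ (fun x => by positivity) ht ?_
    · simpa using ((h.lim t).norm.pow 2)
    · intro x
      simp only [hk, Finset.mul_sum]
      refine Finset.sum_le_sum fun i _ => ?_
      rw [← pd_succ_eq (f := fun z => ‖φ z‖ ^ 2) (hsq.differentiable (by simp)), h.pd_norm_sq]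
      have := abs_real_inner_le_norm (φ (t, x)) (𝒜.cov a φ i.succ (t, x))
      have h2 := pow_le_pow_left₀ (abs_nonneg _) this 2
      rw [sq_abs, mul_pow] at h2
      linarith
  refine (lintegral_mono_ae hle).trans_lt ?_
  exact (hki.integral_prod_left.const_mul 16).lintegral_lt_top

/-- During one period |x| exceeds the comoving distance by at most κP, so the two weights are
comparable in the direction needed. -/
lemma integrable_hardy_comoving (hκ0 : 0 ≤ κ) :
    IntegrableOn (fun z : Spacetime => ‖φ z‖ ^ 2 / (1 + ‖comoving κ v z‖) ^ 2)
      (onePeriod P) := by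
  have hφc := h.contDiff_φ.continuous
  have hcont : Continuous fun z : Spacetime => ‖φ z‖ ^ 2 / (1 + ‖comoving κ v z‖) ^ 2 :=
    (hφc.norm.pow 2).div (by fun_prop) fun z => by positivity
  refine Integrable.mono' (h.integrable_hardy.const_mul ((1 + κ * P) ^ 2))
    hcont.aestronglyMeasurable ?_
  refine (ae_restrict_iff' (measurableSet_onePeriod P)).2 (Eventually.of_forall fun z hz => ?_)
  rw [Real.norm_of_nonneg (by positivity), mul_div_assoc', div_le_div_iff₀ (by positivity)
    (by positivity)]
  have h1 := norm_le_comoving (v := v) hκ0 z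
  have h2 : κ * |z.1| * ‖v‖ ≤ κ * P * 1 := by
    have : |z.1| ≤ P := by rw [abs_of_nonneg hz.1.1]; exact hz.1.2
    exact mul_le_mul (mul_le_mul_of_nonneg_left this hκ0) h.velocity_lt.le (norm_nonneg _)
      (mul_nonneg hκ0 h.pos.le)
  have h3 : 1 + ‖z.2‖ ≤ (1 + κ * P) * (1 + ‖comoving κ v z‖) := by
    nlinarith [mul_nonneg (mul_nonneg hκ0 h.pos.le) (norm_nonneg (comoving κ v z)),
      mul_nonneg hκ0 h.pos.le]
  have h4 : 1 + ‖z.2‖ ^ 2 ≤ ((1 + κ * P) * (1 + ‖comoving κ v z‖)) ^ 2 := by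
    refine le_trans ?_ (pow_le_pow_left₀ (by positivity) h3 2)
    nlinarith [norm_nonneg z.2]
  calc ‖φ z‖ ^ 2 * (1 + ‖z.2‖ ^ 2)
      ≤ ‖φ z‖ ^ 2 * ((1 + κ * P) * (1 + ‖comoving κ v z‖)) ^ 2 :=
        mul_le_mul_of_nonneg_left h4 (sq_nonneg _)
    _ = _ := by ring

/-- By the scalar field equation Q - ⟨S, φ⟩ is the divergence of ⟨φ, D_μφ⟩; the second line is the
error made by the cutoff. -/
lemma integral_scalar_cutoff (hκ0 : 0 ≤ κ) (hκ : κ * (1 - ‖v‖ ^ 2) = 1) {r : ℝ} (hr : 0 < r) :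
    ∫ z in onePeriod P, (cutoff (r⁻¹ • comoving κ v z) *
        ((∑ μ, eta μ * inner ℝ (𝒜.cov a φ μ z) (𝒜.cov a φ μ z)) - inner ℝ (S z) (φ z))
      + ∑ μ, eta μ * (r⁻¹ * fderiv ℝ cutoff (r⁻¹ • comoving κ v z)
          (comoving κ v (coordVec μ)) * inner ℝ (φ z) (𝒜.cov a φ μ z))) = 0 := by
  have hχ : ContDiff ℝ ∞ fun z => cutoff (r⁻¹ • comoving κ v z) :=
    contDiff_cutoff.comp (contDiff_smul_comoving r⁻¹)
  have hj : ∀ μ, ContDiff ℝ ∞ fun z => inner ℝ (φ z) (𝒜.cov a φ μ z) := fun μ =>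
    h.contDiff_φ.inner ℝ (𝒜.contDiff_cov h.contDiff_a h.contDiff_φ μ)
  have hdiv := integral_divergence_eq_zero (P := P) (r := 2 * r + κ * (P + 1)) h.pos
    (J := fun μ z => cutoff (r⁻¹ • comoving κ v z) * inner ℝ (φ z) (𝒜.cov a φ μ z))
    (fun μ => (hχ.mul (hj μ)).of_le (by simp)) (by
      intro μ t ht x hx
      rw [cutoff_of_two_le (h.two_le_norm_comoving hκ0 hr ht hx), zero_mul]) R (P • v) (by
      intro x
      have e : ((P, R x + P • v) : Spacetime) = helicalShift R P (P • v) (0, x) := by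
        simp [helicalShift]
      have h1 : 𝒜.cov a φ 0 (helicalShift R P (P • v) (0, x)) = 𝒜.cov a φ 0 (0, x) := by
        simp [𝒜.cov_helicalShift h.contDiff_φ h.shift_φ h.shift_a, rotMatrix_zero]
      rw [e, comoving_helicalShift hκ h.rotation, ← map_smul, cutoff_rotation, h.shift_φ, h1])
  rw [← hdiv]
  refine setIntegral_congr_fun (measurableSet_onePeriod P) fun z _ => ?_
  have hz : ∀ μ, pd μ (fun z => cutoff (r⁻¹ • comoving κ v z) *
        inner ℝ (φ z) (𝒜.cov a φ μ z)) z
      = r⁻¹ * fderiv ℝ cutoff (r⁻¹ • comoving κ v z)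
          (comoving κ v (coordVec μ)) * inner ℝ (φ z) (𝒜.cov a φ μ z)
        + cutoff (r⁻¹ • comoving κ v z) * (inner ℝ (𝒜.cov a φ μ z) (𝒜.cov a φ μ z)
          + inner ℝ (φ z) (𝒜.cov a (𝒜.cov a φ μ) μ z)) := by
    intro μ
    rw [pd_mul (hχ.differentiable (by simp) z) ((hj μ).differentiable (by simp) z),
      pd_comp_comoving (contDiff_cutoff.differentiable (by simp)),
      𝒜.pd_inner_cov (a := a) (h.contDiff_φ.differentiable (by simp) z)
        ((𝒜.contDiff_cov h.contDiff_a h.contDiff_φ μ).differentiable (by simp) z)]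
  simp only [hz]
  have hs : inner ℝ (S z) (φ z) = -∑ μ, eta μ * inner ℝ (φ z) (𝒜.cov a (𝒜.cov a φ μ) μ z) := by
    have := congrArg (fun w => inner ℝ (φ z) w) (h.fieldEquations.scalar z)
    simp only [inner_sum, real_inner_smul_right, inner_neg_right] at this
    rw [this, real_inner_comm, neg_neg]
  rw [hs]
  simp only [mul_add, Finset.sum_add_distrib, Finset.mul_sum, sub_neg_eq_add]
  rw [add_comm]
  congr 1
  congr 1 <;> exact Finset.sum_congr rfl fun _ _ => by ring

/-- The integrated equation of motion of the scalar field, contracted with the field. -/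
theorem integral_scalar (hκ0 : 0 ≤ κ) (hκ : κ * (1 - ‖v‖ ^ 2) = 1) :
    ∫ z in onePeriod P, ((∑ μ, eta μ * inner ℝ (𝒜.cov a φ μ z) (𝒜.cov a φ μ z))
      - inner ℝ (S z) (φ z)) = 0 := by
  obtain ⟨C, hC0, hC⟩ := exists_bound_fderiv contDiff_cutoff hasCompactSupport_cutoff
  set Q : Spacetime → ℝ := fun z =>
    (∑ μ, eta μ * inner ℝ (𝒜.cov a φ μ z) (𝒜.cov a φ μ z)) - inner ℝ (S z) (φ z) with hQ
  have hQi : IntegrableOn Q (onePeriod P) :=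
    (integrable_finsetSum _ fun μ _ => (h.integrable_inner_cov μ μ).const_mul (eta μ)).sub
      h.integrable_force
  -- Uses r⁻¹(1 + |y|) ≤ 1 + |y/r| for r ≥ 1 together with the weighted bound on the gradient of the
  -- cutoff.
  have hdecay : ∀ (n : ℕ) (z : Spacetime) (w : Space),
      |((n : ℝ) + 1)⁻¹ * fderiv ℝ cutoff (((n : ℝ) + 1)⁻¹ • comoving κ v z) w|
        ≤ C * ‖w‖ / (1 + ‖comoving κ v z‖) := by
    intro n z w
    set r : ℝ := (n : ℝ) + 1 with hr
    have hr1 : 1 ≤ r := by simp [hr]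
    have hr0 : 0 < r := by linarith
    rw [le_div_iff₀ (by positivity), abs_mul, abs_of_pos (inv_pos.2 hr0)]
    have h1 := ContinuousLinearMap.le_opNorm (fderiv ℝ cutoff (r⁻¹ • comoving κ v z)) w
    rw [Real.norm_eq_abs] at h1
    have h2 : r⁻¹ * (1 + ‖comoving κ v z‖) ≤ 1 + ‖r⁻¹ • comoving κ v z‖ := by
      rw [norm_smul, norm_inv, Real.norm_of_nonneg hr0.le, mul_add, mul_one]
      gcongr
      exact inv_le_one_of_one_le₀ hr1
    calc _ = (r⁻¹ * (1 + ‖comoving κ v z‖)) * |fderiv ℝ cutoff (r⁻¹ • comoving κ v z) w| := by ring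
      _ ≤ (1 + ‖r⁻¹ • comoving κ v z‖) * (‖fderiv ℝ cutoff (r⁻¹ • comoving κ v z)‖ * ‖w‖) :=
          mul_le_mul h2 h1 (abs_nonneg _) (by positivity)
      _ = ((1 + ‖r⁻¹ • comoving κ v z‖) * ‖fderiv ℝ cutoff (r⁻¹ • comoving κ v z)‖) * ‖w‖ := by
          ring
      _ ≤ C * ‖w‖ := mul_le_mul_of_nonneg_right (hC _) (norm_nonneg _)
  -- The cutoff error is at most a constant times |φ||Dφ|/(1 + |y|), y being the comoving position.
  -- Young's inequality bounds this by the Hardy density plus |Dφ|², both integrable.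
  have hlim := tendsto_integral_of_dominated_convergence (μ := volume.restrict (onePeriod P))
    (F := fun (n : ℕ) z => cutoff (((n : ℝ) + 1)⁻¹ • comoving κ v z) * Q z
      + ∑ μ, eta μ * (((n : ℝ) + 1)⁻¹ * fderiv ℝ cutoff (((n : ℝ) + 1)⁻¹ • comoving κ v z)
          (comoving κ v (coordVec μ)) * inner ℝ (φ z) (𝒜.cov a φ μ z)))
    (f := Q)
    (fun z => ‖Q z‖ + ∑ μ, |eta μ| * (C * ‖comoving κ v (coordVec μ)‖ *
      (‖φ z‖ ^ 2 / (1 + ‖comoving κ v z‖) ^ 2 + ‖𝒜.cov a φ μ z‖ ^ 2)))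
    (by
      intro n
      refine AEStronglyMeasurable.add (AEStronglyMeasurable.mul ?_ hQi.aestronglyMeasurable) ?_
      · exact (contDiff_cutoff.continuous.comp
          (contDiff_smul_comoving (((n : ℝ) + 1)⁻¹)).continuous).aestronglyMeasurable
      · refine Continuous.aestronglyMeasurable ?_
        refine continuous_finsetSum _ fun μ _ => continuous_const.mul (Continuous.mul
          (continuous_const.mul ?_) (h.contDiff_φ.continuous.inner (h.continuous_cov μ)))
        exact ((contDiff_cutoff.continuous_fderiv (by simp)).comp
          (contDiff_smul_comoving (((n : ℝ) + 1)⁻¹)).continuous).clm_apply continuous_const)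
    (hQi.norm.add (integrable_finsetSum _ fun μ _ =>
      (((h.integrable_hardy_comoving hκ0).add (h.integrable_cov μ)).const_mul _).const_mul _))
    (by
      intro n
      refine Eventually.of_forall fun z => ?_
      refine (norm_add_le _ _).trans (add_le_add ?_ ((norm_sum_le _ _).trans
        (Finset.sum_le_sum fun μ _ => ?_)))
      · rw [norm_mul, Real.norm_of_nonneg (cutoff_mem _).1]
        exact mul_le_of_le_one_left (norm_nonneg _) (cutoff_mem _).2
      · rw [norm_mul, norm_mul, Real.norm_eq_abs, Real.norm_eq_abs]
        refine mul_le_mul_of_nonneg_left ?_ (abs_nonneg _)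
        set w := comoving κ v (coordVec μ)
        set q := 1 + ‖comoving κ v z‖
        have hq : 0 < q := by positivity
        calc _ ≤ (C * ‖w‖ / q) * (‖φ z‖ * ‖𝒜.cov a φ μ z‖) :=
              mul_le_mul (hdecay n z w) (norm_inner_le_norm _ _) (norm_nonneg _) (by positivity)
          _ = C * ‖w‖ * (‖φ z‖ / q * ‖𝒜.cov a φ μ z‖) := by field_simp
          _ ≤ _ := by
              refine mul_le_mul_of_nonneg_left ?_ (by positivity)
              rw [← div_pow]
              nlinarith [sq_nonneg (‖φ z‖ / q - ‖𝒜.cov a φ μ z‖), sq_nonneg (‖φ z‖ / q),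
                sq_nonneg ‖𝒜.cov a φ μ z‖])
    (by
      refine Eventually.of_forall fun z => ?_
      have h1 : Tendsto (fun n : ℕ => cutoff (((n : ℝ) + 1)⁻¹ • comoving κ v z)) atTop
          (𝓝 (cutoff 0)) :=
        (contDiff_cutoff.continuous.tendsto 0).comp (tendsto_inv_smul_zero _)
      have h2 : ∀ μ, Tendsto (fun n : ℕ => ((n : ℝ) + 1)⁻¹ *
          fderiv ℝ cutoff (((n : ℝ) + 1)⁻¹ • comoving κ v z) (comoving κ v (coordVec μ))) atTop
          (𝓝 (0 * fderiv ℝ cutoff 0 (comoving κ v (coordVec μ)))) := by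
        intro μ
        refine Tendsto.mul ?_ ?_
        · simpa using tendsto_one_div_add_atTop_nhds_zero_nat (𝕜 := ℝ)
        · have hc : Continuous fun y => fderiv ℝ cutoff y (comoving κ v (coordVec μ)) :=
            (contDiff_cutoff.continuous_fderiv (by simp)).clm_apply continuous_const
          exact (hc.tendsto 0).comp (tendsto_inv_smul_zero _)
      have h3 := (h1.mul_const (Q z)).add (tendsto_finsetSum Finset.univ fun μ _ =>
        ((h2 μ).mul_const (inner ℝ (φ z) (𝒜.cov a φ μ z))).const_mul (eta μ))
      simpa [cutoff_zero] using h3)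
  have hzero : ∀ n : ℕ, ∫ z in onePeriod P, (cutoff (((n : ℝ) + 1)⁻¹ • comoving κ v z) * Q z
      + ∑ μ, eta μ * (((n : ℝ) + 1)⁻¹ * fderiv ℝ cutoff (((n : ℝ) + 1)⁻¹ • comoving κ v z)
          (comoving κ v (coordVec μ)) * inner ℝ (φ z) (𝒜.cov a φ μ z))) = 0 := fun n =>
    h.integral_scalar_cutoff hκ0 hκ (by positivity)
  simp only [hzero] at hlim
  exact (tendsto_nhds_unique hlim tendsto_const_nhds)

end PeriodicSolution

end GaugeAction

/-! ### Positivity in the comoving frame -/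

/-- The components of the four-velocity `(1, v)`. -/
def fourVel (v : Space) : Fin 4 → ℝ := Fin.cons 1 fun i => v i

section Positivity

variable {κ : ℝ} {v : Space}

lemma sum_sq_eq_norm_sq (v : Space) : ∑ i, v i ^ 2 = ‖v‖ ^ 2 := by
  rw [EuclideanSpace.norm_sq_eq]; simp

/-- The derivative of the orthogonal position vector is the projector along (1, v). The virial
integrand is therefore the η-trace of the stress tensor minus κ times its value on (u, u). -/
lemma eta_mul_orthLift_comoving (hκ : κ * (1 - ‖v‖ ^ 2) = 1) (μ ν : Fin 4) :
    eta μ * orthLift v ν (comoving κ v (coordVec μ))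
      = (if μ = ν then eta μ else 0) - κ * (fourVel v μ * fourVel v ν) := by
  have he : ∀ i : Fin 3, eta i.succ = -1 := by intro i; fin_cases i <;> rfl
  have he0 : eta 0 = 1 := rfl
  have h0 : comoving κ v (coordVec 0) = (-κ) • v := by
    rw [comoving_apply]; simp [coordVec]
  have hi : ∀ i : Fin 3, comoving κ v (coordVec i.succ)
      = EuclideanSpace.single i (1 : ℝ) + (κ * v i) • v := by
    intro i
    rw [comoving_apply]
    simp [coordVec, EuclideanSpace.inner_single_right]
  refine Fin.cases ?_ (fun i => ?_) μ <;> refine Fin.cases ?_ (fun j => ?_) ν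
  · rw [h0, orthLift_smul]
    simp only [orthLift, fourVel, Fin.cons_zero, real_inner_self_eq_norm_sq, he0, if_true]
    linear_combination hκ
  · rw [h0, orthLift_smul]
    simp [orthLift, fourVel, he0, (Fin.succ_ne_zero _).symm]
  · rw [hi, orthLift_add, orthLift_smul]
    simp only [orthLift, fourVel, Fin.cons_zero, Fin.cons_succ, real_inner_self_eq_norm_sq, he,
      Fin.succ_ne_zero, if_false, EuclideanSpace.inner_single_right]
    simp only [conj_trivial]
    linear_combination (v i) * hκ
  · rw [hi, orthLift_add, orthLift_smul]
    simp only [orthLift, fourVel, Fin.cons_succ, he, Fin.succ_inj]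
    by_cases hij : i = j
    · subst hij
      simp
      ring
    · have : j ≠ i := fun h => hij h.symm
      simp [hij, this]
      ring

variable {E : Type*} [NormedAddCommGroup E] [InnerProductSpace ℝ E]

lemma norm_sum_smul_sq_le (v : Space) (p : Fin 3 → E) :
    ‖∑ i, v i • p i‖ ^ 2 ≤ ‖v‖ ^ 2 * ∑ i, ‖p i‖ ^ 2 := by
  have h1 : ‖∑ i, v i • p i‖ ≤ ∑ i, |v i| * ‖p i‖ := by
    refine (norm_sum_le _ _).trans (le_of_eq ?_)
    simp [norm_smul]
  refine (pow_le_pow_left₀ (norm_nonneg _) h1 2).trans ?_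
  refine (Finset.sum_mul_sq_le_sq_mul_sq _ _ _).trans (le_of_eq ?_)
  simp [sum_sq_eq_norm_sq]

/-- The sum of the squares of the spatial components of a covector in the comoving frame. -/
lemma spatial_part_ge (hκ : κ * (1 - ‖v‖ ^ 2) = 1) (d : Fin 4 → E) :
    (1 - ‖v‖ ^ 2) * ∑ i : Fin 3, ‖d i.succ + (κ * v i) • ∑ μ, fourVel v μ • d μ‖ ^ 2
      ≤ κ * ‖∑ μ, fourVel v μ • d μ‖ ^ 2 - ∑ μ, eta μ * inner ℝ (d μ) (d μ) := by
  set U := ∑ μ, fourVel v μ • d μ with hU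
  -- These are the spatial components of the projection of d orthogonal to u; its time component is
  -- -∑ v_i p_i. Minus its Minkowski square is ∑ |p_i|² - |∑ v_i p_i|², and Cauchy–Schwarz bounds
  -- the subtracted term.
  set p : Fin 3 → E := fun i => d i.succ + (κ * v i) • U with hp
  have hle := norm_sum_smul_sq_le v p
  have hs : ∑ i, v i • d i.succ = U - d 0 := by
    have : U = d 0 + ∑ i : Fin 3, v i • d i.succ := by
      rw [hU, Fin.sum_univ_succ]
      simp only [fourVel, Fin.cons_zero, Fin.cons_succ, one_smul]
    rw [this, add_sub_cancel_left]
  have hvp : ∑ i, v i • p i = κ • U - d 0 := by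
    simp only [hp, smul_add, smul_smul, Finset.sum_add_distrib, hs, ← Finset.sum_smul]
    have : ∑ i, v i * (κ * v i) = κ - 1 := by
      rw [← hκ, ← sum_sq_eq_norm_sq, mul_sub, mul_one, sub_sub_cancel, Finset.mul_sum]
      exact Finset.sum_congr rfl fun _ _ => by ring
    rw [this, sub_smul, one_smul]
    abel
  have hpp : ∑ i, ‖p i‖ ^ 2 = ∑ i : Fin 3, ‖d i.succ‖ ^ 2
      + 2 * κ * (‖U‖ ^ 2 - inner ℝ (d 0) U) + κ ^ 2 * ‖v‖ ^ 2 * ‖U‖ ^ 2 := by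
    have h1 : ∀ i, ‖p i‖ ^ 2 = ‖d i.succ‖ ^ 2 + 2 * κ * inner ℝ (v i • d i.succ) U
        + κ ^ 2 * v i ^ 2 * ‖U‖ ^ 2 := by
      intro i
      rw [hp, norm_add_sq_real, real_inner_smul_right, norm_smul, mul_pow, Real.norm_eq_abs,
        sq_abs, real_inner_smul_left]
      ring
    simp only [h1, Finset.sum_add_distrib, ← Finset.mul_sum, ← Finset.sum_mul, ← sum_inner, hs,
      sum_sq_eq_norm_sq, inner_sub_left, real_inner_self_eq_norm_sq]
  have hvp2 : ‖∑ i, v i • p i‖ ^ 2 = κ ^ 2 * ‖U‖ ^ 2 - 2 * κ * inner ℝ (d 0) U + ‖d 0‖ ^ 2 := by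
    rw [hvp, norm_sub_sq_real, norm_smul, mul_pow, Real.norm_eq_abs, sq_abs,
      real_inner_smul_left, real_inner_comm]
    ring
  have he : ∀ i : Fin 3, eta i.succ = -1 := by intro i; fin_cases i <;> rfl
  have hQ : ∑ μ, eta μ * inner ℝ (d μ) (d μ) = ‖d 0‖ ^ 2 - ∑ i : Fin 3, ‖d i.succ‖ ^ 2 := by
    rw [Fin.sum_univ_succ]
    simp only [he, real_inner_self_eq_norm_sq, neg_mul, one_mul, Finset.sum_neg_distrib]
    change 1 * _ + _ = _
    ring
  have hkey : ∑ i, ‖p i‖ ^ 2 - ‖∑ i, v i • p i‖ ^ 2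
      = κ * ‖U‖ ^ 2 - ∑ μ, eta μ * inner ℝ (d μ) (d μ) := by
    rw [hpp, hvp2, hQ]
    linear_combination (-κ * ‖U‖ ^ 2) * hκ
  rw [← hkey]
  linarith

/-- Twice the energy density, in the comoving frame, of one component of the gauge field. -/
def fieldEnergy (κ : ℝ) (v : Space) (f : Fin 4 → Fin 4 → ℝ) : ℝ :=
  (1 / 4) * ∑ μ, ∑ ν, eta μ * eta ν * (f μ ν * f μ ν)
    - κ * ∑ ρ, eta ρ * ((∑ μ, fourVel v μ * f μ ρ) * ∑ μ, fourVel v μ * f μ ρ)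

/-- The combinations are E - v × B and B + v × E. For each of them κ(|a|² - (v·a)²) is the squared
length of the boosted field, because κ scales the part transverse to v while the longitudinal part
is unchanged. -/
lemma fieldEnergy_eq (hκ : κ * (1 - (v 0 ^ 2 + v 1 ^ 2 + v 2 ^ 2)) = 1)
    {f : Fin 4 → Fin 4 → ℝ} {E1 E2 E3 B1 B2 B3 : ℝ}
    (hf : f = ![![0, E1, E2, E3], ![-E1, 0, B3, -B2], ![-E2, -B3, 0, B1], ![-E3, B2, -B1, 0]]) :
    fieldEnergy κ v f = κ / 2 * (
      ((E1 - (v 1 * B3 - v 2 * B2)) ^ 2 + (E2 - (v 2 * B1 - v 0 * B3)) ^ 2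
        + (E3 - (v 0 * B2 - v 1 * B1)) ^ 2)
      - (v 0 * (E1 - (v 1 * B3 - v 2 * B2)) + v 1 * (E2 - (v 2 * B1 - v 0 * B3))
        + v 2 * (E3 - (v 0 * B2 - v 1 * B1))) ^ 2
      + ((B1 + (v 1 * E3 - v 2 * E2)) ^ 2 + (B2 + (v 2 * E1 - v 0 * E3)) ^ 2
        + (B3 + (v 0 * E2 - v 1 * E1)) ^ 2)
      - (v 0 * (B1 + (v 1 * E3 - v 2 * E2)) + v 1 * (B2 + (v 2 * E1 - v 0 * E3))
        + v 2 * (B3 + (v 0 * E2 - v 1 * E1))) ^ 2) := by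
  subst hf
  have hu0 : fourVel v 0 = 1 := rfl
  have hu1 : fourVel v 1 = v 0 := rfl
  have hu2 : fourVel v 2 = v 1 := rfl
  have hu3 : fourVel v 3 = v 2 := rfl
  simp only [fieldEnergy, Fin.sum_univ_four, hu0, hu1, hu2, hu3, eta, Matrix.cons_val]
  linear_combination (1 / 2) * (E1 ^ 2 + E2 ^ 2 + E3 ^ 2 - B1 ^ 2 - B2 ^ 2 - B3 ^ 2) * hκ

/-- Lagrange's identity gives |a|² - (v·a)² = (1 - |v|²)|a|² + |v × a|². -/
lemma sum_sq_le_of_boost {κ x y w : ℝ} (hκ0 : 0 ≤ κ) (hκ : κ * (1 - (x ^ 2 + y ^ 2 + w ^ 2)) = 1)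
    (a b c : ℝ) :
    a ^ 2 + b ^ 2 + c ^ 2 ≤ κ * (a ^ 2 + b ^ 2 + c ^ 2 - (x * a + y * b + w * c) ^ 2) := by
  have h1 : a ^ 2 + b ^ 2 + c ^ 2 - (x * a + y * b + w * c) ^ 2
      = (1 - (x ^ 2 + y ^ 2 + w ^ 2)) * (a ^ 2 + b ^ 2 + c ^ 2)
        + ((x * b - y * a) ^ 2 + (x * c - w * a) ^ 2 + (y * c - w * b) ^ 2) := by ring
  rw [h1, mul_add, ← mul_assoc, hκ, one_mul]
  have : 0 ≤ κ * ((x * b - y * a) ^ 2 + (x * c - w * a) ^ 2 + (y * c - w * b) ^ 2) := by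
    positivity
  linarith

/-- From E = v × B and B = -v × E follow v·E = 0 and E = |v|²E, and the second relation forces E = 0
because 1 - |v|² is invertible. -/
lemma eq_zero_of_boost {κ x y w : ℝ} (hκ : κ * (1 - (x ^ 2 + y ^ 2 + w ^ 2)) = 1)
    {E1 E2 E3 B1 B2 B3 : ℝ} (he1 : E1 - (y * B3 - w * B2) = 0) (he2 : E2 - (w * B1 - x * B3) = 0)
    (he3 : E3 - (x * B2 - y * B1) = 0) (hb1 : B1 + (y * E3 - w * E2) = 0)
    (hb2 : B2 + (w * E1 - x * E3) = 0) (hb3 : B3 + (x * E2 - y * E1) = 0) :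
    (E1 = 0 ∧ E2 = 0 ∧ E3 = 0) ∧ B1 = 0 ∧ B2 = 0 ∧ B3 = 0 := by
  have hvE : x * E1 + y * E2 + w * E3 = 0 := by
    linear_combination x * he1 + y * he2 + w * he3
  have sE1 : E1 = 0 := by
    linear_combination (-E1) * hκ + κ * he1 + κ * y * hb3 - κ * w * hb2 - κ * x * hvE
  have sE2 : E2 = 0 := by
    linear_combination (-E2) * hκ + κ * he2 + κ * w * hb1 - κ * x * hb3 - κ * y * hvE
  have sE3 : E3 = 0 := by
    linear_combination (-E3) * hκ + κ * he3 + κ * x * hb2 - κ * y * hb1 - κ * w * hvE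
  subst sE1 sE2 sE3
  exact ⟨⟨rfl, rfl, rfl⟩, by linarith, by linarith, by linarith⟩

lemma fieldEnergy_nonneg (hκ0 : 0 ≤ κ) (hκ : κ * (1 - ‖v‖ ^ 2) = 1) (f : Fin 4 → Fin 4 → ℝ)
    (hf : ∀ μ ν, f ν μ = -f μ ν) :
    0 ≤ fieldEnergy κ v f ∧ (fieldEnergy κ v f = 0 → ∀ μ ν, f μ ν = 0) := by
  rw [← sum_sq_eq_norm_sq, Fin.sum_univ_three] at hκ
  have hd : ∀ μ, f μ μ = 0 := fun μ => by linarith [hf μ μ]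
  have hfm : f = ![![0, f 0 1, f 0 2, f 0 3], ![-f 0 1, 0, f 1 2, -f 3 1],
      ![-f 0 2, -f 1 2, 0, f 2 3], ![-f 0 3, f 3 1, -f 2 3, 0]] := by
    ext μ ν
    fin_cases μ <;> fin_cases ν <;> simp [hd, ← hf]
  have hE := fieldEnergy_eq hκ hfm
  set e1 := f 0 1 - (v 1 * f 1 2 - v 2 * f 3 1) with he1
  set e2 := f 0 2 - (v 2 * f 2 3 - v 0 * f 1 2) with he2
  set e3 := f 0 3 - (v 0 * f 3 1 - v 1 * f 2 3) with he3
  set b1 := f 2 3 + (v 1 * f 0 3 - v 2 * f 0 2) with hb1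
  set b2 := f 3 1 + (v 2 * f 0 1 - v 0 * f 0 3) with hb2
  set b3 := f 1 2 + (v 0 * f 0 2 - v 1 * f 0 1) with hb3
  have hge : (e1 ^ 2 + e2 ^ 2 + e3 ^ 2 + (b1 ^ 2 + b2 ^ 2 + b3 ^ 2)) / 2
      ≤ fieldEnergy κ v f := by
    rw [hE]
    linarith [sum_sq_le_of_boost hκ0 hκ e1 e2 e3, sum_sq_le_of_boost hκ0 hκ b1 b2 b3]
  refine ⟨le_trans (by positivity) hge, fun h0 => ?_⟩
  rw [h0] at hge
  have z : ∀ a : ℝ, a ^ 2 ≤ 0 → a = 0 := fun a ha => by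
    simpa using le_antisymm ha (sq_nonneg a)
  have p1 := sq_nonneg e1
  have p2 := sq_nonneg e2
  have p3 := sq_nonneg e3
  have q1 := sq_nonneg b1
  have q2 := sq_nonneg b2
  have q3 := sq_nonneg b3
  obtain ⟨⟨h1, h2, h3⟩, k1, k2, k3⟩ := eq_zero_of_boost hκ (he1.symm.trans (z e1 (by linarith)))
    (he2.symm.trans (z e2 (by linarith))) (he3.symm.trans (z e3 (by linarith)))
    (hb1.symm.trans (z b1 (by linarith))) (hb2.symm.trans (z b2 (by linarith)))
    (hb3.symm.trans (z b3 (by linarith)))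
  intro μ ν
  rw [hfm, h1, h2, h3, k1, k2, k3]
  fin_cases μ <;> fin_cases ν <;> simp

end Positivity

/-! ### Vanishing of the solution -/

lemma exists_ne_zero_orthogonal (v : Space) : ∃ w : Space, w ≠ 0 ∧ inner ℝ v w = 0 := by
  by_cases h : v 0 = 0
  · exact ⟨EuclideanSpace.single 0 1, by simp, by
      simp [EuclideanSpace.inner_single_right, h]⟩
  · refine ⟨EuclideanSpace.single 0 (v 1) - EuclideanSpace.single 1 (v 0), fun h0 => h ?_, ?_⟩
    · have := congrArg (fun y : Space => y 1) h0
      simpa using this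
    · simp [inner_sub_right, EuclideanSpace.inner_single_right]
      ring

namespace GaugeAction.PeriodicSolution

section Stress

variable {𝔤 H : Type*} [NormedAddCommGroup 𝔤] [InnerProductSpace ℝ 𝔤]
    [NormedAddCommGroup H] [InnerProductSpace ℝ H] {𝒜 : GaugeAction 𝔤 H}
    {a : Fin 4 → Spacetime → 𝔤} {φ : Spacetime → H} {Vp : Spacetime → ℝ} {κ : ℝ} {v : Space}

/-- The stress in the comoving frame, in terms of kinetic, potential and field energies. -/
lemma sum_stress_eq (hκ : κ * (1 - ‖v‖ ^ 2) = 1) (z : Spacetime) :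
    ∑ μ, ∑ ν, eta μ * (𝒜.stress a φ Vp μ ν z * orthLift v ν (comoving κ v (coordVec μ)))
      = 3 * Vp z - (∑ μ, eta μ * inner ℝ (𝒜.cov a φ μ z) (𝒜.cov a φ μ z))
        - 2 * κ * ‖∑ μ, fourVel v μ • 𝒜.cov a φ μ z‖ ^ 2
        - ((1 / 4) * ∑ μ, ∑ ν, eta μ * eta ν *
            inner ℝ (𝒜.curvature a μ ν z) (𝒜.curvature a μ ν z)
          - κ * ∑ ρ, eta ρ * inner ℝ (∑ μ, fourVel v μ • 𝒜.curvature a μ ρ z)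
              (∑ μ, fourVel v μ • 𝒜.curvature a μ ρ z)) := by
  have hT : ∀ μ ν, eta μ * (𝒜.stress a φ Vp μ ν z * orthLift v ν (comoving κ v (coordVec μ)))
      = 𝒜.stress a φ Vp μ ν z * (if μ = ν then eta μ else 0)
        - κ * (fourVel v μ * fourVel v ν * 𝒜.stress a φ Vp μ ν z) := by
    intro μ ν
    rw [mul_left_comm, eta_mul_orthLift_comoving hκ]
    ring
  simp only [hT, Finset.sum_sub_distrib, ← Finset.mul_sum]
  have htr : ∑ μ, ∑ ν, 𝒜.stress a φ Vp μ ν z * (if μ = ν then eta μ else 0)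
      = 2 * (∑ μ, eta μ * inner ℝ (𝒜.cov a φ μ z) (𝒜.cov a φ μ z))
        - (∑ μ, ∑ ν, eta μ * eta ν * inner ℝ (𝒜.curvature a μ ν z) (𝒜.curvature a μ ν z))
        - 4 * 𝒜.lagr a φ Vp z := by
    have : ∀ μ, ∑ ν, 𝒜.stress a φ Vp μ ν z * (if μ = ν then eta μ else 0)
        = 2 * (eta μ * inner ℝ (𝒜.cov a φ μ z) (𝒜.cov a φ μ z))
          - (∑ ν, eta μ * eta ν * inner ℝ (𝒜.curvature a μ ν z) (𝒜.curvature a μ ν z))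
          - 𝒜.lagr a φ Vp z := by
      intro μ
      simp only [mul_ite, mul_zero, Finset.sum_ite_eq, Finset.mem_univ, if_true, stress, sub_mul,
        Finset.sum_mul]
      congr 1
      · congr 1
        · ring
        · exact Finset.sum_congr rfl fun _ _ => by ring
      · rw [mul_right_comm, eta_mul_self, one_mul]
    simp only [this, Finset.sum_sub_distrib, ← Finset.mul_sum]
    simp
  have huu : ∑ μ, ∑ ν, fourVel v μ * fourVel v ν * 𝒜.stress a φ Vp μ ν z
      = 2 * ‖∑ μ, fourVel v μ • 𝒜.cov a φ μ z‖ ^ 2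
        - (∑ ρ, eta ρ * inner ℝ (∑ μ, fourVel v μ • 𝒜.curvature a μ ρ z)
              (∑ μ, fourVel v μ • 𝒜.curvature a μ ρ z))
        - (1 - ‖v‖ ^ 2) * 𝒜.lagr a φ Vp z := by
    simp only [stress, mul_sub, Finset.sum_sub_distrib]
    congr 1
    · congr 1
      · rw [← real_inner_self_eq_norm_sq]
        simp only [sum_inner, inner_sum, real_inner_smul_left, real_inner_smul_right,
          Finset.mul_sum]
        rw [Finset.sum_comm]
        exact Finset.sum_congr rfl fun _ _ => Finset.sum_congr rfl fun _ _ => by ring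
      · simp only [sum_inner, inner_sum, real_inner_smul_left, real_inner_smul_right,
          Finset.mul_sum]
        rw [Finset.sum_congr rfl fun μ _ => Finset.sum_comm, Finset.sum_comm]
        refine Finset.sum_congr rfl fun ρ _ => ?_
        rw [Finset.sum_comm]
        exact Finset.sum_congr rfl fun _ _ => Finset.sum_congr rfl fun _ _ => by ring
    · simp only [ite_mul, zero_mul, mul_ite, mul_zero, Finset.sum_ite_eq, Finset.mem_univ, if_true,
        ← mul_assoc, ← Finset.sum_mul]
      congr 1
      have he : ∀ i : Fin 3, eta i.succ = -1 := by intro i; fin_cases i <;> rfl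
      rw [Fin.sum_univ_succ, ← sum_sq_eq_norm_sq]
      simp only [fourVel, Fin.cons_zero, Fin.cons_succ, he]
      change 1 * 1 * 1 + _ = _
      rw [sub_eq_add_neg, ← Finset.sum_neg_distrib]
      congr 1
      · norm_num
      · exact Finset.sum_congr rfl fun _ _ => by ring
  rw [htr, huu, lagr]
  set FF := ∑ μ, ∑ ν, eta μ * eta ν * inner ℝ (𝒜.curvature a μ ν z) (𝒜.curvature a μ ν z)
  set Q := ∑ μ, eta μ * inner ℝ (𝒜.cov a φ μ z) (𝒜.cov a φ μ z)
  linear_combination (Q - Vp z - 1 / 4 * FF) * hκ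

end Stress

section Vanishing

variable {n : ℕ} {H : Type*} [NormedAddCommGroup H] [InnerProductSpace ℝ H]
    {𝒜 : GaugeAction (EuclideanSpace ℝ (Fin n)) H}
    {a : Fin 4 → Spacetime → EuclideanSpace ℝ (Fin n)} {φ : Spacetime → H} {Vp : Spacetime → ℝ}
    {S : Spacetime → H} {P : ℝ} {v : Space} {R : Space ≃ₗᵢ[ℝ] Space}

lemma sum_fieldEnergy_eq (κ : ℝ) (v : Space) (F : Fin 4 → Fin 4 → EuclideanSpace ℝ (Fin n)) :
    ∑ b, fieldEnergy κ v (fun μ ν => F μ ν b)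
      = (1 / 4) * ∑ μ, ∑ ν, eta μ * eta ν * inner ℝ (F μ ν) (F μ ν)
          - κ * ∑ ρ, eta ρ * inner ℝ (∑ μ, fourVel v μ • F μ ρ) (∑ μ, fourVel v μ • F μ ρ) := by
  simp only [fieldEnergy, Finset.sum_sub_distrib, ← Finset.mul_sum]
  congr 2
  · rw [Finset.sum_comm]
    refine Finset.sum_congr rfl fun μ _ => ?_
    rw [Finset.sum_comm]
    refine Finset.sum_congr rfl fun ν _ => ?_
    rw [← Finset.mul_sum, PiLp.inner_apply]
    simp only [RCLike.inner_apply, conj_trivial]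
  · rw [Finset.sum_comm]
    refine Finset.sum_congr rfl fun ρ _ => ?_
    rw [← Finset.mul_sum, PiLp.inner_apply]
    simp [sq]

variable (h : 𝒜.PeriodicSolution a φ Vp S P v R)

include h

/-- All the energies vanish during one period. -/
lemma energies_eq_zero {γ κ : ℝ} (hγ : 1 / 2 < γ) (hγ' : γ ≤ 3 / 2) (hκ0 : 0 < κ)
    (hκ : κ * (1 - ‖v‖ ^ 2) = 1) (hV : ∀ z, 0 ≤ 2 * γ * inner ℝ (S z) (φ z) - 3 * Vp z)
    {z : Spacetime} (hz : z ∈ onePeriod P) :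
    (κ * ‖∑ μ, fourVel v μ • 𝒜.cov a φ μ z‖ ^ 2
        - ∑ μ, eta μ * inner ℝ (𝒜.cov a φ μ z) (𝒜.cov a φ μ z) = 0)
      ∧ ∑ b, fieldEnergy κ v (fun μ ν => 𝒜.curvature a μ ν z b) = 0 := by
  set Q : Spacetime → ℝ := fun z =>
    (∑ μ, eta μ * inner ℝ (𝒜.cov a φ μ z) (𝒜.cov a φ μ z)) with hQ
  set K : Spacetime → ℝ := fun z => κ * ‖∑ μ, fourVel v μ • 𝒜.cov a φ μ z‖ ^ 2 - Q z with hK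
  set M : Spacetime → ℝ := fun z =>
    ∑ b, fieldEnergy κ v (fun μ ν => 𝒜.curvature a μ ν z b) with hM
  set T : Spacetime → ℝ := fun z => ∑ μ, ∑ ν, eta μ * (𝒜.stress a φ Vp μ ν z
      * orthLift v ν (comoving κ v (coordVec μ))) with hT
  have hcd := h.continuous_cov
  have hcf := h.continuous_curvature
  have hκv : 0 < 1 - ‖v‖ ^ 2 := by
    by_contra hc
    nlinarith
  have hK0 : ∀ z, 0 ≤ K z := fun z =>
    le_trans (by positivity) (spatial_part_ge hκ fun μ => 𝒜.cov a φ μ z)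
  have hM0 : ∀ z, 0 ≤ M z := fun z => Finset.sum_nonneg fun b _ =>
    (fieldEnergy_nonneg hκ0.le hκ _ fun μ ν => by
      rw [𝒜.curvature_antisymm]; rfl).1
  -- The multiplier 2γ is chosen so that the potential enters exactly as in the assumed inequality.
  -- Writing Q as κ|D_uφ|² - K then gives the coefficients 3 - 2γ and 2γ - 1.
  set N : Spacetime → ℝ := fun z => -T z - 2 * γ * (Q z - inner ℝ (S z) (φ z)) with hN
  have hNeq : ∀ z, N z = (2 * γ * inner ℝ (S z) (φ z) - 3 * Vp z)
      + (3 - 2 * γ) * (κ * ‖∑ μ, fourVel v μ • 𝒜.cov a φ μ z‖ ^ 2)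
      + ((2 * γ - 1) * K z + M z) := by
    intro z
    have h1 : T z = _ := sum_stress_eq (𝒜 := 𝒜) (a := a) (φ := φ) (Vp := Vp) hκ z
    rw [← sum_fieldEnergy_eq] at h1
    simp only [hN, h1, hK, hM, hQ]
    ring
  have hGN : ∀ z, (2 * γ - 1) * K z + M z ≤ N z := by
    intro z
    rw [hNeq]
    have : 0 ≤ (3 - 2 * γ) * (κ * ‖∑ μ, fourVel v μ • 𝒜.cov a φ μ z‖ ^ 2) :=
      mul_nonneg (by linarith) (by positivity)
    linarith [hV z]
  have hG0 : ∀ z, 0 ≤ (2 * γ - 1) * K z + M z := fun z =>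
    add_nonneg (mul_nonneg (by linarith) (hK0 z)) (hM0 z)
  have hTi : IntegrableOn T (onePeriod P) :=
    integrable_finsetSum _ fun μ _ => integrable_finsetSum _ fun ν _ =>
      ((h.integrable_stress μ ν).mul_const _).const_mul _
  have hQi : IntegrableOn (fun z => Q z - inner ℝ (S z) (φ z)) (onePeriod P) :=
    (integrable_finsetSum _ fun μ _ => (h.integrable_inner_cov μ μ).const_mul (eta μ)).sub
      h.integrable_force
  have hNi : IntegrableOn N (onePeriod P) := hTi.neg.sub (hQi.const_mul (2 * γ))
  have hint : ∫ z in onePeriod P, N z = 0 := by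
    have e1 : ∫ z in onePeriod P, T z = 0 := h.integral_stress hκ0.le hκ
    have e2 : ∫ z in onePeriod P, (Q z - inner ℝ (S z) (φ z)) = 0 := h.integral_scalar hκ0.le hκ
    calc ∫ z in onePeriod P, N z
        = (∫ z in onePeriod P, -T z)
          - ∫ z in onePeriod P, 2 * γ * (Q z - inner ℝ (S z) (φ z)) :=
          integral_sub hTi.neg (hQi.const_mul (2 * γ))
      _ = 0 := by rw [integral_neg, integral_const_mul, e1, e2]; simp
  have hN0 : N =ᵐ[volume.restrict (onePeriod P)] 0 :=
    (setIntegral_eq_zero_iff_of_nonneg_ae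
      (Eventually.of_forall fun z => (hG0 z).trans (hGN z)) hNi).1 hint
  have hGae : (fun z => (2 * γ - 1) * K z + M z) =ᵐ[volume.restrict (onePeriod P)] fun _ => 0 := by
    filter_upwards [hN0] with z hz
    exact le_antisymm ((hGN z).trans hz.le) (hG0 z)
  have hGc : Continuous fun z => (2 * γ - 1) * K z + M z := by
    have hQc : Continuous Q :=
      continuous_finsetSum _ fun μ _ => continuous_const.mul ((hcd μ).inner (hcd μ))
    have hKc : Continuous K := (continuous_const.mul ((continuous_finsetSum _ fun μ _ =>
      continuous_const.smul (hcd μ)).norm.pow 2)).sub hQc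
    have hMc : Continuous M := by
      have : ∀ μ ν b, Continuous fun z => 𝒜.curvature a μ ν z b := fun μ ν b =>
        (EuclideanSpace.proj b : EuclideanSpace ℝ (Fin n) →L[ℝ] ℝ).continuous.comp (hcf μ ν)
      simp only [hM, fieldEnergy]
      fun_prop
    exact (continuous_const.mul hKc).add hMc
  -- The closed slab is the closure of its interior, so a continuous function vanishing almost
  -- everywhere on it vanishes also at the end times.
  have hsub : onePeriod P ⊆ closure (interior (onePeriod P)) := by
    rw [onePeriod, interior_prod_eq, interior_Icc, interior_univ, closure_prod_eq,
      closure_Ioo h.pos.ne, closure_univ]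
  have hG := Measure.eqOn_of_ae_eq hGae hGc.continuousOn continuousOn_const hsub hz
  simp only at hG
  have hKz := hK0 z
  have hMz := hM0 z
  have hKM : (2 * γ - 1) * K z = 0 := by
    have := mul_nonneg (by linarith : 0 ≤ 2 * γ - 1) hKz
    linarith
  -- Here γ > 1/2 has to be strict.
  have hK' : K z = 0 := by
    rcases mul_eq_zero.1 hKM with h1 | h1
    · linarith
    · exact h1
  exact ⟨hK', by linarith⟩

/-- A property which holds during one period and which is invariant under the helical shift holds
at all times. -/
lemma forall_of_onePeriod {p : Spacetime → Prop} (h0 : ∀ z ∈ onePeriod P, p z)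
    (hshift : ∀ z, p (helicalShift R P (P • v) z) ↔ p z) (z : Spacetime) : p z := by
  have hP := h.pos
  have hnat : ∀ (k : ℕ) (z : Spacetime), z.1 ∈ Icc (-(k * P)) (k * P + P) → p z := by
    intro k
    induction k with
    | zero => intro z hz; exact h0 z ⟨by simpa using hz, mem_univ _⟩
    | succ k ih =>
      intro z hz
      push_cast at hz
      rcases le_total z.1 0 with hz0 | hz0
      · rw [← hshift]
        refine ih _ ⟨?_, ?_⟩
        · simp only [helicalShift]; linarith [hz.1]
        · have : 0 ≤ (k : ℝ) * P := by positivity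
          simp only [helicalShift]; linarith
      · obtain ⟨y, hy⟩ : ∃ y, z = helicalShift R P (P • v) y :=
          ⟨(z.1 - P, R.symm (z.2 - P • v)), by simp [helicalShift]⟩
        rw [hy, hshift]
        have hy1 : z.1 = y.1 + P := by rw [hy]; rfl
        have : 0 ≤ (k : ℝ) * P := by positivity
        -- One period back may leave the interval of the induction hypothesis only for k = 0, when
        -- the time of z lies in [0, P). In that case the point is shifted forward again into the
        -- first period.
        by_cases hk : (k : ℝ) * P < P ∧ y.1 < -(k * P)
        · by_cases hk0 : k = 0
          · subst hk0
            have : y.1 ∈ Icc (-P) 0 := ⟨by linarith, by have := hk.2; simp at this; linarith⟩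
            rw [← hshift]
            exact ih _ ⟨by simp only [helicalShift]; simp; linarith [this.1],
              by simp only [helicalShift]; simp; linarith [this.2]⟩
          · have : (1 : ℝ) ≤ k := by exact_mod_cast Nat.one_le_iff_ne_zero.2 hk0
            nlinarith [hk.1]
        · refine ih _ ⟨?_, by linarith [hz.2]⟩
          by_contra hc
          push Not at hc hk
          have h2 := mt hk (not_le.2 hc)
          push Not at h2
          linarith
  obtain ⟨k, hk⟩ := exists_nat_ge (|z.1| / P)
  have hk' : |z.1| ≤ k * P := by rwa [div_le_iff₀ hP] at hk
  exact hnat k z ⟨by linarith [neg_abs_le z.1], by linarith [le_abs_self z.1]⟩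

lemma curvature_helicalShift_eq_zero_iff (z : Spacetime) :
    (∀ μ ν, 𝒜.curvature a μ ν (helicalShift R P (P • v) z) = 0)
      ↔ ∀ μ ν, 𝒜.curvature a μ ν z = 0 := by
  -- An orthogonal matrix is injective; contraction with the basis vector of index β isolates X β.
  -- It is applied once for each index of the curvature.
  have hinj : ∀ X : Fin 4 → EuclideanSpace ℝ (Fin n),
      (∀ ν, ∑ β, rotMatrix R ν β • X β = 0) → ∀ β, X β = 0 := by
    intro X hX β
    have := sum_rotMatrix_smul R (Pi.single β 1) X
    simp only [hX, smul_zero, Finset.sum_const_zero] at this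
    rw [this]
    simp [Pi.single_apply]
  constructor
  · intro h0 μ ν
    have h1 : ∀ α μ, ∑ β, rotMatrix R μ β • ∑ γ, rotMatrix R α γ • 𝒜.curvature a β γ z = 0 := by
      intro α μ
      rw [← h0 μ α, 𝒜.curvature_helicalShift h.contDiff_a h.shift_a]
      simp only [Finset.smul_sum, smul_smul]
    exact hinj _ (fun α => hinj _ (h1 α) μ) ν
  · intro h0 μ ν
    rw [𝒜.curvature_helicalShift h.contDiff_a h.shift_a]
    simp [h0]

/-- A solution for which the potential satisfies the virial inequality vanishes. -/
theorem eq_zero {γ : ℝ} (hγ : 1 / 2 < γ) (hγ' : γ ≤ 3 / 2)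
    (hV : ∀ z, 0 ≤ 2 * γ * inner ℝ (S z) (φ z) - 3 * Vp z) :
    (∀ z, φ z = 0) ∧ ∀ μ ν z, 𝒜.curvature a μ ν z = 0 := by
  have hv1 : 0 < 1 - ‖v‖ ^ 2 := by nlinarith [h.velocity_lt, norm_nonneg v]
  obtain ⟨κ, hκd⟩ : ∃ κ, κ = (1 - ‖v‖ ^ 2)⁻¹ := ⟨_, rfl⟩
  have hκ0 : 0 < κ := by rw [hκd]; positivity
  have hκ : κ * (1 - ‖v‖ ^ 2) = 1 := by rw [hκd]; exact inv_mul_cancel₀ hv1.ne'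
  refine ⟨?_, fun μ ν z => ?_⟩
  · refine h.forall_of_onePeriod ?_ fun z => by rw [h.shift_φ]
    rintro ⟨t, x⟩ ⟨ht, -⟩
    -- K = 0 gives D_iφ = -κ v_i D_uφ. Contracting with w orthogonal to v removes D_uφ, about which
    -- nothing is known when γ = 3/2. One such direction is enough.
    obtain ⟨w, hw0, hvw⟩ := exists_ne_zero_orthogonal v
    have hcov : ∀ y : Space, ∑ i : Fin 3, w i • 𝒜.cov a φ i.succ (t, y) = 0 := by
      intro y
      have hK := (h.energies_eq_zero hγ hγ' hκ0 hκ hV (z := (t, y)) ⟨ht, mem_univ _⟩).1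
      have hp := spatial_part_ge hκ fun μ => 𝒜.cov a φ μ (t, y)
      rw [hK] at hp
      have hp0 : ∑ i : Fin 3, ‖𝒜.cov a φ i.succ (t, y)
          + (κ * v i) • ∑ μ, fourVel v μ • 𝒜.cov a φ μ (t, y)‖ ^ 2 ≤ 0 :=
        le_of_mul_le_mul_left (by simpa using hp) hv1
      have hpi : ∀ i : Fin 3, 𝒜.cov a φ i.succ (t, y)
          + (κ * v i) • ∑ μ, fourVel v μ • 𝒜.cov a φ μ (t, y) = 0 := by
        intro i
        have := (Finset.sum_eq_zero_iff_of_nonneg fun i _ => sq_nonneg _).1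
          (le_antisymm hp0 (Finset.sum_nonneg fun i _ => sq_nonneg _)) i (Finset.mem_univ i)
        simpa using this
      have hvw' : ∑ i, w i * (κ * v i) = 0 := by
        rw [PiLp.inner_apply] at hvw
        simp only [RCLike.inner_apply, conj_trivial] at hvw
        rw [← mul_zero κ, ← hvw, Finset.mul_sum]
        exact Finset.sum_congr rfl fun _ _ => by ring
      have := Finset.sum_congr rfl fun i (_ : i ∈ Finset.univ) => congrArg (w i • ·) (hpi i)
      simp only [smul_add, smul_smul, Finset.sum_add_distrib, ← Finset.sum_smul, hvw', zero_smul,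
        add_zero, smul_zero, Finset.sum_const_zero] at this
      exact this
    have hsq : ContDiff ℝ ∞ fun z => ‖φ z‖ ^ 2 := h.contDiff_φ.norm_sq ℝ
    have hder : ∀ s : ℝ, HasDerivAt (fun s : ℝ => ‖φ (t, x + s • w)‖ ^ 2) 0 s := by
      intro s
      have h1 : HasDerivAt (fun s : ℝ => ((t, x + s • w) : Spacetime)) ((0 : ℝ), w) s := by
        refine (hasDerivAt_const s t).prodMk ?_
        simpa using ((hasDerivAt_id s).smul_const w).const_add x
      have h2 := (hsq.differentiable (by simp) (t, x + s • w)).hasFDerivAt.comp_hasDerivAt s h1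
      have h3 : fderiv ℝ (fun z => ‖φ z‖ ^ 2) (t, x + s • w) ((0 : ℝ), w) = 0 := by
        have hw : ((0 : ℝ), w) = ∑ i : Fin 3, w i • coordVec i.succ := by
          ext k
          · simp [coordVec, Prod.fst_sum]
          · simp [coordVec, Prod.snd_sum, Pi.single_apply]
        rw [hw, map_sum]
        simp only [map_smul]
        have : ∀ i : Fin 3, fderiv ℝ (fun z => ‖φ z‖ ^ 2) (t, x + s • w) (coordVec i.succ)
            = 2 * inner ℝ (φ (t, x + s • w)) (𝒜.cov a φ i.succ (t, x + s • w)) := fun i =>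
          h.pd_norm_sq i.succ (t, x + s • w)
        simp only [this, smul_eq_mul, mul_left_comm _ (2 : ℝ), ← Finset.mul_sum]
        simp only [← real_inner_smul_right, ← inner_sum, hcov, inner_zero_right, mul_zero]
      rw [h3] at h2
      exact h2
    have hconst : ∀ s : ℝ, ‖φ (t, x + s • w)‖ ^ 2 = ‖φ (t, x)‖ ^ 2 := by
      intro s
      have := is_const_of_deriv_eq_zero (fun s => (hder s).differentiableAt)
        (fun s => (hder s).deriv) s 0
      simpa using this
    have hinf : Tendsto (fun s : ℝ => x + s • w) atTop (cocompact Space) := by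
      rw [← Metric.cobounded_eq_cocompact, ← tendsto_norm_atTop_iff_cobounded]
      have h1 : Tendsto (fun s : ℝ => s * ‖w‖ - ‖x‖) atTop atTop :=
        tendsto_atTop_add_const_right _ _ (tendsto_id.atTop_mul_const (norm_pos_iff.2 hw0))
      refine tendsto_atTop_mono (fun s => ?_) h1
      have h2 := norm_sub_norm_le (s • w) (-x)
      rw [norm_smul, norm_neg, sub_neg_eq_add, add_comm] at h2
      have h3 : s * ‖w‖ ≤ ‖s‖ * ‖w‖ :=
        mul_le_mul_of_nonneg_right (Real.le_norm_self s) (norm_nonneg _)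
      linarith
    -- The constant value of |φ|² along the line equals its limit at infinity.
    have hl := ((h.lim t).comp hinf).norm.pow 2
    simp only [Function.comp_def, hconst, norm_zero] at hl
    have := tendsto_nhds_unique hl tendsto_const_nhds
    simpa using this.symm
  · refine h.forall_of_onePeriod (p := fun z => ∀ μ ν, 𝒜.curvature a μ ν z = 0) ?_
      h.curvature_helicalShift_eq_zero_iff z μ ν
    intro z hz μ ν
    have hM := (h.energies_eq_zero hγ hγ' hκ0 hκ hV hz).2
    have hnn := fun b => fieldEnergy_nonneg hκ0.le hκ (fun μ ν => 𝒜.curvature a μ ν z b)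
      fun μ ν => by rw [𝒜.curvature_antisymm]; rfl
    ext b
    exact (hnn b).2 ((Finset.sum_eq_zero_iff_of_nonneg fun b _ => (hnn b).1).1 hM b
      (Finset.mem_univ b)) μ ν

end Vanishing

end GaugeAction.PeriodicSolution

/-! ### The gauge action of a gauge group in a unitary representation -/

section GaugeData

variable {N n d : ℕ}

/-- The linear combination of generators with given real coefficients. -/
def lieComb {m : ℕ} (τ : Fin n → Matrix (Fin m) (Fin m) ℂ) (X : Fin n → ℝ) :
    Matrix (Fin m) (Fin m) ℂ := ∑ a, X a • τ a

lemma lieComb_add {m : ℕ} (τ : Fin n → Matrix (Fin m) (Fin m) ℂ) (X Y : Fin n → ℝ) :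
    lieComb τ (X + Y) = lieComb τ X + lieComb τ Y := by
  simp [lieComb, add_smul, Finset.sum_add_distrib]

lemma lieComb_smul {m : ℕ} (τ : Fin n → Matrix (Fin m) (Fin m) ℂ) (c : ℝ) (X : Fin n → ℝ) :
    lieComb τ (c • X) = c • lieComb τ X := by
  simp [lieComb, Finset.smul_sum, mul_smul]

/-- The Lie bracket given by the structure constants, times the coupling constant. -/
def structBracket (C : Fin n → Fin n → Fin n → ℝ) (g : ℝ) (X Y : Fin n → ℝ) : Fin n → ℝ :=
  fun a => g * ∑ b, ∑ c, C a b c * X b * Y c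

variable (𝒢 : GaugeGroup N n)

lemma GaugeGroup.C_cyclic (a b c : Fin n) : 𝒢.C c a b = 𝒢.C a b c := by
  rw [𝒢.antisymm_left a c b, 𝒢.antisymm_right a b c, neg_neg]

/-- Stated for any matrices with these structure constants, so that it serves both the defining
generators τ and the representation T. The factor g matches the coupling contained in
`structBracket`. -/
lemma lieComb_commutator {m : ℕ} {τ : Fin n → Matrix (Fin m) (Fin m) ℂ}
    (hτ : ∀ a b, τ a * τ b - τ b * τ a = Complex.I • ∑ c, 𝒢.C a b c • τ c)
    (g : ℝ) (X Y : Fin n → ℝ) :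
    (g : ℂ) • (lieComb τ X * lieComb τ Y - lieComb τ Y * lieComb τ X)
      = Complex.I • lieComb τ (structBracket 𝒢.C g X Y) := by
  have h1 : lieComb τ X * lieComb τ Y - lieComb τ Y * lieComb τ X
      = ∑ a, ∑ b, (X a * Y b) • (τ a * τ b - τ b * τ a) := by
    have h2 : lieComb τ Y * lieComb τ X = ∑ a, ∑ b, (X a * Y b) • (τ b * τ a) := by
      simp only [lieComb, Finset.sum_mul_sum, smul_mul_smul_comm]
      rw [Finset.sum_comm]
      simp only [mul_comm]
    rw [h2]
    simp only [lieComb, Finset.sum_mul_sum, smul_mul_smul_comm, smul_sub, Finset.sum_sub_distrib]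
  rw [h1]
  simp only [hτ, lieComb, structBracket]
  have h3 : ∀ a b, (X a * Y b) • Complex.I • ∑ c, 𝒢.C a b c • τ c
      = Complex.I • ∑ c, (𝒢.C c a b * X a * Y b) • τ c := by
    intro a b
    rw [smul_comm, Finset.smul_sum]
    congr 1
    refine Finset.sum_congr rfl fun c _ => ?_
    rw [smul_smul, 𝒢.C_cyclic a b c]
    congr 1
    ring
  simp only [h3, ← Finset.smul_sum]
  rw [smul_comm]
  congr 1
  rw [Complex.coe_smul, Finset.sum_congr rfl fun a _ => Finset.sum_comm, Finset.sum_comm,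
    Finset.smul_sum]
  refine Finset.sum_congr rfl fun c _ => ?_
  simp only [← Finset.sum_smul, smul_smul]

lemma lieComb_injective {m : ℕ} {τ : Fin n → Matrix (Fin m) (Fin m) ℂ}
    (hτ : LinearIndependent ℝ τ) {X : Fin n → ℝ} (hX : lieComb τ X = 0) : X = 0 := by
  funext a
  exact Fintype.linearIndependent_iff.1 hτ X hX a

/-- Pulled back from the Jacobi identity of matrix commutators. This has to go through τ, which is
linearly independent; the matrices T need not be. -/
lemma structBracket_jacobi (g : ℝ) (X Y Z : Fin n → ℝ) :
    structBracket 𝒢.C g X (structBracket 𝒢.C g Y Z)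
      + structBracket 𝒢.C g Y (structBracket 𝒢.C g Z X)
      + structBracket 𝒢.C g Z (structBracket 𝒢.C g X Y) = 0 := by
  have h := fun X Y => lieComb_commutator 𝒢 𝒢.comm g X Y
  have key : ∀ X Y Z, Complex.I • Complex.I •
      lieComb 𝒢.τ (structBracket 𝒢.C g X (structBracket 𝒢.C g Y Z))
      = (g : ℂ) • (g : ℂ) • (lieComb 𝒢.τ X * (lieComb 𝒢.τ Y * lieComb 𝒢.τ Z
        - lieComb 𝒢.τ Z * lieComb 𝒢.τ Y) - (lieComb 𝒢.τ Y * lieComb 𝒢.τ Z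
        - lieComb 𝒢.τ Z * lieComb 𝒢.τ Y) * lieComb 𝒢.τ X) := by
    intro X Y Z
    rw [← h X, smul_comm Complex.I, smul_sub Complex.I, ← mul_smul_comm Complex.I,
      ← smul_mul_assoc Complex.I, ← h Y Z, mul_smul_comm, smul_mul_assoc, ← smul_sub]
  refine lieComb_injective 𝒢.linearIndependent ?_
  have hI : Complex.I • Complex.I • lieComb 𝒢.τ (structBracket 𝒢.C g X (structBracket 𝒢.C g Y Z)
      + structBracket 𝒢.C g Y (structBracket 𝒢.C g Z X)
      + structBracket 𝒢.C g Z (structBracket 𝒢.C g X Y)) = 0 := by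
    simp only [lieComb_add, smul_add, key]
    simp only [← smul_add]
    have : ∀ A B D : Matrix (Fin N) (Fin N) ℂ, A * (B * D - D * B) - (B * D - D * B) * A
        + (B * (D * A - A * D) - (D * A - A * D) * B)
        + (D * (A * B - B * A) - (A * B - B * A) * D) = 0 := by
      intro A B D
      noncomm_ring
    rw [this]
    simp
  simpa using hI

/-- Invariance of the inner product: total antisymmetry makes C change sign when its first and last
indices are exchanged. -/
lemma sum_structBracket_mul (g : ℝ) (X Y Z : Fin n → ℝ) :
    ∑ a, structBracket 𝒢.C g X Y a * Z a = -∑ a, Y a * structBracket 𝒢.C g X Z a := by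
  simp only [structBracket, Finset.mul_sum, Finset.sum_mul]
  rw [← Finset.sum_neg_distrib]
  have : ∀ f : Fin n → Fin n → Fin n → ℝ, ∑ a, ∑ b, ∑ c, f a b c = ∑ c, ∑ b, ∑ a, f a b c := by
    intro f
    rw [Finset.sum_comm, Finset.sum_congr rfl fun b _ => Finset.sum_comm, Finset.sum_comm]
  rw [this]
  refine Finset.sum_congr rfl fun c _ => ?_
  rw [← Finset.sum_neg_distrib]
  refine Finset.sum_congr rfl fun b _ => ?_
  rw [← Finset.sum_neg_distrib]
  refine Finset.sum_congr rfl fun a _ => ?_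
  have : 𝒢.C c b a = -𝒢.C a b c := by
    rw [← 𝒢.C_cyclic, 𝒢.antisymm_right]
  rw [this]
  ring

lemma structBracket_antisymm (g : ℝ) (X Y : Fin n → ℝ) :
    structBracket 𝒢.C g Y X = -structBracket 𝒢.C g X Y := by
  funext a
  simp only [structBracket, Pi.neg_apply]
  rw [Finset.sum_comm, ← mul_neg, ← Finset.sum_neg_distrib]
  congr 1
  refine Finset.sum_congr rfl fun b _ => ?_
  rw [← Finset.sum_neg_distrib]
  refine Finset.sum_congr rfl fun c _ => ?_
  rw [𝒢.antisymm_right a b c]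
  ring

variable {𝒢} (ℛ : Generators 𝒢 d)

/-- The matrix of the action of a Lie algebra element. -/
def actMatrix (g : ℝ) (X : Fin n → ℝ) : Matrix (Fin d) (Fin d) ℂ :=
  (-(Complex.I * (g : ℂ))) • lieComb ℛ.T X

lemma actMatrix_structBracket (g : ℝ) (X Y : Fin n → ℝ) :
    actMatrix ℛ g (structBracket 𝒢.C g X Y)
      = actMatrix ℛ g X * actMatrix ℛ g Y - actMatrix ℛ g Y * actMatrix ℛ g X := by
  have h := lieComb_commutator 𝒢 ℛ.comm g X Y
  simp only [actMatrix, smul_mul_smul_comm, ← smul_sub]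
  have e : (-(Complex.I * (g : ℂ))) • lieComb ℛ.T (structBracket 𝒢.C g X Y)
      = (-(g : ℂ)) • Complex.I • lieComb ℛ.T (structBracket 𝒢.C g X Y) := by
    rw [smul_smul]; congr 1; ring
  rw [e, ← h, smul_smul]
  congr 1
  linear_combination (-(g : ℂ) ^ 2) * Complex.I_mul_I

/-- The gauge action on the scalar field, with the coupling constant absorbed. -/
def gaugeAction (g : ℝ) :
    GaugeAction (EuclideanSpace ℝ (Fin n)) (EuclideanSpace ℂ (Fin d)) where
  br := (LinearMap.mk₂ ℝ (fun X Y : EuclideanSpace ℝ (Fin n) =>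
      (WithLp.toLp 2 (structBracket 𝒢.C g X.ofLp Y.ofLp) : EuclideanSpace ℝ (Fin n)))
    (fun X Y Z => by
      ext a
      simp only [structBracket, PiLp.add_apply, mul_add, add_mul,
        Finset.sum_add_distrib])
    (fun c X Z => by
      ext a
      simp only [structBracket, PiLp.smul_apply, smul_eq_mul,
        Finset.mul_sum]
      exact Finset.sum_congr rfl fun _ _ => Finset.sum_congr rfl fun _ _ => by ring)
    (fun X Y Z => by
      ext a
      simp only [structBracket, PiLp.add_apply, mul_add,
        Finset.sum_add_distrib])
    (fun c X Z => by
      ext a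
      simp only [structBracket, PiLp.smul_apply, smul_eq_mul,
        Finset.mul_sum]
      exact Finset.sum_congr rfl fun _ _ => Finset.sum_congr rfl fun _ _ => by
        ring)).toContinuousBilinearMap
  act := (LinearMap.mk₂ ℝ (fun (X : EuclideanSpace ℝ (Fin n)) (ψ : EuclideanSpace ℂ (Fin d)) =>
      Matrix.toEuclideanLin (actMatrix ℛ g X.ofLp) ψ)
    (fun X Y ψ => by simp [actMatrix, lieComb_add])
    (fun c X ψ => by
      rw [WithLp.ofLp_smul, actMatrix, lieComb_smul, ← Complex.coe_smul, smul_comm, map_smul,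
        LinearMap.smul_apply, Complex.coe_smul]
      rfl)
    (fun X ψ χ => by simp)
    (fun c X ψ => by
      rw [← Complex.coe_smul, map_smul, Complex.coe_smul])).toContinuousBilinearMap
  br_antisymm X Y := by
    simp only [LinearMap.toContinuousBilinearMap_apply, LinearMap.mk₂_apply,
      structBracket_antisymm 𝒢 g X.ofLp Y.ofLp, WithLp.toLp_neg]
  jacobi X Y Z := by
    simp only [LinearMap.toContinuousBilinearMap_apply, LinearMap.mk₂_apply, ← WithLp.toLp_add,
      structBracket_jacobi, WithLp.toLp_zero]
  br_skew X Y Z := by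
    simp only [LinearMap.toContinuousBilinearMap_apply, LinearMap.mk₂_apply, PiLp.inner_apply,
      RCLike.inner_apply, conj_trivial]
    simpa only [mul_comm] using sum_structBracket_mul 𝒢 g X.ofLp Y.ofLp Z.ofLp
  act_skew X ψ χ := by
    simp only [LinearMap.toContinuousBilinearMap_apply, LinearMap.mk₂_apply]
    have hre : ∀ x y : EuclideanSpace ℂ (Fin d), inner ℝ x y = (inner ℂ x y).re := by
      intro x y
      simp [PiLp.inner_apply]
    have hH : (lieComb ℛ.T X.ofLp).IsHermitian := by
      rw [Matrix.IsHermitian, lieComb, Matrix.conjTranspose_sum]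
      refine Finset.sum_congr rfl fun a _ => ?_
      rw [Matrix.conjTranspose_smul, (ℛ.isHermitian a).eq]
      simp
    have hsym := Matrix.isSymmetric_toEuclideanLin_iff.2 hH ψ χ
    rw [hre, hre, actMatrix, map_smul, LinearMap.smul_apply, LinearMap.smul_apply,
      inner_smul_left, inner_smul_right, hsym]
    simp
  act_br X Y ψ := by
    simp only [LinearMap.toContinuousBilinearMap_apply, LinearMap.mk₂_apply,
      actMatrix_structBracket, Matrix.toLpLin_apply, Matrix.sub_mulVec, WithLp.toLp_sub,
      Matrix.mulVec_mulVec]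

lemma gaugeAction_act_apply (g : ℝ) (X : EuclideanSpace ℝ (Fin n))
    (ψ : EuclideanSpace ℂ (Fin d)) :
    (gaugeAction ℛ g).act X ψ
      = -((Complex.I * (g : ℂ)) • ∑ a, X a • Matrix.toEuclideanLin (ℛ.T a) ψ) := by
  change Matrix.toEuclideanLin (actMatrix ℛ g X.ofLp) ψ = _
  rw [actMatrix, map_smul, LinearMap.smul_apply, neg_smul, lieComb, map_sum, LinearMap.sum_apply]
  congr 2
  refine Finset.sum_congr rfl fun a _ => ?_
  rw [← Complex.coe_smul, map_smul, LinearMap.smul_apply, Complex.coe_smul]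

/-! ### The Lagrangian in terms of the gauge action -/

variable (g : ℝ) (V : ℝ → ℝ)

/-- The field strength as a vector of the Lie algebra. -/
def curvVec (A : Fin 4 → Fin n → ℝ) (dA : Fin 4 → Fin 4 → Fin n → ℝ) (μ ν : Fin 4) :
    EuclideanSpace ℝ (Fin n) :=
  WithLp.toLp 2 (dA μ ν) - WithLp.toLp 2 (dA ν μ)
    + (gaugeAction ℛ g).br (WithLp.toLp 2 (A μ)) (WithLp.toLp 2 (A ν))

lemma curvVec_apply (A : Fin 4 → Fin n → ℝ) (dA : Fin 4 → Fin 4 → Fin n → ℝ) (μ ν : Fin 4)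
    (a : Fin n) : curvVec ℛ g A dA μ ν a = curv 𝒢 g A dA μ ν a := rfl

lemma covD_eq (φ : EuclideanSpace ℂ (Fin d)) (A : Fin 4 → Fin n → ℝ)
    (dφ : Fin 4 → EuclideanSpace ℂ (Fin d)) (μ : Fin 4) :
    covD 𝒢 ℛ g φ A dφ μ = dφ μ + (gaugeAction ℛ g).act (WithLp.toLp 2 (A μ)) φ := by
  rw [gaugeAction_act_apply, ← sub_eq_add_neg]
  rfl

lemma lagrangian_eq (φ : EuclideanSpace ℂ (Fin d)) (A : Fin 4 → Fin n → ℝ)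
    (dφ : Fin 4 → EuclideanSpace ℂ (Fin d)) (dA : Fin 4 → Fin 4 → Fin n → ℝ) :
    lagrangian 𝒢 ℛ g V φ A dφ dA = (∑ μ, eta μ * ‖covD 𝒢 ℛ g φ A dφ μ‖ ^ 2) - V (‖φ‖ ^ 2)
      - (1 / 4) * ∑ μ, ∑ ν, eta μ * eta ν * ‖curvVec ℛ g A dA μ ν‖ ^ 2 := by
  rw [lagrangian]
  congr 2
  rw [Finset.sum_comm]
  refine Finset.sum_congr rfl fun μ _ => ?_
  rw [Finset.sum_comm]
  refine Finset.sum_congr rfl fun ν _ => ?_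
  rw [← Finset.mul_sum, EuclideanSpace.norm_sq_eq]
  simp only [curvVec_apply, Real.norm_eq_abs, sq_abs]

variable {g V}

/-- One computation for all the derivatives in the Euler–Lagrange equations: each variation enters
only through D_μφ, V(|φ|²) and F_{μν}. -/
lemma hasDerivAt_lagrangian {φ : ℝ → EuclideanSpace ℂ (Fin d)} {A : ℝ → Fin 4 → Fin n → ℝ}
    {dφ : ℝ → Fin 4 → EuclideanSpace ℂ (Fin d)} {dA : ℝ → Fin 4 → Fin 4 → Fin n → ℝ}
    {D' : Fin 4 → EuclideanSpace ℂ (Fin d)} {V' : ℝ}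
    {F' : Fin 4 → Fin 4 → EuclideanSpace ℝ (Fin n)}
    (hD : ∀ μ, HasDerivAt (fun ε => covD 𝒢 ℛ g (φ ε) (A ε) (dφ ε) μ) (D' μ) 0)
    (hV : HasDerivAt (fun ε => V (‖φ ε‖ ^ 2)) V' 0)
    (hF : ∀ μ ν, HasDerivAt (fun ε => curvVec ℛ g (A ε) (dA ε) μ ν) (F' μ ν) 0) :
    deriv (fun ε => lagrangian 𝒢 ℛ g V (φ ε) (A ε) (dφ ε) (dA ε)) 0
      = 2 * (∑ μ, eta μ * inner ℝ (covD 𝒢 ℛ g (φ 0) (A 0) (dφ 0) μ) (D' μ)) - V'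
        - (1 / 2) * ∑ μ, ∑ ν, eta μ * eta ν *
          inner ℝ (curvVec ℛ g (A 0) (dA 0) μ ν) (F' μ ν) := by
  simp only [lagrangian_eq]
  have h1 : HasDerivAt (fun ε => ∑ μ, eta μ * ‖covD 𝒢 ℛ g (φ ε) (A ε) (dφ ε) μ‖ ^ 2)
      (∑ μ, eta μ * (2 * inner ℝ (covD 𝒢 ℛ g (φ 0) (A 0) (dφ 0) μ) (D' μ))) 0 :=
    HasDerivAt.fun_sum fun μ _ => ((hD μ).norm_sq).const_mul (eta μ)
  have h2 : HasDerivAt (fun ε => ∑ μ, ∑ ν, eta μ * eta ν * ‖curvVec ℛ g (A ε) (dA ε) μ ν‖ ^ 2)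
      (∑ μ, ∑ ν, eta μ * eta ν * (2 * inner ℝ (curvVec ℛ g (A 0) (dA 0) μ ν) (F' μ ν))) 0 :=
    HasDerivAt.fun_sum fun μ _ => HasDerivAt.fun_sum fun ν _ =>
      ((hF μ ν).norm_sq).const_mul (eta μ * eta ν)
  have h3 := ((h1.sub hV).sub (h2.const_mul (1 / 4))).deriv
  refine h3.trans ?_
  simp only [mul_left_comm _ (2 : ℝ), ← Finset.mul_sum]
  ring

end GaugeData

/-! ### The Euler–Lagrange equations in covariant form -/

section ConcreteFields

variable {N n d : ℕ} {𝒢 : GaugeGroup N n} (ℛ : Generators 𝒢 d) (g : ℝ) {V : ℝ → ℝ}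
  {φ : Spacetime → EuclideanSpace ℂ (Fin d)} {A : Spacetime → Fin 4 → Fin n → ℝ}

/-- The gauge potential as a field with values in the Lie algebra. -/
def potential (A : Spacetime → Fin 4 → Fin n → ℝ) (μ : Fin 4) (z : Spacetime) :
    EuclideanSpace ℝ (Fin n) :=
  WithLp.toLp 2 (A z μ)

lemma contDiff_potential (hA : ContDiff ℝ ∞ A) (μ : Fin 4) : ContDiff ℝ ∞ (potential A μ) := by
  unfold potential
  fun_prop

lemma pd_potential (hA : ContDiff ℝ ∞ A) (μ ν : Fin 4) (z : Spacetime) :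
    pd μ (potential A ν) z = WithLp.toLp 2 (gradA A z μ ν) := by
  ext a
  have h : DifferentiableAt ℝ (potential A ν) z :=
    (contDiff_potential hA ν).differentiable (by simp) z
  have := (((EuclideanSpace.proj a : EuclideanSpace ℝ (Fin n) →L[ℝ] ℝ)).hasFDerivAt.comp z
    h.hasFDerivAt).fderiv
  have := congrArg (fun L => L (coordVec μ)) this
  exact this.symm

lemma covDeriv_eq (μ : Fin 4) (z : Spacetime) :
    covDeriv 𝒢 ℛ g φ A μ z = (gaugeAction ℛ g).cov (potential A) φ μ z :=
  covD_eq ℛ g _ _ _ _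

lemma curvVec_eq (hA : ContDiff ℝ ∞ A) (μ ν : Fin 4) (z : Spacetime) :
    curvVec ℛ g (A z) (gradA A z) μ ν = (gaugeAction ℛ g).curvature (potential A) μ ν z := by
  rw [GaugeAction.curvature, pd_potential hA, pd_potential hA]
  rfl

lemma fieldStrength_eq (hA : ContDiff ℝ ∞ A) (μ ν : Fin 4) (a : Fin n) (z : Spacetime) :
    fieldStrength 𝒢 g A μ ν a z = (gaugeAction ℛ g).curvature (potential A) μ ν z a := by
  rw [← curvVec_eq ℛ g hA]
  rfl

/-- The force exerted by the potential on the scalar field. -/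
def force (V : ℝ → ℝ) (φ : Spacetime → EuclideanSpace ℂ (Fin d)) (z : Spacetime) :
    EuclideanSpace ℂ (Fin d) :=
  derivWithin V (Set.Ici 0) (‖φ z‖ ^ 2) • φ z

lemma hasDerivAt_add_smul {E : Type*} [NormedAddCommGroup E] [NormedSpace ℝ E] (x v : E) :
    HasDerivAt (fun ε : ℝ => x + ε • v) v 0 := by
  simpa using ((hasDerivAt_id (0 : ℝ)).smul_const v).const_add x

/-- The argument of V never leaves [0, ∞), so the one-sided derivative is enough for a two-sided
chain rule, even at x = 0. -/
lemma hasDerivAt_potentialEnergy (hV : DifferentiableOn ℝ V (Set.Ici 0))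
    (x v : EuclideanSpace ℂ (Fin d)) :
    HasDerivAt (fun ε : ℝ => V (‖x + ε • v‖ ^ 2))
      (derivWithin V (Set.Ici 0) (‖x‖ ^ 2) * (2 * inner ℝ x v)) 0 := by
  have h1 := (hasDerivAt_add_smul x v).norm_sq
  have h2 := (hV (‖x + (0 : ℝ) • v‖ ^ 2) (by simp [Set.mem_Ici])).hasDerivWithinAt
  have h3 := h2.scomp_hasDerivAt (0 : ℝ) h1 (fun ε => by simp [Set.mem_Ici])
  refine h3.congr_deriv ?_
  simp [mul_comm]

lemma deriv_lagrangian_dirGrad (μ : Fin 4) (v : EuclideanSpace ℂ (Fin d)) (z : Spacetime) :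
    deriv (fun ε : ℝ =>
        lagrangian 𝒢 ℛ g V (φ z) (A z) (grad φ z + ε • dirGrad μ v) (gradA A z)) 0
      = 2 * eta μ * inner ℝ ((gaugeAction ℛ g).cov (potential A) φ μ z) v := by
  have hD : ∀ ν, HasDerivAt (fun ε : ℝ => covD 𝒢 ℛ g (φ z) (A z) (grad φ z + ε • dirGrad μ v) ν)
      (dirGrad μ v ν) 0 := by
    intro ν
    simp only [covD_eq, Pi.add_apply, Pi.smul_apply]
    exact (hasDerivAt_add_smul _ _).add_const _
  rw [hasDerivAt_lagrangian (g := g) (φ := fun _ => φ z) (A := fun _ => A z)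
    (dA := fun _ => gradA A z) ℛ hD (hasDerivAt_const _ _) (F' := fun _ _ => 0)
    (fun _ _ => hasDerivAt_const _ _)]
  simp only [zero_smul, add_zero, inner_zero_right, mul_zero, Finset.sum_const_zero, sub_zero]
  rw [Finset.sum_eq_single μ]
  · rw [← covDeriv_eq, covDeriv, dirGrad, Pi.single_eq_same]
    ring
  · intro ν _ hν
    simp [dirGrad, Pi.single_eq_of_ne hν]
  · simp

lemma deriv_lagrangian_scalar (hV : DifferentiableOn ℝ V (Set.Ici 0))
    (v : EuclideanSpace ℂ (Fin d)) (z : Spacetime) :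
    deriv (fun ε : ℝ => lagrangian 𝒢 ℛ g V (φ z + ε • v) (A z) (grad φ z) (gradA A z)) 0
      = 2 * (∑ μ, eta μ * inner ℝ ((gaugeAction ℛ g).cov (potential A) φ μ z)
          ((gaugeAction ℛ g).act (potential A μ z) v)) - 2 * inner ℝ (force V φ z) v := by
  have hD : ∀ μ, HasDerivAt (fun ε : ℝ => covD 𝒢 ℛ g (φ z + ε • v) (A z) (grad φ z) μ)
      ((gaugeAction ℛ g).act (potential A μ z) v) 0 := by
    intro μ
    simp only [covD_eq]
    exact (((gaugeAction ℛ g).act (potential A μ z)).hasFDerivAt.comp_hasDerivAt _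
      (hasDerivAt_add_smul (φ z) v)).const_add _
  rw [hasDerivAt_lagrangian (g := g) (φ := fun ε : ℝ => φ z + ε • v) (A := fun _ => A z)
    (dφ := fun _ => grad φ z) (dA := fun _ => gradA A z) ℛ hD
    (hasDerivAt_potentialEnergy hV (φ z) v) (F' := fun _ _ => 0)
    (fun _ _ => hasDerivAt_const _ _)]
  simp only [zero_smul, add_zero, inner_zero_right, mul_zero, Finset.sum_const_zero, sub_zero]
  rw [force, real_inner_smul_left]
  simp only [← covDeriv_eq, covDeriv]
  ring

lemma toLp_dirA (ν ρ : Fin 4) (a : Fin n) :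
    (WithLp.toLp 2 (dirA ν a ρ) : EuclideanSpace ℝ (Fin n))
      = if ρ = ν then EuclideanSpace.single a (1 : ℝ) else 0 := by
  unfold dirA
  split_ifs with h
  · subst h; simp
  · simp [Pi.single_eq_of_ne h]

lemma toLp_dirGradA (μ ν ρ σ : Fin 4) (a : Fin n) :
    (WithLp.toLp 2 (dirGradA μ ν a ρ σ) : EuclideanSpace ℝ (Fin n))
      = if ρ = μ then (if σ = ν then EuclideanSpace.single a (1 : ℝ) else 0) else 0 := by
  unfold dirGradA
  split_ifs with h h'
  · subst h; rw [Pi.single_eq_same, toLp_dirA, if_pos h']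
  · subst h; rw [Pi.single_eq_same, toLp_dirA, if_neg h']
  · simp [Pi.single_eq_of_ne h]

/-- Both terms of a variation of F contribute equally; the factor 2 compensates for the double
counting of index pairs in the Lagrangian. -/
lemma sum_eta_inner_antisymm {E : Type*} [NormedAddCommGroup E] [InnerProductSpace ℝ E]
    {F : Fin 4 → Fin 4 → E} (hF : ∀ μ ν, F ν μ = -F μ ν) (w : Fin 4 → Fin 4 → E) :
    ∑ ρ, ∑ σ, eta ρ * eta σ * inner ℝ (F ρ σ) (w ρ σ - w σ ρ)
      = 2 * ∑ ρ, ∑ σ, eta ρ * eta σ * inner ℝ (F ρ σ) (w ρ σ) := by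
  have h : ∑ ρ, ∑ σ, eta ρ * eta σ * inner ℝ (F ρ σ) (w σ ρ)
      = -∑ ρ, ∑ σ, eta ρ * eta σ * inner ℝ (F ρ σ) (w ρ σ) := by
    rw [Finset.sum_comm, ← Finset.sum_neg_distrib]
    refine Finset.sum_congr rfl fun ρ _ => ?_
    rw [← Finset.sum_neg_distrib]
    refine Finset.sum_congr rfl fun σ _ => ?_
    rw [hF ρ σ, inner_neg_left]
    ring
  simp only [inner_sub_right, mul_sub, Finset.sum_sub_distrib, h]
  ring

lemma deriv_lagrangian_dirGradA (hA : ContDiff ℝ ∞ A) (μ ν : Fin 4) (a : Fin n)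
    (z : Spacetime) :
    deriv (fun ε : ℝ => lagrangian 𝒢 ℛ g V (φ z) (A z) (grad φ z)
        (gradA A z + ε • dirGradA μ ν a)) 0
      = -(eta μ * eta ν) * inner ℝ ((gaugeAction ℛ g).curvature (potential A) μ ν z)
          (EuclideanSpace.single a (1 : ℝ)) := by
  set w : Fin 4 → Fin 4 → EuclideanSpace ℝ (Fin n) :=
    fun ρ σ => WithLp.toLp 2 (dirGradA μ ν a ρ σ) with hw
  have hF : ∀ ρ σ, HasDerivAt (fun ε : ℝ => curvVec ℛ g (A z) (gradA A z + ε • dirGradA μ ν a) ρ σ)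
      (w ρ σ - w σ ρ) 0 := by
    intro ρ σ
    simp only [curvVec, Pi.add_apply, Pi.smul_apply, WithLp.toLp_add, WithLp.toLp_smul]
    exact ((hasDerivAt_add_smul _ _).sub (hasDerivAt_add_smul _ _)).add_const _
  rw [hasDerivAt_lagrangian (g := g) (φ := fun _ => φ z) (A := fun _ => A z)
    (dφ := fun _ => grad φ z) ℛ (D' := fun _ => 0) (fun _ => hasDerivAt_const _ _)
    (hasDerivAt_const _ _) hF]
  simp only [zero_smul, add_zero, inner_zero_right, mul_zero, Finset.sum_const_zero, sub_zero,
    curvVec_eq ℛ g hA]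
  rw [sum_eta_inner_antisymm fun ρ σ => (gaugeAction ℛ g).curvature_antisymm ρ σ z]
  simp [hw, toLp_dirGradA, apply_ite]

lemma deriv_lagrangian_gauge (hA : ContDiff ℝ ∞ A) (ν : Fin 4) (a : Fin n) (z : Spacetime) :
    deriv (fun ε : ℝ => lagrangian 𝒢 ℛ g V (φ z) (A z + ε • dirA ν a) (grad φ z)
        (gradA A z)) 0
      = 2 * eta ν * inner ℝ ((gaugeAction ℛ g).cov (potential A) φ ν z)
          ((gaugeAction ℛ g).act (EuclideanSpace.single a (1 : ℝ)) (φ z))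
        - ∑ μ, eta μ * eta ν * inner ℝ ((gaugeAction ℛ g).curvature (potential A) μ ν z)
          ((gaugeAction ℛ g).br (potential A μ z) (EuclideanSpace.single a (1 : ℝ))) := by
  set 𝒜 := gaugeAction ℛ g
  set w : Fin 4 → EuclideanSpace ℝ (Fin n) := fun ρ => WithLp.toLp 2 (dirA ν a ρ) with hw
  have hx : ∀ ρ, HasDerivAt (fun ε : ℝ => (WithLp.toLp 2 ((A z + ε • dirA ν a) ρ) :
      EuclideanSpace ℝ (Fin n))) (w ρ) 0 := by
    intro ρ
    simp only [Pi.add_apply, Pi.smul_apply, WithLp.toLp_add, WithLp.toLp_smul]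
    exact hasDerivAt_add_smul _ _
  have hD : ∀ ρ, HasDerivAt (fun ε : ℝ => covD 𝒢 ℛ g (φ z) (A z + ε • dirA ν a) (grad φ z) ρ)
      (𝒜.act (w ρ) (φ z)) 0 := by
    intro ρ
    simp only [covD_eq]
    simpa using ((𝒜.act.hasFDerivAt.comp_hasDerivAt _ (hx ρ)).clm_apply
      (hasDerivAt_const (0 : ℝ) (φ z))).const_add (grad φ z ρ)
  have hF : ∀ ρ σ, HasDerivAt (fun ε : ℝ => curvVec ℛ g (A z + ε • dirA ν a) (gradA A z) ρ σ)
      (𝒜.br (potential A ρ z) (w σ) - 𝒜.br (potential A σ z) (w ρ)) 0 := by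
    intro ρ σ
    have h := ((𝒜.br.hasFDerivAt.comp_hasDerivAt _ (hx ρ)).clm_apply (hx σ)).const_add
      (WithLp.toLp 2 (gradA A z ρ σ) - WithLp.toLp 2 (gradA A z σ ρ))
    refine h.congr_deriv ?_
    rw [sub_eq_add_neg, ← 𝒜.br_antisymm (potential A σ z) (w ρ)]
    simp [potential, add_comm]
  rw [hasDerivAt_lagrangian (g := g) (φ := fun _ => φ z) (A := fun ε : ℝ => A z + ε • dirA ν a)
    (dφ := fun _ => grad φ z) (dA := fun _ => gradA A z) ℛ hD (hasDerivAt_const _ _) hF]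
  simp only [zero_smul, add_zero, sub_zero, curvVec_eq ℛ g hA]
  rw [sum_eta_inner_antisymm (fun ρ σ => 𝒜.curvature_antisymm ρ σ z)
    (fun ρ σ => 𝒜.br (potential A ρ z) (w σ))]
  have h1 : ∀ ρ, covD 𝒢 ℛ g (φ z) (A z) (grad φ z) ρ = 𝒜.cov (potential A) φ ρ z :=
    fun ρ => covDeriv_eq ℛ g ρ z
  have h2 : w ν = EuclideanSpace.single a (1 : ℝ) := (toLp_dirA ν ν a).trans (if_pos rfl)
  have h3 : ∀ ρ, ρ ≠ ν → w ρ = 0 := fun ρ hρ => (toLp_dirA ν ρ a).trans (if_neg hρ)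
  have h4 : ∀ f : Fin 4 → ℝ, (∀ ρ, ρ ≠ ν → f ρ = 0) → ∑ ρ, f ρ = f ν := fun f hf =>
    Finset.sum_eq_single ν (fun ρ _ hρ => hf ρ hρ) (by simp)
  rw [h4 _ fun ρ hρ => by rw [h3 ρ hρ]; simp,
    Finset.sum_congr rfl fun μ _ => h4 _ fun ρ hρ => by rw [h3 ρ hρ]; simp]
  simp only [h1, h2]
  ring

/-- The Euler–Lagrange equations in covariant form. -/
lemma EquationsOfMotion.fieldEquations (hV : DifferentiableOn ℝ V (Set.Ici 0))
    (hφ : ContDiff ℝ ∞ φ) (hA : ContDiff ℝ ∞ A) (h : EquationsOfMotion 𝒢 ℛ g V φ A) :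
    (gaugeAction ℛ g).FieldEquations (potential A) φ (force V φ) := by
  set 𝒜 := gaugeAction ℛ g
  have hcov : ∀ μ, Differentiable ℝ (𝒜.cov (potential A) φ μ) := fun μ =>
    (𝒜.contDiff_cov (contDiff_potential hA) hφ μ).differentiable (by simp)
  have hcurv : ∀ μ ν, Differentiable ℝ (𝒜.curvature (potential A) μ ν) := fun μ ν =>
    (𝒜.contDiff_curvature (contDiff_potential hA) μ ν).differentiable (by simp)
  constructor
  · intro z
    refine ext_inner_right ℝ fun v => ?_
    have h1 := h.scalar v z
    simp only [deriv_lagrangian_dirGrad, deriv_lagrangian_scalar ℛ g hV] at h1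
    -- The covariant derivative of the constant field v is the action of A_μ on v. This extra term
    -- is the one that appears in ∂L/∂φ, and it cancels.
    have h2 : ∀ μ, pd μ (fun y => 2 * eta μ * inner ℝ (𝒜.cov (potential A) φ μ y) v) z
        = 2 * (eta μ * inner ℝ (𝒜.cov (potential A) (𝒜.cov (potential A) φ μ) μ z) v)
          + 2 * (eta μ * inner ℝ (𝒜.cov (potential A) φ μ z) (𝒜.act (potential A μ z) v)) := by
      intro μ
      rw [pd_const_mul _ ((hcov μ z).inner ℝ (differentiableAt_const _)),
        𝒜.pd_inner_cov (a := potential A) (hcov μ z) (differentiableAt_const _)]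
      simp only [GaugeAction.cov, pd, fderiv_fun_const, Pi.zero_apply,
        _root_.zero_apply, zero_add]
      ring
    rw [Finset.sum_congr rfl fun μ _ => h2 μ, Finset.sum_add_distrib, ← Finset.mul_sum,
      ← Finset.mul_sum] at h1
    rw [sum_inner, inner_neg_left]
    simp only [real_inner_smul_left]
    linarith
  · intro ν z X
    have key : ∀ a, ∑ μ, eta μ * inner ℝ (𝒜.covAd (potential A)
        (𝒜.curvature (potential A) μ ν) μ z) (EuclideanSpace.single a (1 : ℝ))
        = -2 * inner ℝ (𝒜.cov (potential A) φ ν z)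
          (𝒜.act (EuclideanSpace.single a (1 : ℝ)) (φ z)) := by
      intro a
      set e : EuclideanSpace ℝ (Fin n) := EuclideanSpace.single a (1 : ℝ)
      have h1 := h.gauge ν a z
      simp only [deriv_lagrangian_dirGradA ℛ g hA, deriv_lagrangian_gauge ℛ g hA] at h1
      -- The same device with the constant Lie algebra element e: the bracket term is the
      -- self-interaction part of ∂L/∂A.
      have h2 : ∀ μ, pd μ (fun y => -(eta μ * eta ν) *
          inner ℝ (𝒜.curvature (potential A) μ ν y) e) z
          = -eta ν * (eta μ * inner ℝ (𝒜.covAd (potential A)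
              (𝒜.curvature (potential A) μ ν) μ z) e)
            - eta μ * eta ν * inner ℝ (𝒜.curvature (potential A) μ ν z)
              (𝒜.br (potential A μ z) e) := by
        intro μ
        rw [pd_const_mul _ ((hcurv μ ν z).inner ℝ (differentiableAt_const _)),
          𝒜.pd_inner_covAd (a := potential A) (hcurv μ ν z) (differentiableAt_const _)]
        simp only [GaugeAction.covAd, pd, fderiv_fun_const, Pi.zero_apply,
          _root_.zero_apply, zero_add]
        ring
      rw [Finset.sum_congr rfl fun μ _ => h2 μ, Finset.sum_sub_distrib, ← Finset.mul_sum] at h1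
      have h3 := GaugeAction.eta_mul_self ν
      have h4 := congrArg (fun x => -eta ν * x) (sub_left_injective h1)
      linear_combination h4 - (∑ μ, eta μ * inner ℝ (𝒜.covAd (potential A)
        (𝒜.curvature (potential A) μ ν) μ z) e + 2 * inner ℝ (𝒜.cov (potential A) φ ν z)
          (𝒜.act e (φ z))) * h3
    have hX : X = ∑ a, X a • EuclideanSpace.single a (1 : ℝ) := by
      simpa using ((EuclideanSpace.basisFun (Fin n) ℝ).sum_repr X).symm
    rw [hX]
    simp only [inner_sum, map_sum, map_smul, _root_.sum_apply,
      _root_.smul_apply, real_inner_smul_right, Finset.mul_sum]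
    rw [Finset.sum_comm]
    refine Finset.sum_congr rfl fun a _ => ?_
    have := congrArg (fun x => X a * x) (key a)
    simp only [Finset.mul_sum] at this
    rw [mul_left_comm, ← this]
    exact Finset.sum_congr rfl fun μ _ => by ring

end ConcreteFields

section Rotations

/-- The linear isometry of an orthogonal matrix. -/
lemma exists_rotation {Ω : Matrix (Fin 3) (Fin 3) ℝ}
    (hΩ : Ω ∈ Matrix.specialOrthogonalGroup (Fin 3) ℝ) :
    ∃ R : Space ≃ₗᵢ[ℝ] Space, (∀ x, R x = Matrix.toEuclideanLin Ω x) ∧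
      ∀ x, Matrix.toEuclideanLin Ω⁻¹ (R x) = x := by
  have h1 : Ωᵀ * Ω = 1 := (Matrix.mem_orthogonalGroup_iff' _ _).1
    (Matrix.mem_specialOrthogonalGroup_iff.1 hΩ).1
  have h2 : Ω⁻¹ * Ω = 1 := by rw [Matrix.inv_eq_left_inv h1, h1]
  have h3 : ∀ (M : Matrix (Fin 3) (Fin 3) ℝ) (x : Space), Matrix.toEuclideanLin M
      (Matrix.toEuclideanLin Ω x) = Matrix.toEuclideanLin (M * Ω) x := by
    intro M x
    simp [Matrix.toLpLin_apply, Matrix.mulVec_mulVec]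
  have h4 : ∀ x y : Space, inner ℝ (Matrix.toEuclideanLin Ω x) (Matrix.toEuclideanLin Ω y)
      = inner ℝ x y := by
    intro x y
    rw [← LinearMap.adjoint_inner_right, ← Matrix.toEuclideanLin_conjTranspose_eq_adjoint, h3,
      Matrix.conjTranspose_eq_transpose_of_trivial, h1]
    simp
  refine ⟨((Matrix.toEuclideanLin Ω).isometryOfInner h4).toLinearIsometryEquiv rfl,
    fun x => rfl, fun x => ?_⟩
  change Matrix.toEuclideanLin Ω⁻¹ (Matrix.toEuclideanLin Ω x) = x
  rw [h3, h2]
  simp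

end Rotations

/-! ### From the hypotheses on the fields to the abstract setting -/

section ConcreteFields

variable {N n d : ℕ} {𝒢 : GaugeGroup N n} {ℛ : Generators 𝒢 d} {g : ℝ} {V : ℝ → ℝ}
  {φ : Spacetime → EuclideanSpace ℂ (Fin d)} {A : Spacetime → Fin 4 → Fin n → ℝ}

/-- V' is not assumed continuous. By the field equation, however, V'(|φ|²)φ is minus a covariant
d'Alembertian of a smooth field. This makes V(|φ|²) continuously differentiable, as the divergence
theorem requires. -/
lemma continuous_force (hφ : ContDiff ℝ ∞ φ) (hA : ContDiff ℝ ∞ A)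
    (h : (gaugeAction ℛ g).FieldEquations (potential A) φ (force V φ)) :
    Continuous (force V φ) := by
  have h1 : ∀ μ, Continuous ((gaugeAction ℛ g).cov (potential A)
      ((gaugeAction ℛ g).cov (potential A) φ μ) μ) := fun μ =>
    ((gaugeAction ℛ g).contDiff_cov (contDiff_potential hA)
      ((gaugeAction ℛ g).contDiff_cov (contDiff_potential hA) hφ μ) μ).continuous
  have h2 : force V φ = fun z => -∑ μ, eta μ • (gaugeAction ℛ g).cov (potential A)
      ((gaugeAction ℛ g).cov (potential A) φ μ) μ z := by
    funext z
    rw [h.scalar z, neg_neg]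
  rw [h2]
  fun_prop

lemma hasFDerivAt_potentialEnergy (hV : DifferentiableOn ℝ V (Set.Ici 0))
    (hφ : Differentiable ℝ φ) (z : Spacetime) :
    HasFDerivAt (fun y => V (‖φ y‖ ^ 2))
      ((2 : ℝ) • (innerSL ℝ (force V φ z)).comp (fderiv ℝ φ z)) z := by
  have h1 := (hφ z).hasFDerivAt.norm_sq
  have h2 := (hV (‖φ z‖ ^ 2) (by simp [Set.mem_Ici])).hasDerivWithinAt
  have h3 := h2.comp_hasFDerivAt z h1 (Eventually.of_forall fun y => by simp [Set.mem_Ici])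
  refine h3.congr_fderiv ?_
  ext w <;> simp [force] <;> ring

lemma contDiff_potentialEnergy (hV : DifferentiableOn ℝ V (Set.Ici 0))
    (hφ : ContDiff ℝ ∞ φ) (hS : Continuous (force V φ)) :
    ContDiff ℝ 1 (fun z => V (‖φ z‖ ^ 2)) := by
  have h1 := hasFDerivAt_potentialEnergy hV (hφ.differentiable (by simp))
  rw [contDiff_one_iff_fderiv]
  refine ⟨fun z => (h1 z).differentiableAt, ?_⟩
  rw [funext fun z => (h1 z).fderiv]
  exact (((innerSL ℝ).continuous.comp hS).clm_comp
    (hφ.continuous_fderiv (by simp))).const_smul (2 : ℝ)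

lemma integrableOn_curvature {P : ℝ} (hA : ContDiff ℝ ∞ A)
    (hfin : FiniteIntegrals 𝒢 ℛ g V φ A P) (μ ν : Fin 4) :
    IntegrableOn (fun z => ‖(gaugeAction ℛ g).curvature (potential A) μ ν z‖ ^ 2)
      (onePeriod P) := by
  set 𝒜 := gaugeAction ℛ g
  have hm : ∀ μ ν, AEStronglyMeasurable (fun z => ‖𝒜.curvature (potential A) μ ν z‖ ^ 2)
      (volume.restrict (onePeriod P)) := fun μ ν =>
    ((𝒜.contDiff_curvature (contDiff_potential hA) μ ν).continuous.norm.pow 2).aestronglyMeasurable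
  have hn : ∀ μ ν z, ‖𝒜.curvature (potential A) μ ν z‖ ^ 2
      = ∑ a, fieldStrength 𝒢 g A μ ν a z ^ 2 := by
    intro μ ν z
    simp only [EuclideanSpace.norm_sq_eq, fieldStrength_eq ℛ g hA, Real.norm_eq_abs, sq_abs, 𝒜]
  have hE : ∀ i : Fin 3, IntegrableOn
      (fun z => ‖𝒜.curvature (potential A) 0 i.succ z‖ ^ 2) (onePeriod P) := by
    intro i
    refine Integrable.mono' (hfin.gauge_electric.const_mul 2) (hm _ _)
      (Eventually.of_forall fun z => ?_)
    rw [Real.norm_eq_abs, abs_of_nonneg (by positivity), hn, ← mul_assoc]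
    norm_num
    exact Finset.sum_le_sum fun a _ => Finset.single_le_sum
      (f := fun i : Fin 3 => fieldStrength 𝒢 g A 0 i.succ a z ^ 2)
      (fun j _ => sq_nonneg _) (Finset.mem_univ i)
  have hB : ∀ i j : Fin 3, IntegrableOn
      (fun z => ‖𝒜.curvature (potential A) i.succ j.succ z‖ ^ 2) (onePeriod P) := by
    intro i j
    refine Integrable.mono' (hfin.gauge_magnetic.const_mul 4) (hm _ _)
      (Eventually.of_forall fun z => ?_)
    rw [Real.norm_eq_abs, abs_of_nonneg (by positivity), hn, ← mul_assoc]
    norm_num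
    refine Finset.sum_le_sum fun a _ => (Finset.single_le_sum
      (f := fun j : Fin 3 => fieldStrength 𝒢 g A i.succ j.succ a z ^ 2)
      (fun j _ => sq_nonneg _) (Finset.mem_univ j)).trans (Finset.single_le_sum
      (f := fun i : Fin 3 => ∑ j : Fin 3, fieldStrength 𝒢 g A i.succ j.succ a z ^ 2)
      (fun j _ => Finset.sum_nonneg fun _ _ => sq_nonneg _) (Finset.mem_univ i))
  have hsymm : ∀ μ ν, (fun z => ‖𝒜.curvature (potential A) ν μ z‖ ^ 2)
      = fun z => ‖𝒜.curvature (potential A) μ ν z‖ ^ 2 := by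
    intro μ ν
    funext z
    rw [𝒜.curvature_antisymm μ ν z, norm_neg]
  refine Fin.cases ?_ (fun i => ?_) μ <;> refine Fin.cases ?_ (fun j => ?_) ν
  · have : ∀ z, 𝒜.curvature (potential A) 0 0 z = 0 := by
      intro z
      ext a
      have := congrArg (fun x : EuclideanSpace ℝ (Fin n) => x a) (𝒜.curvature_antisymm (a := potential A) 0 0 z)
      simp only [PiLp.neg_apply] at this
      simp only [PiLp.zero_apply]
      linarith
    simp [this]
  · exact hE j
  · rw [hsymm]; exact hE i
  · exact hB i j

/-- The hypotheses on the fields in terms of the gauge action. -/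
lemma exists_periodicSolution (hV : DifferentiableOn ℝ V (Set.Ici 0))
    (hφ : ContDiff ℝ ∞ φ) (hA : ContDiff ℝ ∞ A)
    (hEOM : EquationsOfMotion 𝒢 ℛ g V φ A) (hlim : VanishAtSpatialInfinity φ A)
    {P : ℝ} (hP : 0 < P) {Ω : Matrix (Fin 3) (Fin 3) ℝ}
    (hΩ : Ω ∈ Matrix.specialOrthogonalGroup (Fin 3) ℝ) {l : Space}
    (hΩl : Matrix.toEuclideanLin Ω l = l) (hl : ‖l‖ / P < 1)
    (hper : PeriodicUpTo φ A P Ω l) (hfin : FiniteIntegrals 𝒢 ℛ g V φ A P) :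
    ∃ (v : Space) (R : Space ≃ₗᵢ[ℝ] Space), (gaugeAction ℛ g).PeriodicSolution (potential A) φ
      (fun z => V (‖φ z‖ ^ 2)) (force V φ) P v R := by
  obtain ⟨R, hR, hRinv⟩ := exists_rotation hΩ
  have hRl : R l = l := by rw [hR, hΩl]
  have heq := hEOM.fieldEquations ℛ g hV hφ hA
  -- Substituting x = R y + l inverts the spatial map Ω⁻¹x - l in the periodicity condition, because
  -- Ω fixes l. The condition thereby becomes invariance under a helical shift.
  have hback : ∀ y : Space, Matrix.toEuclideanLin Ω⁻¹ (R y + l) - l = y := by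
    intro y
    have := hRinv l
    rw [hRl] at this
    rw [map_add, hRinv, this, add_sub_cancel_right]
  have hPl : P • P⁻¹ • l = l := by rw [smul_smul, mul_inv_cancel₀ hP.ne', one_smul]
  have hshift : ∀ z : Spacetime, φ (helicalShift R P (P • P⁻¹ • l) z) = φ z := by
    rintro ⟨t, y⟩
    rw [hPl]
    exact (hper.scalar t (R y + l)).trans (by rw [hback])
  -- The soliton moves with velocity l/P.
  refine ⟨P⁻¹ • l, R, ?_⟩
  refine
    { contDiff_a := contDiff_potential hA
      contDiff_φ := hφ
      contDiff_Vp := contDiff_potentialEnergy hV hφ (continuous_force hφ hA heq)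
      pd_Vp := fun μ z => ?_
      inner_act := fun X z => ?_
      fieldEquations := heq
      pos := hP
      velocity_lt := ?_
      rotation := ?_
      shift_φ := hshift
      shift_a := ?_
      shift_Vp := fun z => by rw [hshift]
      lim := hlim.scalar
      integrable_cov := ?_
      integrable_curvature := integrableOn_curvature hA hfin
      integrable_force := ?_
      integrable_Vp := hfin.potential }
  · rw [pd, (hasFDerivAt_potentialEnergy hV (hφ.differentiable (by simp)) z).fderiv]
    simp [pd]
  · rw [force, real_inner_smul_left, GaugeAction.act_self_inner, mul_zero]
  · rw [norm_smul, norm_inv, Real.norm_eq_abs, abs_of_pos hP, inv_mul_eq_div]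
    exact hl
  · rw [map_smul, hRl]
  · rintro μ ⟨t, y⟩
    rw [hPl]
    ext a
    refine Fin.cases ?_ (fun i => ?_) μ
    · refine (hper.gauge_time t (R y + l) a).trans ?_
      rw [hback]
      simp [rotMatrix_zero, potential]
    · have h1 : ∀ j, rotMatrix R i.succ j.succ = Ω i j := by
        intro j
        simp [rotMatrix_succ_succ, hR, Matrix.toLpLin_apply]
      have h2 : (∑ α, rotMatrix R i.succ α • potential A α (t, y)) a
          = ∑ j, Ω i j * A (t, y) j.succ a := by
        rw [Fin.sum_univ_succ, rotMatrix_succ_zero, zero_smul, zero_add]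
        simp only [h1]
        simp [potential]
      refine (hper.gauge_space t (R y + l) i a).trans (Eq.trans ?_ h2.symm)
      rw [hback]
  · have h1 : ∀ μ z, ‖(gaugeAction ℛ g).cov (potential A) φ μ z‖ ^ 2
        = ‖covDeriv 𝒢 ℛ g φ A μ z‖ ^ 2 := fun μ z => by rw [covDeriv_eq]
    intro μ
    refine Fin.cases ?_ (fun i => ?_) μ
    · simpa only [h1] using hfin.scalar_time
    · refine Integrable.mono' hfin.scalar_space
        (((gaugeAction ℛ g).contDiff_cov (contDiff_potential hA) hφ
          i.succ).continuous.norm.pow 2).aestronglyMeasurable (Eventually.of_forall fun z => ?_)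
      rw [Real.norm_eq_abs, abs_of_nonneg (by positivity), h1]
      exact Finset.single_le_sum (f := fun i : Fin 3 => ‖covDeriv 𝒢 ℛ g φ A i.succ z‖ ^ 2)
        (fun j _ => sq_nonneg _) (Finset.mem_univ i)
  · simpa only [force, real_inner_smul_left, real_inner_self_eq_norm_sq]
      using hfin.potential_deriv

end ConcreteFields

/-! ### Linear differential equations in a Banach algebra -/

section LinearODE

variable {𝕄 : Type*} [NormedRing 𝕄] [NormedAlgebra ℝ 𝕄]

/-- The terms of the time-ordered exponential. -/
def dysonTerm (M : ℝ → 𝕄) : ℕ → ℝ → 𝕄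
  | 0 => fun _ => 1
  | k + 1 => fun s => ∫ r in (0 : ℝ)..s, M r * dysonTerm M k r

lemma continuous_dysonTerm {M : ℝ → 𝕄} (hM : Continuous M) (k : ℕ) :
    Continuous (dysonTerm M k) := by
  induction k with
  | zero => exact continuous_const
  | succ k ih =>
    exact intervalIntegral.continuous_primitive
      (fun a b => (hM.mul ih).intervalIntegrable a b) 0

lemma norm_dysonTerm_le {M : ℝ → 𝕄} {K b : ℝ} (hK : ∀ s, |s| ≤ b → ‖M s‖ ≤ K) (k : ℕ) :
    ∀ s, |s| ≤ b → ‖dysonTerm M k s‖ ≤ ‖(1 : 𝕄)‖ * (K ^ k * |s| ^ k / k.factorial) := by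
  induction k with
  | zero => intro s _; simp [dysonTerm]
  | succ k ih =>
    intro s hs
    have hK0 : 0 ≤ K := (norm_nonneg _).trans (hK s hs)
    have hle : ∀ r ∈ Set.uIoc 0 s, ‖M r * dysonTerm M k r‖
        ≤ ‖(1 : 𝕄)‖ * (K ^ (k + 1) / k.factorial) * |r| ^ k := by
      intro r hr
      have hr' : |r| ≤ b := by
        refine le_trans ?_ hs
        rcases Set.mem_uIoc.1 hr with h | h
        · rw [abs_of_pos h.1, abs_of_pos (h.1.trans_le h.2)]; exact h.2
        · rw [abs_of_nonpos h.2, abs_of_neg (h.1.trans_le h.2)]; linarith [h.1]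
      calc ‖M r * dysonTerm M k r‖ ≤ ‖M r‖ * ‖dysonTerm M k r‖ := norm_mul_le _ _
        _ ≤ K * (‖(1 : 𝕄)‖ * (K ^ k * |r| ^ k / k.factorial)) :=
          mul_le_mul (hK r hr') (ih r hr') (norm_nonneg _) hK0
        _ = _ := by ring
    have h1 := intervalIntegral.norm_integral_le_abs_of_norm_le (μ := volume)
      ((ae_restrict_iff' measurableSet_uIoc).2 (Eventually.of_forall hle))
      (Continuous.intervalIntegrable (by fun_prop) _ _)
    refine h1.trans ?_
    rw [intervalIntegral.abs_integral_eq_abs_integral_uIoc, integral_const_mul]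
    have h2 := integral_pow_abs_sub_uIoc (a := 0) (b := s) k
    simp only [sub_zero] at h2
    rw [h2, abs_of_nonneg (by positivity), Nat.factorial_succ]
    push_cast
    apply le_of_eq
    field_simp

/-- The solution is the Dyson series. It is estimated on [-2, 2] so that every point of [0, 1], end
points included, has a two-sided derivative. -/
theorem exists_linear_ode [CompleteSpace 𝕄] {M : ℝ → 𝕄} (hM : Continuous M) :
    ∃ u : ℝ → 𝕄, u 0 = 1 ∧ ∀ s ∈ Set.Icc (0 : ℝ) 1, HasDerivAt u (M s * u s) s := by
  obtain ⟨K, hK⟩ := (isCompact_Icc (a := (-2 : ℝ)) (b := 2)).exists_bound_of_continuousOn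
    hM.continuousOn
  have hK' : ∀ s, |s| ≤ 2 → ‖M s‖ ≤ K := fun s hs => hK s (abs_le.1 hs)
  have hK0 : 0 ≤ K := (norm_nonneg _).trans (hK' 0 (by simp))
  have hbound : ∀ k s, |s| ≤ 2 →
      ‖dysonTerm M k s‖ ≤ ‖(1 : 𝕄)‖ * ((K * 2) ^ k / k.factorial) := by
    intro k s hs
    refine (norm_dysonTerm_le hK' k s hs).trans ?_
    rw [mul_pow]
    gcongr
  have hsum : Summable fun k : ℕ => ‖(1 : 𝕄)‖ * ((K * 2) ^ k / k.factorial) :=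
    (Real.summable_pow_div_factorial (K * 2)).mul_left _
  have hsummable : ∀ s, |s| ≤ 2 → Summable fun k => dysonTerm M k s := fun s hs =>
    Summable.of_norm_bounded hsum fun k => hbound k s hs
  have hderiv : ∀ (k : ℕ) (s : ℝ), HasDerivAt (dysonTerm M (k + 1)) (M s * dysonTerm M k s) s :=
    fun k s => ((hM.mul (continuous_dysonTerm hM k)).integral_hasStrictDerivAt 0 s).hasDerivAt
  have hshift : ∀ s ∈ Set.Ioo (-2 : ℝ) 2, ∑' k, dysonTerm M k s
      = 1 + ∑' k, dysonTerm M (k + 1) s := fun s hs =>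
    (hsummable s (abs_le.2 ⟨hs.1.le, hs.2.le⟩)).tsum_eq_zero_add
  refine ⟨fun s => ∑' k, dysonTerm M k s, ?_, fun s hs => ?_⟩
  · refine (hshift 0 (by norm_num)).trans ?_
    simp [dysonTerm]
  · have hs2 : s ∈ Set.Ioo (-2 : ℝ) 2 := ⟨by linarith [hs.1], by linarith [hs.2]⟩
    have h := hasDerivAt_tsum_of_isPreconnected (t := Set.Ioo (-2 : ℝ) 2) (y₀ := 0) (y := s)
      (g := fun k => dysonTerm M (k + 1)) (g' := fun k s => M s * dysonTerm M k s)
      (hsum.mul_left K) isOpen_Ioo isPreconnected_Ioo (fun k s _ => hderiv k s)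
      (fun k s hs => (norm_mul_le _ _).trans (mul_le_mul
        (hK' s (abs_le.2 ⟨hs.1.le, hs.2.le⟩)) (hbound k s (abs_le.2 ⟨hs.1.le, hs.2.le⟩))
        (norm_nonneg _) hK0))
      (by norm_num) ((summable_nat_add_iff 1).2 (hsummable 0 (by simp))) hs2
    have hs3 : |s| ≤ 2 := abs_le.2 ⟨hs2.1.le, hs2.2.le⟩
    rw [(hsummable s hs3).tsum_mul_left] at h
    refine (h.const_add 1).congr_of_eventuallyEq ?_
    filter_upwards [isOpen_Ioo.mem_nhds hs2] with r hr
    exact hshift r hr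

/-- Grönwall's inequality for the distance to S. Starting at a nearest point p of S, the curve
exp(hM)p remains in S, and its velocity differs from that of u by at most K times the distance. -/
theorem mem_of_linear_ode [CompleteSpace 𝕄] [ProperSpace 𝕄] {S : Set 𝕄} (hS : IsClosed S)
    {M u : ℝ → 𝕄}
    (hM : Continuous M) (hMS : ∀ s h : ℝ, ∀ p ∈ S, NormedSpace.exp (h • M s) * p ∈ S)
    (hu : ∀ s ∈ Set.Icc (0 : ℝ) 1, HasDerivAt u (M s * u s) s) (hu0 : u 0 ∈ S) {s : ℝ}
    (hs : s ∈ Set.Icc (0 : ℝ) 1) : u s ∈ S := by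
  have hne : S.Nonempty := ⟨_, hu0⟩
  obtain ⟨K, hK⟩ := (isCompact_Icc (a := (0 : ℝ)) (b := 1)).exists_bound_of_continuousOn
    hM.continuousOn
  have hcont : ContinuousOn u (Set.Icc 0 1) := fun s hs => (hu s hs).continuousAt.continuousWithinAt
  have h := le_gronwallBound_of_liminf_deriv_right_le (f := fun s => Metric.infDist (u s) S)
    (f' := fun s => K * Metric.infDist (u s) S) (δ := 0) (K := K) (ε := 0) (a := 0) (b := 1)
    ((Metric.continuous_infDist_pt S).comp_continuousOn hcont) ?_
    (by simp [Metric.infDist_zero_of_mem hu0]) (fun x _ => by simp) s hs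
  · rw [gronwallBound_ε0_δ0] at h
    exact (hS.mem_iff_infDist_zero hne).2 (le_antisymm h Metric.infDist_nonneg)
  · intro x hx r hr
    have hx' : x ∈ Set.Icc (0 : ℝ) 1 := ⟨hx.1, hx.2.le⟩
    obtain ⟨p, hpS, hp⟩ := hS.exists_infDist_eq_dist hne (u x)
    have h1 : HasDerivAt (fun y => NormedSpace.exp ((y - x) • M x) * p) (M x * p) x := by
      have h2 := (hasDerivAt_exp_smul_const (𝕂 := ℝ) (M x) (x - x)).comp_sub_const x x
      simpa using h2.mul_const p
    have h3 := ((hu x hx').sub h1).hasDerivWithinAt (s := Set.Ici x)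
    have hlt : ‖M x * u x - M x * p‖ < r := by
      rw [← mul_sub]
      refine lt_of_le_of_lt ((norm_mul_le _ _).trans ?_) hr
      rw [hp, dist_eq_norm]
      exact mul_le_mul_of_nonneg_right (hK x hx') (norm_nonneg _)
    refine (((h3.limsup_slope_norm_le hlt).filter_mono
      (nhdsWithin_mono x Set.Ioi_subset_Ici_self)).and self_mem_nhdsWithin).frequently.mono ?_
    rintro y ⟨hy, hxy⟩
    refine lt_of_le_of_lt ?_ hy
    have hxy' : 0 < y - x := sub_pos.2 hxy
    rw [Real.norm_of_nonneg hxy'.le]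
    refine mul_le_mul_of_nonneg_left ?_ (inv_nonneg.2 hxy'.le)
    refine sub_le_sub ?_ (le_of_eq ?_)
    · rw [Pi.sub_apply, ← dist_eq_norm]
      exact Metric.infDist_le_dist_of_mem (hMS _ _ _ hpS)
    · rw [hp, dist_eq_norm]
      simp

end LinearODE

/-! ### Parallel transport of a flat connection -/

section FlatConnection

variable {𝕄 Z : Type*} [NormedRing 𝕄] [NormedAlgebra ℝ 𝕄] [NormedAddCommGroup Z]
  [NormedSpace ℝ Z] {B : Z → Z →L[ℝ] 𝕄} {u : Z → ℝ → 𝕄}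

/-- The differentiated curve is the first-order guess for the transport along the ray through z + w.
-/
lemma hasDerivAt_radial (hB : Differentiable ℝ B) {z w : Z} {s : ℝ}
    (hu : HasDerivAt (u z) (B (s • z) z * u z s) s) :
    HasDerivAt (fun s => u z s + s • (B (s • z) w * u z s))
      (B (s • z) z * u z s + (B (s • z) w * u z s
        + s • (fderiv ℝ B (s • z) z w * u z s + B (s • z) w * (B (s • z) z * u z s)))) s := by
  have h1 : HasDerivAt (fun s : ℝ => s • z) z s := by
    simpa using (hasDerivAt_id s).smul_const z
  have h2 : HasDerivAt (fun s : ℝ => B (s • z) w) (fderiv ℝ B (s • z) z w) s := by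
    have h : HasDerivAt (fun s : ℝ => B (s • z)) (fderiv ℝ B (s • z) z) s :=
      (hB (s • z)).hasFDerivAt.comp_hasDerivAt s h1
    simpa using h.clm_apply (hasDerivAt_const s w)
  have h3 := (hasDerivAt_id s).smul (h2.mul hu)
  refine (hu.add h3).congr_deriv ?_
  simp [add_comm]

lemma norm_sub_sub_fderiv_le (hB : ContDiff ℝ 2 B) [ProperSpace Z] (r : ℝ) :
    ∃ K, 0 ≤ K ∧ (∀ y ∈ Metric.closedBall (0 : Z) r, ‖B y‖ ≤ K) ∧
      (∀ y ∈ Metric.closedBall (0 : Z) r, ‖fderiv ℝ B y‖ ≤ K) ∧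
      ∀ y ∈ Metric.closedBall (0 : Z) r, ∀ h, y + h ∈ Metric.closedBall (0 : Z) r →
        ‖B (y + h) - B y - fderiv ℝ B y h‖ ≤ K * ‖h‖ ^ 2 := by
  have hB' : ContDiff ℝ 1 (fderiv ℝ B) := hB.fderiv_right (by norm_num)
  have hc := isCompact_closedBall (0 : Z) r
  obtain ⟨K0, h0⟩ := hc.exists_bound_of_continuousOn hB.continuous.continuousOn
  obtain ⟨K1, h1⟩ := hc.exists_bound_of_continuousOn (E := Z →L[ℝ] Z →L[ℝ] 𝕄)
    hB'.continuous.continuousOn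
  obtain ⟨K2, h2⟩ := hc.exists_bound_of_continuousOn
    (hB'.continuous_fderiv (by norm_num)).norm.continuousOn
  simp only [norm_norm] at h2
  refine ⟨max (max K0 K1) (max K2 0), by simp, fun y hy => (h0 y hy).trans (by simp),
    fun y hy => (h1 y hy).trans (by simp), fun y hy h hyh => ?_⟩
  have hseg : segment ℝ y (y + h) ⊆ Metric.closedBall 0 r :=
    (convex_closedBall (0 : Z) r).segment_subset hy hyh
  have hK2 : K2 ≤ max (max K0 K1) (max K2 0) := by simp
  have hlip : ∀ x ∈ segment ℝ y (y + h), ‖fderiv ℝ B x - fderiv ℝ B y‖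
      ≤ max (max K0 K1) (max K2 0) * ‖h‖ := by
    intro x hx
    refine (Convex.norm_image_sub_le_of_norm_fderiv_le (𝕜 := ℝ) (C := K2)
      (fun x _ => hB'.differentiable (by norm_num) x) (fun x hx => h2 x hx)
      (convex_closedBall (0 : Z) r) hy (hseg hx)).trans ?_
    have hxy : ‖x - y‖ ≤ ‖h‖ := by
      have := norm_sub_le_of_mem_segment hx
      simpa using this
    have : 0 ≤ max (max K0 K1) (max K2 0) := by simp
    gcongr
  have := Convex.norm_image_sub_le_of_norm_fderiv_le' (𝕜 := ℝ) (f := B) (φ := fderiv ℝ B y)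
    (fun x _ => hB.differentiable (by norm_num) x) hlip (convex_segment y (y + h))
    (left_mem_segment ℝ y (y + h)) (right_mem_segment ℝ y (y + h))
  rw [add_sub_cancel_left] at this
  linarith [this, pow_two ‖h‖, mul_assoc (max (max K0 K1) (max K2 0)) ‖h‖ ‖h‖]

theorem hasFDerivAt_transport [ProperSpace Z] (hB : ContDiff ℝ 2 B)
    (hflat : ∀ z w w', fderiv ℝ B z w w' - fderiv ℝ B z w' w = B z w * B z w' - B z w' * B z w)
    (hu0 : ∀ z, u z 0 = 1)
    (hu : ∀ z, ∀ s ∈ Set.Icc (0 : ℝ) 1, HasDerivAt (u z) (B (s • z) z * u z s) s) (z : Z) :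
    HasFDerivAt (fun z => u z 1)
      (((ContinuousLinearMap.mul ℝ 𝕄).flip (u z 1)).comp (B z)) z := by
  set r := ‖z‖ + 1 with hr
  have hr0 : 0 ≤ r := by positivity
  obtain ⟨K, hK, hK0, hK1, hK2⟩ := norm_sub_sub_fderiv_le hB r
  obtain ⟨L, hL⟩ := (isCompact_Icc (a := (0 : ℝ)) (b := 1)).exists_bound_of_continuousOn
    (f := u z) fun s hs => (hu z s hs).continuousAt.continuousWithinAt
  have hL0 : 0 ≤ L := (norm_nonneg _).trans (hL 0 (by simp))
  have hball : ∀ s ∈ Set.Icc (0 : ℝ) 1, ∀ y : Z, ‖y‖ ≤ r → s • y ∈ Metric.closedBall (0 : Z) r := by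
    intro s hs y hy
    rw [mem_closedBall_zero_iff, norm_smul, Real.norm_of_nonneg hs.1]
    exact (mul_le_of_le_one_left (norm_nonneg _) hs.2).trans hy
  -- In the equation on the ray through z + w, c|w|² bounds the second-order part of the change of
  -- the coefficient, c'|w| the whole change, and D|w|² the defect of the first-order guess.
  set c := K + K * r with hc
  have hc0 : 0 ≤ c := by positivity
  set c' := K + K * r + c with hc'
  have hc0' : 0 ≤ c' := by positivity
  set D := c * L + c' * (K * L) with hD
  have hD0 : 0 ≤ D := by positivity
  -- Grönwall compares the true transport with the guess. The Lipschitz constant Kr is enlarged by 1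
  -- to keep it nonzero, as the closed form of `gronwallBound` requires.
  have key : ∀ w : Z, ‖w‖ ≤ 1 → ‖u (z + w) 1 - (u z 1 + B z w * u z 1)‖
      ≤ gronwallBound 0 (K * r + 1) (D * ‖w‖ ^ 2) 1 := by
    intro w hw
    have hzw : ‖z + w‖ ≤ r := (norm_add_le _ _).trans (by linarith)
    have hz : ‖z‖ ≤ r := by linarith
    have hkr : 0 ≤ K * r + 1 := by positivity
    have hmem : ∀ t ∈ Set.Ico (0 : ℝ) 1, t ∈ Set.Icc (0 : ℝ) 1 := fun t ht => ⟨ht.1, ht.2.le⟩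
    have hd := fun t (ht : t ∈ Set.Icc (0 : ℝ) 1) =>
      hasDerivAt_radial (w := w) (hB.differentiable (by norm_num)) (hu z t ht)
    have := dist_le_of_approx_trajectories_ODE_of_mem (a := 0) (b := 1) (δ := 0)
      (v := fun t x => B (t • (z + w)) (z + w) * x) (s := fun _ => Set.univ)
      (K := ⟨K * r + 1, hkr⟩) (f := u (z + w)) (f' := fun t => B (t • (z + w)) (z + w) * u (z + w) t)
      (g := fun t => u z t + t • (B (t • z) w * u z t)) (εf := 0) (εg := D * ‖w‖ ^ 2)
      ?_ (fun t ht => (hu _ t ht).continuousAt.continuousWithinAt)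
      (fun t ht => (hu _ t (hmem t ht)).hasDerivWithinAt) (by simp) (by simp)
      (fun t ht => (hd t ht).continuousAt.continuousWithinAt)
      (fun t ht => (hd t (hmem t ht)).hasDerivWithinAt) ?_ (by simp) (by simp [hu0]) 1 (by simp)
    · rw [dist_eq_norm, sub_zero, zero_add, one_smul, one_smul] at this
      exact this
    · intro t ht
      refine LipschitzWith.lipschitzOnWith (LipschitzWith.of_dist_le_mul fun x y => ?_)
      rw [dist_eq_norm, dist_eq_norm, ← mul_sub]
      refine (norm_mul_le _ _).trans (mul_le_mul_of_nonneg_right ?_ (norm_nonneg _))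
      change _ ≤ K * r + 1
      have := (B (t • (z + w))).le_of_opNorm_le (hK0 _ (hball t (hmem t ht) _ hzw)) (z + w)
      have h2 : K * ‖z + w‖ ≤ K * r := by gcongr
      linarith
    · intro t ht
      have ht' := hmem t ht
      set b := B (t • z)
      set b' := fderiv ℝ B (t • z)
      have hb : ‖b‖ ≤ K := hK0 _ (hball t ht' z hz)
      have hb' : ‖b'‖ ≤ K := hK1 _ (hball t ht' z hz)
      set x := u z t
      have hx : ‖x‖ ≤ L := hL t ht'
      have ht1 : ‖t‖ ≤ 1 := by rw [Real.norm_of_nonneg ht.1]; exact ht.2.le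
      set E := B (t • (z + w)) - b - b' (t • w) with hE
      have hEn : ‖E‖ ≤ K * ‖w‖ ^ 2 := by
        have h1 := hK2 (t • z) (hball t ht' z hz) (t • w)
          (by rw [← smul_add]; exact hball t ht' _ hzw)
        rw [← smul_add] at h1
        refine h1.trans ?_
        rw [norm_smul]
        gcongr
        exact mul_le_of_le_one_left (norm_nonneg _) ht1
      set Rm := t • b' w w + E (z + w) with hRm
      have hR : ‖Rm‖ ≤ c * ‖w‖ ^ 2 := by
        have h1 : ‖t • b' w w‖ ≤ K * ‖w‖ ^ 2 := by
          rw [norm_smul]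
          have h2 : ‖b' w w‖ ≤ K * ‖w‖ ^ 2 := by
            refine (b'.le_opNorm₂ w w).trans ?_
            rw [mul_assoc, ← pow_two]
            gcongr
          exact (mul_le_of_le_one_left (norm_nonneg _) ht1).trans h2
        have h3 : ‖E (z + w)‖ ≤ K * ‖w‖ ^ 2 * r := by
          refine (E.le_of_opNorm_le hEn _).trans ?_
          gcongr
        calc ‖Rm‖ ≤ _ := norm_add_le _ _
          _ ≤ K * ‖w‖ ^ 2 + K * ‖w‖ ^ 2 * r := add_le_add h1 h3
          _ = c * ‖w‖ ^ 2 := by rw [hc]; ring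
      set Q := b w + t • b' w z + Rm with hQ
      have hQn : ‖Q‖ ≤ c' * ‖w‖ := by
        have h1 : ‖b w‖ ≤ K * ‖w‖ := b.le_of_opNorm_le hb w
        have h2 : ‖t • b' w z‖ ≤ K * r * ‖w‖ := by
          rw [norm_smul]
          refine (mul_le_of_le_one_left (norm_nonneg _) ht1).trans ((b'.le_opNorm₂ w z).trans ?_)
          calc ‖b'‖ * ‖w‖ * ‖z‖ ≤ K * ‖w‖ * r := by gcongr
            _ = K * r * ‖w‖ := by ring
        have h3 : ‖Rm‖ ≤ c * ‖w‖ := by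
          refine hR.trans ?_
          gcongr
          rw [pow_two]
          exact mul_le_of_le_one_left (norm_nonneg _) hw
        calc ‖Q‖ ≤ _ := norm_add₃_le
          _ ≤ K * ‖w‖ + K * r * ‖w‖ + c * ‖w‖ := by gcongr
          _ = c' * ‖w‖ := by rw [hc']; ring
      have hM : B (t • (z + w)) (z + w) = b z + Q := by
        have : B (t • (z + w)) = b + t • b' w + E := by
          rw [hE, map_smul]; abel
        rw [hQ, hRm, this]
        simp only [_root_.add_apply, _root_.smul_apply, map_add]
        abel
      -- Flatness enters here: exchanging the arguments of the derivative yields precisely the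
      -- commutator needed to cancel the terms of first order in w.
      have hfl : b' z w = b' w z + (b z * b w - b w * b z) := by
        rw [← hflat (t • z) z w]; abel
      have hdiff : b z * x + (b w * x + t • (b' z w * x + b w * (b z * x)))
          - B (t • (z + w)) (z + w) * (x + t • (b w * x))
          = -(Rm * x) - t • (Q * (b w * x)) := by
        rw [hM, hfl, hQ]
        simp only [add_mul, mul_add, sub_mul, smul_add, smul_sub, mul_smul_comm, smul_mul_assoc,
          mul_assoc]
        abel
      rw [dist_eq_norm, hdiff]
      calc ‖-(Rm * x) - t • (Q * (b w * x))‖ ≤ ‖Rm * x‖ + ‖t • (Q * (b w * x))‖ := by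
            rw [← norm_neg (Rm * x)]; exact norm_sub_le _ _
        _ ≤ c * ‖w‖ ^ 2 * L + c' * ‖w‖ * (K * ‖w‖ * L) := by
            refine add_le_add ((norm_mul_le _ _).trans (by gcongr)) ?_
            rw [norm_smul]
            refine (mul_le_of_le_one_left (norm_nonneg _) ht1).trans ((norm_mul_le _ _).trans ?_)
            have h1 : ‖b w * x‖ ≤ K * ‖w‖ * L :=
              (norm_mul_le _ _).trans (mul_le_mul (b.le_of_opNorm_le hb w) hx (norm_nonneg _)
                (by positivity))
            gcongr
        _ = D * ‖w‖ ^ 2 := by rw [hD]; ring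
  rw [hasFDerivAt_iff_isLittleO_nhds_zero]
  have hO : (fun w => u (z + w) 1 - u z 1
      - (((ContinuousLinearMap.mul ℝ 𝕄).flip (u z 1)).comp (B z)) w)
      =O[𝓝 0] fun w : Z => ‖w‖ ^ 2 := by
    have hne : K * r + 1 ≠ 0 := by positivity
    refine Asymptotics.IsBigO.of_bound (D / (K * r + 1) * (Real.exp (K * r + 1) - 1)) ?_
    filter_upwards [Metric.closedBall_mem_nhds (0 : Z) one_pos] with w hw
    have := key w (mem_closedBall_zero_iff.1 hw)
    rw [gronwallBound_of_K_ne_0 hne] at this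
    rw [sub_sub]
    refine this.trans (le_of_eq ?_)
    simp
    ring
  refine hO.trans_isLittleO ?_
  simpa using (Asymptotics.isLittleO_norm_pow_id (E' := Z) one_lt_two)

/-- Transport along rays from the origin is differentiable with dU = BU, and this equation raises
the regularity of U one order at a time. -/
theorem exists_transport [CompleteSpace 𝕄] [ProperSpace Z] (hB : ContDiff ℝ ∞ B)
    (hflat : ∀ z w w', fderiv ℝ B z w w' - fderiv ℝ B z w' w = B z w * B z w' - B z w' * B z w) :
    ∃ U : Z → 𝕄, ContDiff ℝ ∞ U ∧ (∀ z w, fderiv ℝ U z w = B z w * U z) ∧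
      ∀ z, ∃ v : ℝ → 𝕄, v 0 = 1 ∧ v 1 = U z ∧
        ∀ s ∈ Set.Icc (0 : ℝ) 1, HasDerivAt v (B (s • z) z * v s) s := by
  have hex : ∀ z, ∃ v : ℝ → 𝕄, v 0 = 1 ∧
      ∀ s ∈ Set.Icc (0 : ℝ) 1, HasDerivAt v (B (s • z) z * v s) s := by
    intro z
    have := hB.continuous
    exact exists_linear_ode (M := fun s => B (s • z) z) (by fun_prop)
  choose u hu0 hu using hex
  have hd := hasFDerivAt_transport (hB.of_le (by norm_cast)) hflat hu0 hu
  refine ⟨fun z => u z 1, ?_, fun z w => by rw [(hd z).fderiv]; rfl,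
    fun z => ⟨u z, hu0 z, rfl, hu z⟩⟩
  rw [contDiff_infty]
  intro n
  induction n with
  | zero => exact contDiff_zero.2 (continuous_iff_continuousAt.2 fun z => (hd z).continuousAt)
  | succ n ih =>
    push_cast
    rw [contDiff_succ_iff_fderiv]
    refine ⟨fun z => (hd z).differentiableAt, by simp, ?_⟩
    rw [funext fun z => (hd z).fderiv]
    have hBn : ContDiff ℝ n B := hB.of_le (by exact_mod_cast le_top)
    exact (((ContinuousLinearMap.mul ℝ 𝕄).flip.contDiff).comp ih).clm_comp hBn

end FlatConnection

/-! ### Vanishing field strength implies pure gauge -/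

section PureGauge

/-- The coordinates of space-time. -/
def coord : Fin 4 → Spacetime →L[ℝ] ℝ :=
  Fin.cons (ContinuousLinearMap.fst ℝ ℝ Space) fun i =>
    (EuclideanSpace.proj i : Space →L[ℝ] ℝ).comp (ContinuousLinearMap.snd ℝ ℝ Space)

lemma sum_coord_smul_coordVec (w : Spacetime) : ∑ μ, coord μ w • coordVec μ = w := by
  rw [Fin.sum_univ_succ]
  simp only [coord, coordVec, Fin.cons_zero, Fin.cons_succ]
  refine Prod.ext (by simp [Prod.fst_sum]) ?_
  simpa [Prod.snd_sum] using (EuclideanSpace.basisFun (Fin 3) ℝ).sum_repr w.2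

lemma coord_coordVec (μ ν : Fin 4) : coord μ (coordVec ν) = if μ = ν then 1 else 0 := by
  refine Fin.cases ?_ (fun i => ?_) μ <;> refine Fin.cases ?_ (fun j => ?_) ν <;>
    simp [coord, coordVec, Fin.succ_ne_zero, (Fin.succ_ne_zero _).symm]

lemma fderiv_eq_sum_pd {E : Type*} [NormedAddCommGroup E] [NormedSpace ℝ E]
    (f : Spacetime → E) (z w : Spacetime) : fderiv ℝ f z w = ∑ μ, coord μ w • pd μ f z := by
  conv_lhs => rw [← sum_coord_smul_coordVec w]
  simp [pd]

lemma pd_sum_smul {E ι : Type*} [NormedAddCommGroup E] [NormedSpace ℝ E] [Fintype ι]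
    {f : ι → Spacetime → ℝ} (T : ι → E) {μ : Fin 4} {z : Spacetime}
    (hf : ∀ i, DifferentiableAt ℝ (f i) z) :
    pd μ (fun y => ∑ i, f i y • T i) z = ∑ i, pd μ (f i) z • T i := by
  rw [pd, (HasFDerivAt.fun_sum fun i _ => (hf i).hasFDerivAt.smul_const (T i)).fderiv]
  simp [pd]

section ConnectionForm

variable {𝕄 : Type*} [NormedRing 𝕄] [NormedAlgebra ℝ 𝕄] {X : Fin 4 → Spacetime → 𝕄}

/-- The connection form `X_μ dx^μ`. -/
def connectionForm (X : Fin 4 → Spacetime → 𝕄) (z : Spacetime) : Spacetime →L[ℝ] 𝕄 :=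
  ∑ μ, (coord μ).smulRight (X μ z)

lemma connectionForm_apply (z w : Spacetime) :
    connectionForm X z w = ∑ μ, coord μ w • X μ z := by
  simp [connectionForm]

lemma contDiff_connectionForm (hX : ∀ μ, ContDiff ℝ ∞ (X μ)) :
    ContDiff ℝ ∞ (connectionForm X) := by
  unfold connectionForm
  exact ContDiff.sum fun μ _ => contDiff_const.smulRight (hX μ)

lemma fderiv_connectionForm (hX : ∀ μ, ContDiff ℝ ∞ (X μ)) (z w w' : Spacetime) :
    fderiv ℝ (connectionForm X) z w w'
      = ∑ μ, ∑ ν, (coord μ w * coord ν w') • pd μ (X ν) z := by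
  have h1 := (((contDiff_connectionForm hX).differentiable (by simp)
    z).hasFDerivAt.clm_apply (hasFDerivAt_const w' z)).fderiv
  have h2 : (fun y => connectionForm X y w') = fun y => ∑ ν, coord ν w' • X ν y :=
    funext fun y => connectionForm_apply y w'
  have h3 := (HasFDerivAt.fun_sum (u := Finset.univ) fun ν _ =>
    (((hX ν).differentiable (by simp) z).hasFDerivAt.const_smul (coord ν w'))).fderiv
  have h4 := congrArg (fun L => L w) (h1.symm.trans ((congrArg (fun f => fderiv ℝ f z) h2).trans h3))
  have h5 : fderiv ℝ (connectionForm X) z w w'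
      = ∑ ν, coord ν w' • ∑ μ, coord μ w • pd μ (X ν) z := by
    simpa [fderiv_eq_sum_pd _ z w] using h4
  rw [h5]
  simp only [Finset.smul_sum, smul_smul]
  rw [Finset.sum_comm]
  simp only [mul_comm]

lemma connectionForm_flat (hX : ∀ μ, ContDiff ℝ ∞ (X μ))
    (hF : ∀ μ ν z, pd μ (X ν) z - pd ν (X μ) z = X μ z * X ν z - X ν z * X μ z)
    (z w w' : Spacetime) :
    fderiv ℝ (connectionForm X) z w w' - fderiv ℝ (connectionForm X) z w' w
      = connectionForm X z w * connectionForm X z w'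
        - connectionForm X z w' * connectionForm X z w := by
  have h : ∑ μ, ∑ ν, (coord μ w' * coord ν w) • pd μ (X ν) z
      = ∑ μ, ∑ ν, (coord μ w * coord ν w') • pd ν (X μ) z := by
    rw [Finset.sum_comm]
    simp only [mul_comm]
  have h' : ∑ μ, ∑ ν, (coord μ w' * coord ν w) • (X μ z * X ν z)
      = ∑ μ, ∑ ν, (coord μ w * coord ν w') • (X ν z * X μ z) := by
    rw [Finset.sum_comm]
    simp only [mul_comm (coord _ w')]
  simp only [fderiv_connectionForm hX, connectionForm_apply, Finset.sum_mul_sum,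
    smul_mul_smul_comm]
  rw [h, h']
  simp only [← Finset.sum_sub_distrib, ← smul_sub, hF]

/-- A flat potential with values in the tangent directions of a closed set is a pure gauge. -/
theorem exists_pureGauge [CompleteSpace 𝕄] [ProperSpace 𝕄] (hX : ∀ μ, ContDiff ℝ ∞ (X μ))
    (hF : ∀ μ ν z, pd μ (X ν) z - pd ν (X μ) z = X μ z * X ν z - X ν z * X μ z)
    {S : Set 𝕄} (hS : IsClosed S) (h1 : (1 : 𝕄) ∈ S)
    (hXS : ∀ (z : Spacetime) (c : Fin 4 → ℝ) (h : ℝ), ∀ p ∈ S,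
      NormedSpace.exp (h • ∑ μ, c μ • X μ z) * p ∈ S) :
    ∃ U : Spacetime → 𝕄, (∀ z, U z ∈ S) ∧ ContDiff ℝ ∞ U ∧
      ∀ μ z, pd μ U z = X μ z * U z := by
  have hB := contDiff_connectionForm hX
  obtain ⟨U, hU, hdU, hmem⟩ := exists_transport hB (connectionForm_flat hX hF)
  refine ⟨U, fun z => ?_, hU, fun μ z => ?_⟩
  · obtain ⟨v, hv0, hv1, hv⟩ := hmem z
    rw [← hv1]
    have hc := hB.continuous
    refine mem_of_linear_ode hS (M := fun s => connectionForm X (s • z) z)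
      (by fun_prop) (fun s h p hp => ?_) hv (hv0 ▸ h1) (by simp)
    simp only [connectionForm_apply]
    exact hXS _ (fun μ => coord μ z) h p hp
  · rw [pd, hdU, connectionForm_apply]
    simp only [coord_coordVec, ite_smul, one_smul, zero_smul, Finset.sum_ite_eq',
      Finset.mem_univ, if_true]

end ConnectionForm

/-! ### Application to the matrix gauge group -/

section Matrices

attribute [local instance] Matrix.linftyOpNormedRing Matrix.linftyOpNormedAlgebra

variable {N n : ℕ} {𝒢 : GaugeGroup N n} {g : ℝ} {A : Spacetime → Fin 4 → Fin n → ℝ}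

/-- The matrix-valued gauge potential `i g A_μ^a τ^a`. -/
def matrixPotential (𝒢 : GaugeGroup N n) (g : ℝ) (A : Spacetime → Fin 4 → Fin n → ℝ) (μ : Fin 4)
    (z : Spacetime) : Matrix (Fin N) (Fin N) ℂ :=
  (Complex.I * (g : ℂ)) • lieComb 𝒢.τ (A z μ)

lemma contDiff_component (hA : ContDiff ℝ ∞ A) (μ : Fin 4) (a : Fin n) :
    ContDiff ℝ ∞ (fun z => A z μ a) := by
  fun_prop

lemma matrixPotential_eq (μ : Fin 4) : matrixPotential 𝒢 g A μ
    = fun z => ∑ a, A z μ a • ((Complex.I * (g : ℂ)) • 𝒢.τ a) := by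
  funext z
  rw [matrixPotential, lieComb, Finset.smul_sum]
  exact Finset.sum_congr rfl fun a _ => smul_comm _ _ _

lemma contDiff_matrixPotential (hA : ContDiff ℝ ∞ A) (μ : Fin 4) :
    ContDiff ℝ ∞ (matrixPotential 𝒢 g A μ) := by
  rw [matrixPotential_eq]
  exact ContDiff.sum fun a _ => (contDiff_component hA μ a).smul contDiff_const

lemma pd_matrixPotential (hA : ContDiff ℝ ∞ A) (μ ν : Fin 4) (z : Spacetime) :
    pd μ (matrixPotential 𝒢 g A ν) z
      = (Complex.I * (g : ℂ)) • lieComb 𝒢.τ (gradA A z μ ν) := by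
  rw [matrixPotential_eq, pd_sum_smul _ fun a =>
    (contDiff_component hA ν a).differentiable (by simp) z, lieComb, Finset.smul_sum]
  exact Finset.sum_congr rfl fun a _ => smul_comm _ _ _

/-- With F = 0 the curl of A is minus the structure bracket, which the factor (ig)² converts into
the matrix commutator. -/
lemma pd_matrixPotential_sub (hA : ContDiff ℝ ∞ A)
    (hF : ∀ μ ν a z, fieldStrength 𝒢 g A μ ν a z = 0) (μ ν : Fin 4) (z : Spacetime) :
    pd μ (matrixPotential 𝒢 g A ν) z - pd ν (matrixPotential 𝒢 g A μ) z
      = matrixPotential 𝒢 g A μ z * matrixPotential 𝒢 g A ν z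
        - matrixPotential 𝒢 g A ν z * matrixPotential 𝒢 g A μ z := by
  have h1 : gradA A z μ ν = gradA A z ν μ + (-1 : ℝ) • structBracket 𝒢.C g (A z μ) (A z ν) := by
    funext a
    have := hF μ ν a z
    simp only [fieldStrength, curv] at this
    simp only [structBracket, Pi.add_apply, Pi.smul_apply, smul_eq_mul]
    linarith
  have h2 := lieComb_commutator 𝒢 𝒢.comm g (A z μ) (A z ν)
  rw [pd_matrixPotential hA, pd_matrixPotential hA, h1, lieComb_add, lieComb_smul, smul_add,
    add_sub_cancel_left, mul_comm Complex.I, mul_smul, smul_comm Complex.I, ← h2]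
  simp only [matrixPotential, smul_mul_smul_comm, ← smul_sub]
  rw [← Complex.coe_smul, smul_smul, smul_smul]
  congr 1
  push_cast
  linear_combination (-(g : ℂ) ^ 2) * Complex.I_mul_I

lemma sum_matrixPotential_mem_span (c : Fin 4 → ℝ) (z : Spacetime) :
    ∃ Y ∈ Submodule.span ℝ (Set.range 𝒢.τ),
      ∑ μ, c μ • matrixPotential 𝒢 g A μ z = Complex.I • Y := by
  refine ⟨∑ μ, c μ • g • lieComb 𝒢.τ (A z μ), ?_, ?_⟩
  · refine Submodule.sum_mem _ fun μ _ => Submodule.smul_mem _ _ (Submodule.smul_mem _ _ ?_)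
    exact Submodule.sum_mem _ fun a _ => Submodule.smul_mem _ _
      (Submodule.subset_span (Set.mem_range_self a))
  · rw [Finset.smul_sum]
    refine Finset.sum_congr rfl fun μ _ => ?_
    rw [matrixPotential, smul_comm Complex.I, mul_smul, Complex.coe_smul]

/-- The matrices of the gauge group. -/
def GaugeGroup.carrier (𝒢 : GaugeGroup N n) : Set (Matrix (Fin N) (Fin N) ℂ) :=
  Subtype.val '' (𝒢.G : Set (Matrix.unitaryGroup (Fin N) ℂ))

lemma GaugeGroup.isClosed_carrier : IsClosed 𝒢.carrier :=
  (isClosed_unitary (R := Matrix (Fin N) (Fin N) ℂ)).isClosedEmbedding_subtypeVal.isClosedMap _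
    𝒢.isClosed

theorem isPureGauge_of_fieldStrength_eq_zero (hA : ContDiff ℝ ∞ A)
    (hF : ∀ μ ν a z, fieldStrength 𝒢 g A μ ν a z = 0) : IsPureGauge 𝒢 g A := by
  have : ProperSpace (Matrix (Fin N) (Fin N) ℂ) := FiniteDimensional.proper ℝ _
  obtain ⟨U, hUG, hU, hdU⟩ := exists_pureGauge (contDiff_matrixPotential (𝒢 := 𝒢) (g := g) hA)
    (pd_matrixPotential_sub hA hF) 𝒢.isClosed_carrier ⟨1, 𝒢.G.one_mem, rfl⟩ (by
      rintro z c h _ ⟨p, hp, rfl⟩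
      obtain ⟨Y, hY, hYe⟩ := sum_matrixPotential_mem_span (𝒢 := 𝒢) (g := g) (A := A) c z
      -- Membership in the span of the generators means that the one-parameter group lies in G, so
      -- left multiplication by its elements preserves G.
      obtain ⟨W, hW, hWe⟩ := (𝒢.lieAlgebra_iff Y).1 hY h
      refine ⟨W * p, 𝒢.G.mul_mem hW hp, ?_⟩
      rw [hYe]
      exact congrArg (fun x => x * (p : Matrix (Fin N) (Fin N) ℂ)) hWe)
  choose W hW hWU using hUG
  have hentry : ∀ p q, (fun z => (W z : Matrix (Fin N) (Fin N) ℂ) p q)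
      = (Matrix.entryLinearMap ℝ ℂ p q).toContinuousLinearMap ∘ U := by
    intro p q
    funext z
    rw [hWU]
    rfl
  refine ⟨W, hW, fun p q => ?_, fun μ z p q => ?_⟩
  · rw [hentry]
    exact (ContinuousLinearMap.contDiff _).comp hU
  · have h1 := ((Matrix.entryLinearMap ℝ ℂ p q).toContinuousLinearMap.hasFDerivAt.comp z
      ((hU.differentiable (by simp) z).hasFDerivAt)).fderiv
    rw [pd, hentry, h1, hWU]
    exact congrArg (fun x : Matrix (Fin N) (Fin N) ℂ => x p q) (hdU μ z)

end Matrices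

end PureGauge

end YangMillsScalar

end

theorem theorem1 {N n d : ℕ} (𝒢 : GaugeGroup N n) (R : Generators 𝒢 d) (g : ℝ)
    (V : ℝ → ℝ) (hV : DifferentiableOn ℝ V (Set.Ici 0)) (hV0 : V 0 = 0)
    (φ : Spacetime → EuclideanSpace ℂ (Fin d)) (A : Spacetime → Fin 4 → Fin n → ℝ)
    (hφ : ContDiff ℝ ∞ φ) (hA : ContDiff ℝ ∞ A)
    (hEOM : EquationsOfMotion 𝒢 R g V φ A)
    (hlim : VanishAtSpatialInfinity φ A)
    (P : ℝ) (hP : 0 < P)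
    (Ω : Matrix (Fin 3) (Fin 3) ℝ) (hΩ : Ω ∈ Matrix.specialOrthogonalGroup (Fin 3) ℝ)
    (l : Space) (hΩl : Matrix.toEuclideanLin Ω l = l) (hl : ‖l‖ / P < 1)
    (hper : PeriodicUpTo φ A P Ω l)
    (hfin : FiniteIntegrals 𝒢 R g V φ A P)
    (hineq : ∃ γ : ℝ, 1 / 2 < γ ∧ γ ≤ 3 / 2 ∧ ∀ z : Spacetime,
      0 ≤ 2 * γ * derivWithin V (Set.Ici 0) (‖φ z‖ ^ 2) * ‖φ z‖ ^ 2 - 3 * V (‖φ z‖ ^ 2)) :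
    (∀ z, φ z = 0) ∧ (∀ μ ν a z, fieldStrength 𝒢 g A μ ν a z = 0) ∧
      IsPureGauge 𝒢 g A := by
  obtain ⟨v, Q, h⟩ := exists_periodicSolution hV hφ hA hEOM hlim hP hΩ hΩl hl hper hfin
  obtain ⟨γ, hγ, hγ', hineq⟩ := hineq
  obtain ⟨h1, h2⟩ := h.eq_zero hγ hγ' fun z => by
    have := hineq z
    rw [force, real_inner_smul_left, real_inner_self_eq_norm_sq]
    linarith
  have h3 : ∀ μ ν a z, fieldStrength 𝒢 g A μ ν a z = 0 := fun μ ν a z => by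
    rw [fieldStrength_eq R g hA, h2]
    rfl
  exact ⟨h1, h3, isPureGauge_of_fieldStrength_eq_zero hA h3⟩
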